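/- **Conventions.** Rings $k$, $l$ are $\mathbb Z$-graded and graded commutative ($ab=(-1)^{|a||b|}ba$); modules and algebras over them are graded, algebras are graded commutative and unital, and bilinear maps follow the Koszul sign rule. A functor $F$ from $\mathrm{Alg}_k$ (or $\mathrm{Mod}_k$) to $\mathrm{Mod}_l$ is called *formal* if for every $q\in\mathbb Z$ the set-valued functor $F(-)_q$ is represented by a pro-object $A^q$ (a small cofiltered system) of $\mathrm{Alg}_k$ (resp. $\mathrm{Mod}_k$), that is, $F(-)_q\cong\operatorname{colim}_i\mathrm{Hom}(A^q_i,-)$. A *formal $l$-module scheme* is a formal functor $\mathrm{Alg}_k\to\mathrm{Mod}_l$; a *formal $l$-algebra scheme* is a functor $\mathrm{Alg}_k\to\mathrm{Alg}_l$ whose underlying functor to $\mathrm{Mod}_l$ is formal; a *formal bimodule* is a formal functor $\mathrm{Mod}_k\to\mathrm{Mod}_l$. Such an object is *pro-flat* if its representing pro-modules (for schemes: the pro-modules underlying the representing pro-algebras) are pro-isomorphic to cofiltered systems of flat $k$-modules. * For formal module schemes, $F\otimes_l G$ is the formal module scheme with a universal natural $l$-bilinear map $\otimes\colon F\times G\to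 F\otimes_l G$. * For formal bimodules, $B\otimes_l C$ is the formal bimodule with a universal natural $l$-bilinear pairing $B(X)\times C(Y)\to (B\otimes_l C)(X\otimes_k Y)$. This is a tensor product with unit object $\mathbb 1$, and maps $\mathbb 1\to A$ are the elements of $A(k)_0$. An algebra is a monoid for $\otimes_l$. * $\mathcal Q(F)(M)=\ker\bigl(F(k\oplus M)\to F(k)\bigr)$, where $k\oplus M$ is the square-zero extension. * $\eta\colon F\to\mathcal P(F)|_{\mathrm{Alg}_k}$ is the universal map from $F$ to the restriction of a formal bimodule along the forgetful functor $\mathrm{Alg}_k\to\mathrm{Mod}_k$. * $c_F\colon\mathcal Q(F)\to\mathcal P(F)$ is the composite $\mathcal Q(F)(M)\subseteq F(k\oplus M)\xrightarrow{\eta}\mathcal P(F)(k\oplus M)\to\mathcal P(F)(M)$. * The lax structure $\varphi\colon\mathcal Q(F)\otimes_l\mathcal Q(G)\to\mathcal Q(F\otimes_l G)$ is the following map. For $x\in\mathcal Q(F)(M)\subseteq F(k\oplus M)$ and $y\in\mathcal Q(G)(N)\subseteq G(k\oplus N)$, the image of $\varphi(x\otimes y)\in\mathcal Q(F\otimes_lG)(M\otimes_k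 N)$ in $(F\otimes_l G)\bigl((k\oplus M)\otimes_k(k\oplus N)\bigr)$ is $x\otimes y$, where $x$ and $y$ are pushed forward to that algebra. **Proposition.** (i) Let $F,G$ be formal $l$-algebra schemes over $k$ such that $F,G,\mathcal P(F),\mathcal P(G),\mathcal Q(F),\mathcal Q(G)$ are pro-flat. Then $\varphi$ exists, is uniquely determined by the condition above, and factors as $$\mathcal Q(F)\otimes_l\mathcal Q(G)\to E\to\mathcal Q(F\otimes_l G),$$ where $E$ is the pushout, in formal bimodules, of $$\mathcal Q(F)\otimes_l\mathcal P(G)\xleftarrow{\ 1\otimes c_G\ }\mathcal Q(F)\otimes_l\mathcal Q(G)\xrightarrow{\ c_F\otimes 1\ }\mathcal P(F)\otimes_l\mathcal Q(G)$$ and the first map is the canonical one. (The pro-module representing $E$ in each degree is the corresponding fiber product of representing pro-modules.) (ii) Let $F$ be a formal $l$-algebra scheme over $k$ such that $F,\mathcal P(F),\mathcal Q(F)$ are pro-flat. There is exactly one algebra structure on $\mathcal P(F)$ for which $\eta$ is multiplicative and unital, i.e. for which the unit is $\eta(1)\in\mathcal P(F)(k)_0$ and, for all $R$ and $x,y\in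 F(R)$, the product of $\eta(x)$ and $\eta(y)$ in $\mathcal P(F)(R\otimes_kR)$ maps to $\eta(xy)$ under the multiplication $R\otimes_k R\to R$. The factorization of (i) with $F=G$ can be chosen such that the composites $$\mathcal P(F)\otimes_l\mathcal Q(F)\to E\to\mathcal Q(F\otimes_lF)\to\mathcal Q(F),\qquad \mathcal Q(F)\otimes_l\mathcal P(F)\to E\to\mathcal Q(F\otimes_lF)\to\mathcal Q(F),$$ whose last map is induced by the multiplication of $F$, make $\mathcal Q(F)$ a two-sided module over the algebra $\mathcal P(F)$: both actions are associative and unital, and they commute with each other. -/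

import Mathlib

open CategoryTheory Limits

universe u

namespace FormalPlethory

/-- A `ℤ`-graded ring, commutative with the Koszul sign: `a b = (-1)^{|a||b|} b a`.
The product of an element of degree `i` and one of degree `j` may be taken in any degree `n` that
comes with a proof of `i + j = n`. -/
structure GrRing where
  carrier : ℤ → Type u
  [grp : ∀ n, AddCommGroup (carrier n)]
  one : carrier 0
  mul : ∀ {i j n : ℤ}, i + j = n → carrier i → carrier j → carrier n
  mul_add : ∀ {i j n : ℤ} (h : i + j = n) (a : carrier i) (b c : carrier j),
    mul h a (b + c) = mul h a b + mul h a c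
  add_mul : ∀ {i j n : ℤ} (h : i + j = n) (a b : carrier i) (c : carrier j),
    mul h (a + b) c = mul h a c + mul h b c
  one_mul : ∀ {n : ℤ} (h : 0 + n = n) (a : carrier n), mul h one a = a
  mul_assoc : ∀ {i j m ij jm n : ℤ} (h₁ : i + j = ij) (h₂ : ij + m = n) (h₃ : j + m = jm)
    (h₄ : i + jm = n) (a : carrier i) (b : carrier j) (c : carrier m),
    mul h₂ (mul h₁ a b) c = mul h₄ a (mul h₃ b c)
  mul_comm : ∀ {i j n : ℤ} (h : i + j = n) (h' : j + i = n) (a : carrier i) (b : carrier j),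
    mul h a b = (i * j).negOnePow • mul h' b a

attribute [instance] GrRing.grp

/-- A graded module over `k`. It is written as a left module; the corresponding right action is
`m a = (-1)^{|a||m|} a m`. -/
structure GrMod (k : GrRing.{u}) where
  carrier : ℤ → Type u
  [grp : ∀ n, AddCommGroup (carrier n)]
  smul : ∀ {i j n : ℤ}, i + j = n → k.carrier i → carrier j → carrier n
  smul_add : ∀ {i j n : ℤ} (h : i + j = n) (a : k.carrier i) (x y : carrier j),
    smul h a (x + y) = smul h a x + smul h a y
  add_smul : ∀ {i j n : ℤ} (h : i + j = n) (a b : k.carrier i) (x : carrier j),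
    smul h (a + b) x = smul h a x + smul h b x
  one_smul : ∀ {n : ℤ} (h : 0 + n = n) (x : carrier n), smul h k.one x = x
  mul_smul : ∀ {i j m ij jm n : ℤ} (h₁ : i + j = ij) (h₂ : ij + m = n) (h₃ : j + m = jm)
    (h₄ : i + jm = n) (a : k.carrier i) (b : k.carrier j) (x : carrier m),
    smul h₂ (k.mul h₁ a b) x = smul h₄ a (smul h₃ b x)

attribute [instance] GrMod.grp

/-- Morphisms of graded modules preserve the degree. -/
@[ext] structure GrMod.Hom {k : GrRing.{u}} (M N : GrMod k) where
  app : ∀ n, M.carrier n →+ N.carrier n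
  map_smul : ∀ {i j n : ℤ} (h : i + j = n) (a : k.carrier i) (x : M.carrier j),
    app n (M.smul h a x) = N.smul h a (app j x)

instance GrMod.category (k : GrRing.{u}) : Category.{u} (GrMod k) where
  Hom := GrMod.Hom
  id M := { app := fun _ => AddMonoidHom.id _, map_smul := fun _ _ _ => rfl }
  comp f g :=
    { app := fun n => (g.app n).comp (f.app n)
      map_smul := fun h a x => by simp [f.map_smul, g.map_smul] }

/-- A graded-commutative algebra over `k`. -/
structure GrAlg (k : GrRing.{u}) extends GrRing.{u} where
  alg : ∀ n, k.carrier n →+ carrier n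
  alg_one : alg 0 k.one = one
  alg_mul : ∀ {i j n : ℤ} (h : i + j = n) (a : k.carrier i) (b : k.carrier j),
    alg n (k.mul h a b) = mul h (alg i a) (alg j b)

@[ext] structure GrAlg.Hom {k : GrRing.{u}} (A B : GrAlg k) where
  app : ∀ n, A.carrier n →+ B.carrier n
  map_one : app 0 A.one = B.one
  map_mul : ∀ {i j n : ℤ} (h : i + j = n) (a : A.carrier i) (b : A.carrier j),
    app n (A.mul h a b) = B.mul h (app i a) (app j b)
  map_alg : ∀ (n : ℤ) (a : k.carrier n), app n (A.alg n a) = B.alg n a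

instance GrAlg.category (k : GrRing.{u}) : Category.{u} (GrAlg k) where
  Hom := GrAlg.Hom
  id A :=
    { app := fun _ => AddMonoidHom.id _
      map_one := rfl
      map_mul := fun _ _ _ => rfl
      map_alg := fun _ _ => rfl }
  comp f g :=
    { app := fun n => (g.app n).comp (f.app n)
      map_one := by simp [f.map_one, g.map_one]
      map_mul := fun h a x => by simp [f.map_mul, g.map_mul]
      map_alg := fun n a => by simp [f.map_alg, g.map_alg] }

section basic

variable {k : GrRing.{u}}

@[simp] lemma GrMod.id_app (M : GrMod k) (n : ℤ) (x : M.carrier n) :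
    GrMod.Hom.app (𝟙 M) n x = x := rfl

@[simp] lemma GrMod.comp_app {M N P : GrMod k} (f : M ⟶ N) (g : N ⟶ P) (n : ℤ)
    (x : M.carrier n) : GrMod.Hom.app (f ≫ g) n x = g.app n (f.app n x) := rfl

@[simp] lemma GrAlg.id_app (M : GrAlg k) (n : ℤ) (x : M.carrier n) :
    GrAlg.Hom.app (𝟙 M) n x = x := rfl

@[simp] lemma GrAlg.comp_app {M N P : GrAlg k} (f : M ⟶ N) (g : N ⟶ P) (n : ℤ)
    (x : M.carrier n) : GrAlg.Hom.app (f ≫ g) n x = g.app n (f.app n x) := rfl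

lemma GrMod.hom_ext {M N : GrMod k} {f g : M ⟶ N} (h : ∀ n x, f.app n x = g.app n x) : f = g :=
  GrMod.Hom.ext (funext fun n => AddMonoidHom.ext (h n))

lemma GrAlg.hom_ext {M N : GrAlg k} {f g : M ⟶ N} (h : ∀ n x, f.app n x = g.app n x) : f = g :=
  GrAlg.Hom.ext (funext fun n => AddMonoidHom.ext (h n))

@[simp] lemma GrRing.mul_zero (A : GrRing.{u}) {i j n : ℤ} (h : i + j = n) (a : A.carrier i) :
    A.mul h a (0 : A.carrier j) = 0 := by
  have := A.mul_add h a 0 0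
  simpa using this

@[simp] lemma GrRing.zero_mul (A : GrRing.{u}) {i j n : ℤ} (h : i + j = n) (a : A.carrier j) :
    A.mul h (0 : A.carrier i) a = 0 := by
  have := A.add_mul h 0 0 a
  simpa using this

@[simp] lemma GrMod.smul_zero (M : GrMod k) {i j n : ℤ} (h : i + j = n) (a : k.carrier i) :
    M.smul h a (0 : M.carrier j) = 0 := by
  have := M.smul_add h a 0 0
  simpa using this

@[simp] lemma GrMod.zero_smul (M : GrMod k) {i j n : ℤ} (h : i + j = n) (x : M.carrier j) :
    M.smul h (0 : k.carrier i) x = 0 := by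
  have := M.add_smul h 0 0 x
  simpa using this

lemma GrRing.mul_neg (A : GrRing.{u}) {i j n : ℤ} (h : i + j = n) (a : A.carrier i)
    (b : A.carrier j) : A.mul h a (-b) = - A.mul h a b := by
  rw [eq_neg_iff_add_eq_zero, ← A.mul_add]; simp

lemma GrRing.neg_mul (A : GrRing.{u}) {i j n : ℤ} (h : i + j = n) (a : A.carrier i)
    (b : A.carrier j) : A.mul h (-a) b = - A.mul h a b := by
  rw [eq_neg_iff_add_eq_zero, ← A.add_mul]; simp

lemma GrMod.smul_neg (M : GrMod k) {i j n : ℤ} (h : i + j = n) (a : k.carrier i)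
    (b : M.carrier j) : M.smul h a (-b) = - M.smul h a b := by
  rw [eq_neg_iff_add_eq_zero, ← M.smul_add]; simp

lemma sign_smul {A B : Type u} [AddCommGroup A] [AddCommGroup B] (f : A → B)
    (hf : ∀ a, f (-a) = - f a) (s : ℤˣ) (a : A) : f (s • a) = s • f a := by
  rcases Int.units_eq_one_or s with rfl | rfl
  · simp
  · simp [hf]

lemma GrRing.mul_sign (A : GrRing.{u}) {i j n : ℤ} (h : i + j = n) (a : A.carrier i)
    (b : A.carrier j) (s : ℤˣ) : A.mul h a (s • b) = s • A.mul h a b :=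
  sign_smul _ (A.mul_neg h a) s b

lemma GrRing.sign_mul (A : GrRing.{u}) {i j n : ℤ} (h : i + j = n) (a : A.carrier i)
    (b : A.carrier j) (s : ℤˣ) : A.mul h (s • a) b = s • A.mul h a b :=
  sign_smul (fun a => A.mul h a b) (fun a => A.neg_mul h a b) s a

lemma GrMod.smul_sign (M : GrMod k) {i j n : ℤ} (h : i + j = n) (a : k.carrier i)
    (b : M.carrier j) (s : ℤˣ) : M.smul h a (s • b) = s • M.smul h a b :=
  sign_smul _ (M.smul_neg h a) s b

lemma GrMod.smul_comm (M : GrMod k) {i j m im jm n : ℤ} (h₁ : j + m = jm) (h₂ : i + jm = n)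
    (h₃ : i + m = im) (h₄ : j + im = n) (a : k.carrier i) (b : k.carrier j) (x : M.carrier m) :
    M.smul h₂ a (M.smul h₁ b x) = (i * j).negOnePow • M.smul h₄ b (M.smul h₃ a x) := by
  rw [← M.mul_smul (ij := i + j) rfl (by omega) h₁ h₂ a b x, k.mul_comm rfl (add_comm j i),
    ← M.mul_smul (ij := i + j) (by omega) (by omega) h₃ h₄ b a x]
  generalize k.mul _ b a = c
  rcases Int.units_eq_one_or ((i * j).negOnePow) with h | h
  · simp [h]
  · rw [h, eq_comm]
    have := M.add_smul (show i + j + m = n by omega) c (-c) x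
    simp only [add_neg_cancel, GrMod.zero_smul] at this
    simp [neg_eq_of_add_eq_zero_right this.symm]

/-- `k`, as an algebra over itself. -/
abbrev GrAlg.base (k : GrRing.{u}) : GrAlg k :=
  { k with
    alg := fun _ => AddMonoidHom.id _
    alg_one := rfl
    alg_mul := fun _ _ _ => rfl }

/-- The module underlying an algebra. -/
abbrev GrAlg.toMod (A : GrAlg k) : GrMod k where
  carrier := A.carrier
  smul h a x := A.mul h (A.alg _ a) x
  smul_add h a x y := A.mul_add h _ x y
  add_smul h a b x := by simp [A.add_mul]
  one_smul h x := by rw [A.alg_one, A.one_mul]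
  mul_smul h₁ h₂ h₃ h₄ a b x := by rw [A.alg_mul, A.mul_assoc h₁ h₂ h₃ h₄]

/-- The forgetful functor from algebras to modules. -/
def GrAlg.forget (k : GrRing.{u}) : GrAlg k ⥤ GrMod k where
  obj A := A.toMod
  map {A B} f :=
    { app := f.app
      map_smul := fun h a x => (f.map_mul h (A.alg _ a) x).trans (by rw [f.map_alg]) }

/-- A `k`-bilinear map `X × Y → Z` of degree zero. Moving a scalar past an element of `X` costs the
Koszul sign, so that `f (x a, y) = f (x, a y)` for the right action on `X`. -/
@[ext] structure BilinMap (X Y Z : GrMod k) where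
  app : ∀ {i j n : ℤ}, i + j = n → X.carrier i → Y.carrier j → Z.carrier n
  add_left : ∀ {i j n : ℤ} (h : i + j = n) (x x' : X.carrier i) (y : Y.carrier j),
    app h (x + x') y = app h x y + app h x' y
  add_right : ∀ {i j n : ℤ} (h : i + j = n) (x : X.carrier i) (y y' : Y.carrier j),
    app h x (y + y') = app h x y + app h x y'
  smul_left : ∀ {d i j di ij n : ℤ} (h₁ : d + i = di) (h₂ : di + j = n) (h₃ : i + j = ij)
    (h₄ : d + ij = n) (a : k.carrier d) (x : X.carrier i) (y : Y.carrier j),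
    app h₂ (X.smul h₁ a x) y = Z.smul h₄ a (app h₃ x y)
  smul_right : ∀ {d i j dj ij n : ℤ} (h₁ : d + j = dj) (h₂ : i + dj = n) (h₃ : i + j = ij)
    (h₄ : d + ij = n) (a : k.carrier d) (x : X.carrier i) (y : Y.carrier j),
    app h₂ x (Y.smul h₁ a y) = (d * i).negOnePow • Z.smul h₄ a (app h₃ x y)

namespace BilinMap

variable {X Y Z X' Y' Z' : GrMod k}

@[simp] lemma zero_left (f : BilinMap X Y Z) {i j n : ℤ} (h : i + j = n) (y : Y.carrier j) :
    f.app h (0 : X.carrier i) y = 0 := by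
  have := f.add_left h 0 0 y
  simpa using this

@[simp] lemma zero_right (f : BilinMap X Y Z) {i j n : ℤ} (h : i + j = n) (x : X.carrier i) :
    f.app h x (0 : Y.carrier j) = 0 := by
  have := f.add_right h x 0 0
  simpa using this

lemma neg_left (f : BilinMap X Y Z) {i j n : ℤ} (h : i + j = n) (x : X.carrier i)
    (y : Y.carrier j) : f.app h (-x) y = - f.app h x y := by
  rw [eq_neg_iff_add_eq_zero, ← f.add_left]; simp

lemma neg_right (f : BilinMap X Y Z) {i j n : ℤ} (h : i + j = n) (x : X.carrier i)
    (y : Y.carrier j) : f.app h x (-y) = - f.app h x y := by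
  rw [eq_neg_iff_add_eq_zero, ← f.add_right]; simp

lemma sign_left (f : BilinMap X Y Z) {i j n : ℤ} (h : i + j = n) (x : X.carrier i)
    (y : Y.carrier j) (s : ℤˣ) : f.app h (s • x) y = s • f.app h x y :=
  sign_smul (fun x => f.app h x y) (fun x => f.neg_left h x y) s x

lemma sign_right (f : BilinMap X Y Z) {i j n : ℤ} (h : i + j = n) (x : X.carrier i)
    (y : Y.carrier j) (s : ℤˣ) : f.app h x (s • y) = s • f.app h x y :=
  sign_smul (fun y => f.app h x y) (fun y => f.neg_right h x y) s y

/-- Precomposition of a bilinear map with linear maps. -/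
def pre (f : BilinMap X Y Z) (u : X' ⟶ X) (v : Y' ⟶ Y) : BilinMap X' Y' Z where
  app h x y := f.app h (u.app _ x) (v.app _ y)
  add_left h x x' y := by simp [f.add_left]
  add_right h x x' y := by simp [f.add_right]
  smul_left h₁ h₂ h₃ h₄ a x y := by rw [u.map_smul, f.smul_left h₁ h₂ h₃ h₄]
  smul_right h₁ h₂ h₃ h₄ a x y := by rw [v.map_smul, f.smul_right h₁ h₂ h₃ h₄]

/-- Postcomposition of a bilinear map with a linear map. -/
def post (f : BilinMap X Y Z) (w : Z ⟶ Z') : BilinMap X Y Z' where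
  app h x y := w.app _ (f.app h x y)
  add_left h x x' y := by simp [f.add_left]
  add_right h x x' y := by simp [f.add_right]
  smul_left h₁ h₂ h₃ h₄ a x y := by rw [f.smul_left h₁ h₂ h₃ h₄, w.map_smul]
  smul_right h₁ h₂ h₃ h₄ a x y := by
    rw [f.smul_right h₁ h₂ h₃ h₄, sign_smul (w.app _) (map_neg _), w.map_smul]

end BilinMap

/-- The multiplication of an algebra is bilinear. -/
def GrAlg.mulBil (A : GrAlg k) : BilinMap A.toMod A.toMod A.toMod where
  app h x y := A.mul h x y
  add_left h x x' y := A.add_mul h x x' y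
  add_right h x y y' := A.mul_add h x y y'
  smul_left h₁ h₂ h₃ h₄ a x y := A.mul_assoc h₁ h₂ h₃ h₄ _ _ _
  smul_right {d i j dj ij n} h₁ h₂ h₃ h₄ a x y := by
    change A.mul h₂ x (A.mul h₁ (A.alg d a) y) = _ • A.mul h₄ (A.alg d a) (A.mul h₃ x y)
    rw [← A.mul_assoc (ij := i + d) rfl (by omega) h₁ h₂, A.mul_comm rfl (add_comm d i),
      A.sign_mul, A.mul_assoc (ij := i + d) (add_comm d i) (by omega) h₃ h₄, _root_.mul_comm i d]

/-- The action `k × X → X`. -/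
def GrMod.smulBil (X : GrMod k) : BilinMap (GrAlg.base k).toMod X X where
  app h a x := X.smul h a x
  add_left h x x' y := X.add_smul h x x' y
  add_right h x y y' := X.smul_add h x y y'
  smul_left h₁ h₂ h₃ h₄ a x y := X.mul_smul h₁ h₂ h₃ h₄ _ _ _
  smul_right {d i j dj ij n} h₁ h₂ h₃ h₄ a x y := by
    rw [X.smul_comm h₁ h₂ h₃ h₄, _root_.mul_comm i d]

/-- The right action `x a = (-1)^{|a||x|} a x`. -/
def GrMod.rsmul (X : GrMod k) {i j n : ℤ} (h : i + j = n) (x : X.carrier i) (a : k.carrier j) :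
    X.carrier n :=
  (j * i).negOnePow • X.smul ((add_comm j i).trans h) a x

lemma GrMod.rsmul_add (X : GrMod k) {i j n : ℤ} (h : i + j = n) (x : X.carrier i)
    (a b : k.carrier j) : X.rsmul h x (a + b) = X.rsmul h x a + X.rsmul h x b := by
  rw [rsmul, X.add_smul, _root_.smul_add]; rfl

lemma GrMod.add_rsmul (X : GrMod k) {i j n : ℤ} (h : i + j = n) (x y : X.carrier i)
    (a : k.carrier j) : X.rsmul h (x + y) a = X.rsmul h x a + X.rsmul h y a := by
  rw [rsmul, X.smul_add, _root_.smul_add]; rfl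

@[simp] lemma GrMod.zero_rsmul (X : GrMod k) {i j n : ℤ} (h : i + j = n) (a : k.carrier j) :
    X.rsmul h (0 : X.carrier i) a = 0 := by
  simp [rsmul]

@[simp] lemma GrMod.rsmul_zero (X : GrMod k) {i j n : ℤ} (h : i + j = n) (x : X.carrier i) :
    X.rsmul h x (0 : k.carrier j) = 0 := by
  simp [rsmul]

lemma GrMod.smul_rsmul (X : GrMod k) {i j m ij jm n : ℤ} (h₁ : i + j = ij) (h₂ : ij + m = n)
    (h₃ : j + m = jm) (h₄ : i + jm = n) (a : k.carrier i) (x : X.carrier j) (b : k.carrier m) :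
    X.rsmul h₂ (X.smul h₁ a x) b = X.smul h₄ a (X.rsmul h₃ x b) := by
  subst h₁ h₃
  rw [rsmul, rsmul, X.smul_comm rfl (by omega) (show m + j = j + m by omega) h₄, X.smul_sign,
    smul_smul]
  congr 1
  rw [← Int.negOnePow_add, Int.negOnePow_eq_iff]
  exact ⟨m * i, by ring⟩

lemma GrMod.rsmul_rsmul (X : GrMod k) {i j m ij jm n : ℤ} (h₁ : i + j = ij) (h₂ : ij + m = n)
    (h₃ : j + m = jm) (h₄ : i + jm = n) (x : X.carrier i) (a : k.carrier j) (b : k.carrier m) :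
    X.rsmul h₂ (X.rsmul h₁ x a) b = X.rsmul h₄ x (k.mul h₃ a b) := by
  subst h₁ h₃
  have key : ∀ (s : ℤˣ) (c : k.carrier (j + m)), X.smul ((add_comm (j + m) i).trans h₄) (s • c) x =
      s • X.smul ((add_comm (j + m) i).trans h₄) c x := by
    intro s c
    refine sign_smul (fun c => X.smul ((add_comm (j + m) i).trans h₄) c x) (fun c => ?_) s c
    rw [eq_neg_iff_add_eq_zero, ← X.add_smul]; simp
  rw [rsmul, rsmul, rsmul, k.mul_comm rfl (add_comm m j) a b, key, X.smul_sign, smul_smul,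
    smul_smul, X.mul_smul (add_comm m j) _ (add_comm j i) (by omega)]
  congr 1
  rw [← Int.negOnePow_add, ← Int.negOnePow_add]
  congr 1
  ring

lemma BilinMap.rsmul_right {X Y Z : GrMod k} (p : BilinMap X Y Z) {i j m ij jm n : ℤ}
    (h₁ : i + j = ij) (h₂ : ij + m = n) (h₃ : j + m = jm) (h₄ : i + jm = n) (x : X.carrier i)
    (y : Y.carrier j) (b : k.carrier m) :
    Z.rsmul h₂ (p.app h₁ x y) b = p.app h₄ x (Y.rsmul h₃ y b) := by
  subst h₁ h₃
  rw [GrMod.rsmul, GrMod.rsmul, p.sign_right, p.smul_right _ _ rfl (by omega), smul_smul]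
  congr 1
  rw [← Int.negOnePow_add]
  congr 1
  ring

lemma BilinMap.rsmul_left {X Y Z : GrMod k} (p : BilinMap X Y Z) {i j m ij jm n : ℤ}
    (h₁ : i + j = ij) (h₂ : ij + m = n) (h₃ : j + m = jm) (h₄ : i + jm = n) (x : X.carrier i)
    (b : k.carrier j) (y : Y.carrier m) :
    p.app h₂ (X.rsmul h₁ x b) y = p.app h₄ x (Y.smul h₃ b y) := by
  subst h₁ h₃
  rw [GrMod.rsmul, p.sign_left, p.smul_right _ _ rfl (by omega), p.smul_left _ _ rfl]

/-- The action `X × k → X` from the right. -/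
def GrMod.smulBilRight (X : GrMod k) : BilinMap X (GrAlg.base k).toMod X where
  app h x a := X.rsmul h x a
  add_left h x x' y := X.add_rsmul h x x' y
  add_right h x y y' := X.rsmul_add h x y y'
  smul_left h₁ h₂ h₃ h₄ a x y := X.smul_rsmul h₁ h₂ h₃ h₄ a x y
  smul_right {d i j dj ij n} h₁ h₂ h₃ h₄ a x y := by
    subst h₁ h₃
    rw [GrMod.rsmul, GrMod.rsmul, X.smul_sign, smul_smul,
      X.mul_smul rfl (by omega) (add_comm j i) h₄]
    congr 1
    rw [← Int.negOnePow_add]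
    congr 1
    ring

/-- The augmented algebra `k ⊕ V` on a graded module `V` with a graded commutative, associative
bilinear product `p`. -/
abbrev GrAlg.adjoinOne (V : GrMod k) (p : BilinMap V V V)
    (comm : ∀ {i j n : ℤ} (h : i + j = n) (h' : j + i = n) (x : V.carrier i) (y : V.carrier j),
      p.app h x y = (i * j).negOnePow • p.app h' y x)
    (assoc : ∀ {i j m ij jm n : ℤ} (h₁ : i + j = ij) (h₂ : ij + m = n) (h₃ : j + m = jm)
      (h₄ : i + jm = n) (x : V.carrier i) (y : V.carrier j) (z : V.carrier m),
      p.app h₂ (p.app h₁ x y) z = p.app h₄ x (p.app h₃ y z)) : GrAlg k where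
  carrier n := k.carrier n × V.carrier n
  one := (k.one, 0)
  mul {i j _} h a b := (k.mul h a.1 b.1,
    V.smul h a.1 b.2 + V.rsmul h a.2 b.1 + p.app h a.2 b.2)
  mul_add h a b c := by
    ext
    · simp [k.mul_add]
    · simp only [Prod.fst_add, Prod.snd_add, V.smul_add, V.rsmul_add, BilinMap.add_right]
      abel
  add_mul h a b c := by
    ext
    · simp [k.add_mul]
    · simp only [Prod.fst_add, Prod.snd_add, V.add_smul, V.add_rsmul, BilinMap.add_left]
      abel
  one_mul h a := by ext <;> simp [k.one_mul, V.one_smul]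
  mul_assoc {i j m ij jm n} h₁ h₂ h₃ h₄ a b c := by
    ext
    · exact k.mul_assoc h₁ h₂ h₃ h₄ _ _ _
    · simp only [V.smul_add, V.add_rsmul, BilinMap.add_left, BilinMap.add_right]
      rw [V.mul_smul h₁ h₂ h₃ h₄, assoc h₁ h₂ h₃ h₄, p.smul_left h₁ h₂ h₃ h₄,
        V.smul_rsmul h₁ h₂ h₃ h₄, V.rsmul_rsmul h₁ h₂ h₃ h₄, p.rsmul_right h₁ h₂ h₃ h₄,
        p.rsmul_left h₁ h₂ h₃ h₄]
      abel
  mul_comm {i j n} h h' a b := by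
    ext
    · exact k.mul_comm h h' _ _
    · simp only [GrMod.rsmul, Prod.smul_snd]
      rw [comm h h' a.2 b.2, _root_.smul_add, _root_.smul_add, smul_smul, _root_.mul_comm i j,
        ← Int.negOnePow_add, Int.negOnePow_even _ ⟨j * i, rfl⟩, _root_.one_smul]
      abel
  alg n := AddMonoidHom.inl _ _
  alg_one := rfl
  alg_mul h a b := by simp

/-- An algebra map `k ⊕ V → k ⊕ W` from a multiplicative linear map `V → W`. -/
def GrAlg.adjoinOneMap {V W : GrMod k} {p : BilinMap V V V} {q : BilinMap W W W} {cp ap cq aq}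
    (u : V ⟶ W) (hu : ∀ {i j n : ℤ} (h : i + j = n) (x : V.carrier i) (y : V.carrier j),
      u.app n (p.app h x y) = q.app h (u.app i x) (u.app j y)) :
    GrAlg.adjoinOne V p cp ap ⟶ GrAlg.adjoinOne W q cq aq :=
  { app := fun n => (AddMonoidHom.id _).prodMap (u.app n)
    map_one := by ext <;> simp
    map_mul := fun {i j n} h a b => by
      have e : u.app n (V.rsmul h a.2 b.1) = W.rsmul h (u.app i a.2) b.1 := by
        rw [GrMod.rsmul, GrMod.rsmul, sign_smul (u.app n) (map_neg _), u.map_smul]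
      ext
      · rfl
      · simp only [AddMonoidHom.prodMap_def, AddMonoidHom.prod_apply, AddMonoidHom.comp_apply,
          AddMonoidHom.coe_snd, AddMonoidHom.coe_fst, AddMonoidHom.id_apply, map_add, hu, e,
          u.map_smul]
    map_alg := fun _ _ => by ext <;> simp }

/-- The zero bilinear map. -/
def BilinMap.zero (X Y Z : GrMod k) : BilinMap X Y Z where
  app _ _ _ := 0
  add_left := by simp
  add_right := by simp
  smul_left := by simp
  smul_right := by simp

/-- The square-zero extension `k ⊕ M`. -/
abbrev GrAlg.sqZero (M : GrMod k) : GrAlg k :=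
  GrAlg.adjoinOne M (BilinMap.zero M M M) (by simp [BilinMap.zero]) (by simp [BilinMap.zero])

/-- The map `k ⊕ M → k ⊕ N` induced by `M → N`. -/
def GrAlg.sqZeroMap {M N : GrMod k} (g : M ⟶ N) : GrAlg.sqZero M ⟶ GrAlg.sqZero N :=
  GrAlg.adjoinOneMap g (by simp [BilinMap.zero])

/-- The augmentation `k ⊕ M → k`. -/
def GrAlg.sqZeroAug (M : GrMod k) : GrAlg.sqZero M ⟶ GrAlg.base k :=
  { app := fun _ => AddMonoidHom.fst _ _
    map_one := rfl
    map_mul := fun _ _ _ => rfl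
    map_alg := fun _ _ => rfl }

/-- The projection `k ⊕ M → M` of modules. -/
def GrAlg.sqZeroSnd (M : GrMod k) : (GrAlg.sqZero M).toMod ⟶ M :=
  { app := fun _ => AddMonoidHom.snd _ _
    map_smul := fun h a x => by
      change M.smul h a x.2 + M.rsmul h 0 x.1 + 0 = M.smul h a x.2
      simp }

/-- The module `X ⊕ Y ⊕ Z`. -/
abbrev GrMod.sum3 (X Y Z : GrMod k) : GrMod k where
  carrier n := X.carrier n × Y.carrier n × Z.carrier n
  smul h a v := (X.smul h a v.1, Y.smul h a v.2.1, Z.smul h a v.2.2)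
  smul_add h a v w := by simp [X.smul_add, Y.smul_add, Z.smul_add]
  add_smul h a b v := by simp [X.add_smul, Y.add_smul, Z.add_smul]
  one_smul h v := by simp [X.one_smul, Y.one_smul, Z.one_smul]
  mul_smul h₁ h₂ h₃ h₄ a b v := by
    rw [X.mul_smul h₁ h₂ h₃ h₄, Y.mul_smul h₁ h₂ h₃ h₄, Z.mul_smul h₁ h₂ h₃ h₄]

/-- The product on `X ⊕ Y ⊕ Z` for which `x y = f (x, y)` and all products of elements of `X`, or
of elements of `Y`, or with an element of `Z`, vanish. -/
def BilinMap.sum3 {X Y Z : GrMod k} (f : BilinMap X Y Z) :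
    BilinMap (X.sum3 Y Z) (X.sum3 Y Z) (X.sum3 Y Z) where
  app {i j n} h v w :=
    (0, 0, f.app h v.1 w.2.1 + (i * j).negOnePow • f.app ((add_comm j i).trans h) w.1 v.2.1)
  add_left h v v' w := by
    simp only [Prod.fst_add, Prod.snd_add, f.add_left, f.add_right, smul_add, Prod.mk_add_mk,
      add_zero, Prod.mk.injEq, true_and]
    abel
  add_right h v w w' := by
    simp only [Prod.fst_add, Prod.snd_add, f.add_left, f.add_right, smul_add, Prod.mk_add_mk,
      add_zero, Prod.mk.injEq, true_and]
    abel
  smul_left {d i j di ij n} h₁ h₂ h₃ h₄ a v w := by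
    subst h₁ h₃
    simp only [GrMod.smul_zero, Prod.mk.injEq, true_and]
    rw [f.smul_left rfl h₂ rfl h₄, f.smul_right rfl (by omega) (add_comm j i) h₄, Z.smul_add,
      Z.smul_sign, smul_smul, ← Int.negOnePow_add]
    congr 2
    rw [Int.negOnePow_eq_iff]
    exact ⟨d * j, by ring⟩
  smul_right {d i j dj ij n} h₁ h₂ h₃ h₄ a v w := by
    subst h₁ h₃
    simp only [GrMod.smul_zero, Prod.smul_mk, smul_zero, Prod.mk.injEq, true_and]
    rw [f.smul_right rfl h₂ rfl h₄, f.smul_left rfl (by omega) (add_comm j i) h₄, Z.smul_add,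
      Z.smul_sign, smul_add, smul_smul, ← Int.negOnePow_add]
    congr 3
    ring

/-- The algebra `k ⊕ X ⊕ Y ⊕ Z` with `x y = f (x, y)`. If `Z = X ⊗ Y` and `f` is the universal
bilinear map, this is the tensor product of the algebras `k ⊕ X` and `k ⊕ Y`. -/
abbrev BilinMap.algebra {X Y Z : GrMod k} (f : BilinMap X Y Z) : GrAlg k :=
  GrAlg.adjoinOne (X.sum3 Y Z) f.sum3
    (fun {i j n} h h' v w => by
      simp only [BilinMap.sum3, Prod.smul_mk, smul_zero, smul_add, smul_smul, Prod.mk.injEq,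
        true_and]
      rw [mul_comm j i, ← Int.negOnePow_add, Int.negOnePow_even _ ⟨i * j, rfl⟩, one_smul, add_comm])
    (by simp [BilinMap.sum3])

/-- The inclusion `k ⊕ X → k ⊕ X ⊕ Y ⊕ Z`. -/
def BilinMap.inclLeft {X Y Z : GrMod k} (f : BilinMap X Y Z) : GrAlg.sqZero X ⟶ f.algebra :=
  GrAlg.adjoinOneMap
    { app := fun n => AddMonoidHom.inl _ _, map_smul := fun h a x => by simp [Prod.zero_eq_mk] }
    (by simp [BilinMap.sum3, BilinMap.zero, Prod.zero_eq_mk])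

/-- The inclusion `k ⊕ Y → k ⊕ X ⊕ Y ⊕ Z`. -/
def BilinMap.inclRight {X Y Z : GrMod k} (f : BilinMap X Y Z) : GrAlg.sqZero Y ⟶ f.algebra :=
  GrAlg.adjoinOneMap
    { app := fun n => (AddMonoidHom.inr _ _).comp (AddMonoidHom.inl _ _)
      map_smul := fun h a x => by simp }
    (by simp [BilinMap.sum3, BilinMap.zero])

/-- The inclusion `k ⊕ Z → k ⊕ X ⊕ Y ⊕ Z`. -/
def BilinMap.inclProd {X Y Z : GrMod k} (f : BilinMap X Y Z) : GrAlg.sqZero Z ⟶ f.algebra :=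
  GrAlg.adjoinOneMap
    { app := fun n => (AddMonoidHom.inr _ _).comp (AddMonoidHom.inr _ _)
      map_smul := fun h a x => by simp }
    (by simp [BilinMap.sum3, BilinMap.zero])

end basic

section flat

variable {k : GrRing.{u}}

/-- A symbol `x ⊗ y` of degree `n`. -/
structure PureTensor (M N : GrMod k) (n : ℤ) where
  {i j : ℤ}
  deg : i + j = n
  left : M.carrier i
  right : N.carrier j

/-- The relations that define the tensor product over `k`. -/
inductive TensorRel (M N : GrMod k) (n : ℤ) : FreeAbelianGroup (PureTensor M N n) → Prop
  | add_left {i j : ℤ} (h : i + j = n) (x x' : M.carrier i) (y : N.carrier j) :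
    TensorRel M N n (.of ⟨h, x + x', y⟩ - .of ⟨h, x, y⟩ - .of ⟨h, x', y⟩)
  | add_right {i j : ℤ} (h : i + j = n) (x : M.carrier i) (y y' : N.carrier j) :
    TensorRel M N n (.of ⟨h, x, y + y'⟩ - .of ⟨h, x, y⟩ - .of ⟨h, x, y'⟩)
  | balanced {i d j i' j' : ℤ} (h₁ : i + d = i') (h₂ : i' + j = n) (h₃ : d + j = j')
    (h₄ : i + j' = n) (x : M.carrier i) (a : k.carrier d) (y : N.carrier j) :
    TensorRel M N n (.of ⟨h₂, M.rsmul h₁ x a, y⟩ - .of ⟨h₄, x, N.smul h₃ a y⟩)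

/-- The degree `n` part of the tensor product `M ⊗ₖ N`. -/
def GrMod.Tensor (M N : GrMod k) (n : ℤ) : Type u :=
  FreeAbelianGroup (PureTensor M N n) ⧸ AddSubgroup.closure {r | TensorRel M N n r}

instance (M N : GrMod k) (n : ℤ) : AddCommGroup (M.Tensor N n) :=
  inferInstanceAs (AddCommGroup (_ ⧸ _))

/-- The map `id ⊗ g : M ⊗ₖ N → M ⊗ₖ N'` in degree `n`. -/
def GrMod.tensorMap (M : GrMod k) {N N' : GrMod k} (g : N ⟶ N') (n : ℤ) :
    M.Tensor N n →+ M.Tensor N' n :=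
  QuotientAddGroup.map _ _
    (FreeAbelianGroup.map fun t => (⟨t.deg, t.left, g.app _ t.right⟩ : PureTensor M N' n)) (by
      rw [AddSubgroup.closure_le]
      rintro r (⟨h, x, x', y⟩ | ⟨h, x, y, y'⟩ | ⟨h₁, h₂, h₃, h₄, x, a, y⟩) <;>
        simp only [SetLike.mem_coe, AddSubgroup.mem_comap, map_sub, FreeAbelianGroup.map_of_apply,
          map_add, g.map_smul]
      · exact AddSubgroup.subset_closure (.add_left h x x' _)
      · exact AddSubgroup.subset_closure (.add_right h x _ _)
      · exact AddSubgroup.subset_closure (.balanced h₁ h₂ h₃ h₄ x a _))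

/-- A graded module `M` is flat if `M ⊗ₖ -` preserves injections. -/
def GrMod.Flat (M : GrMod k) : Prop :=
  ∀ ⦃N N' : GrMod k⦄ (g : N ⟶ N'), (∀ n, Function.Injective (g.app n)) →
    ∀ n, Function.Injective (M.tensorMap g n)

end flat

section formal

variable {k l : GrRing.{u}}

/-- The functor `colim_i Hom (A i, -)` represented by a pro-object `A`. -/
noncomputable def proHom {C : Type (u + 1)} [Category.{u} C] {I : Type u} [SmallCategory I]
    (A : I ⥤ C) : C ⥤ Type u :=
  colimit (A.op ⋙ coyoneda)

/-- The underlying set of the degree `q` part of a graded module. -/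
def GrMod.deg (l : GrRing.{u}) (q : ℤ) : GrMod l ⥤ Type u where
  obj M := M.carrier q
  map f := TypeCat.ofHom (f.app q)

/-- A functor with values in graded modules is formal if its degree `q` part is ind-representable,
i.e. represented by a pro-object, for every `q`. -/
def IsFormal {C : Type (u + 1)} [Category.{u} C] (F : C ⥤ GrMod l) : Prop :=
  ∀ q : ℤ, ∃ (I : Type u) (_ : SmallCategory I) (_ : IsCofiltered I) (A : I ⥤ C),
    Nonempty (proHom A ≅ F ⋙ GrMod.deg l q)

/-- A pro-module is pro-flat if it is pro-isomorphic to a pro-module that consists of flat modules.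
Pro-objects are compared through the functors that they represent. -/
def IsProFlat {I : Type u} [SmallCategory I] (A : I ⥤ GrMod k) : Prop :=
  ∃ (J : Type u) (_ : SmallCategory J) (_ : IsCofiltered J) (B : J ⥤ GrMod k),
    (∀ j, (B.obj j).Flat) ∧ Nonempty (proHom A ≅ proHom B)

/-- A formal bimodule whose representing pro-modules are pro-flat. -/
def IsProFlatBimod (B : GrMod k ⥤ GrMod l) : Prop :=
  ∀ q : ℤ, ∃ (I : Type u) (_ : SmallCategory I) (_ : IsCofiltered I) (A : I ⥤ GrMod k),
    IsProFlat A ∧ Nonempty (proHom A ≅ B ⋙ GrMod.deg l q)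

/-- A formal module scheme whose representing pro-algebras are pro-flat as pro-modules. -/
def IsProFlatSch (F : GrAlg k ⥤ GrMod l) : Prop :=
  ∀ q : ℤ, ∃ (I : Type u) (_ : SmallCategory I) (_ : IsCofiltered I) (A : I ⥤ GrAlg k),
    IsProFlat (A ⋙ GrAlg.forget k) ∧ Nonempty (proHom A ≅ F ⋙ GrMod.deg l q)

end formal

section schemes

variable {k l : GrRing.{u}}

/-- A formal `l`-algebra scheme over `k`. -/
structure FormalAlgSch (k l : GrRing.{u}) where
  functor : GrAlg k ⥤ GrAlg l
  formal : IsFormal (functor ⋙ GrAlg.forget l)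

/-- The formal module scheme that underlies a formal algebra scheme. -/
abbrev FormalAlgSch.mod (F : FormalAlgSch k l) : GrAlg k ⥤ GrMod l :=
  F.functor ⋙ GrAlg.forget l

/-- A natural `l`-bilinear map `F × G → H`. -/
@[ext] structure SchBilin (F G H : GrAlg k ⥤ GrMod l) where
  bil : ∀ R : GrAlg k, BilinMap (F.obj R) (G.obj R) (H.obj R)
  natural : ∀ {R S : GrAlg k} (g : R ⟶ S) {i j n : ℤ} (h : i + j = n)
    (x : (F.obj R).carrier i) (y : (G.obj R).carrier j),
    (H.map g).app n ((bil R).app h x y) = (bil S).app h ((F.map g).app i x) ((G.map g).app j y)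

/-- Postcomposition of a natural bilinear map with a natural transformation. -/
def SchBilin.post {F G H H' : GrAlg k ⥤ GrMod l} (b : SchBilin F G H) (σ : H ⟶ H') :
    SchBilin F G H' where
  bil R := (b.bil R).post (σ.app R)
  natural {R S} g {i j n} h x y := by
    have := congrArg (fun t => GrMod.Hom.app t n ((b.bil R).app h x y)) (σ.naturality g)
    simp only [GrMod.comp_app, b.natural] at this
    exact this.symm

/-- The tensor product `F ⊗ₗ G` of formal module schemes: the formal module scheme that is universal
for natural `l`-bilinear maps out of `F × G`. -/
structure SchTensor (F G : GrAlg k ⥤ GrMod l) where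
  obj : GrAlg k ⥤ GrMod l
  formal : IsFormal obj
  bilin : SchBilin F G obj
  universal : ∀ H : GrAlg k ⥤ GrMod l, IsFormal H → ∀ b : SchBilin F G H,
    ∃! σ : obj ⟶ H, bilin.post σ = b

/-- The map `F ⊗ₗ F → F` given by the multiplication of `F`. -/
noncomputable def FormalAlgSch.mulMap (F : FormalAlgSch k l) (T : SchTensor F.mod F.mod) :
    T.obj ⟶ F.mod :=
  (T.universal F.mod F.formal
    { bil := fun R => (F.functor.obj R).mulBil
      natural := fun g _ _ _ h x y => (F.functor.map g).map_mul h x y }).choose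

/-- The primitives `𝒫(F)` of a formal module scheme: the formal bimodule with a universal map from
`F` to a formal module scheme of the form `R ↦ B(R)` for a formal bimodule `B`. So `𝒫` is left
adjoint to restriction along the forgetful functor from algebras to modules. -/
structure Primitives (F : GrAlg k ⥤ GrMod l) where
  obj : GrMod k ⥤ GrMod l
  formal : IsFormal obj
  unit : F ⟶ GrAlg.forget k ⋙ obj
  universal : ∀ B : GrMod k ⥤ GrMod l, IsFormal B → ∀ g : F ⟶ GrAlg.forget k ⋙ B,
    ∃! σ : obj ⟶ B, unit ≫ Functor.whiskerLeft (GrAlg.forget k) σ = g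

/-- The value at `M` of the indecomposables `𝒬(F)`: the kernel of `F(k ⊕ M) → F(k)`. -/
def indecObj (F : GrAlg k ⥤ GrMod l) (M : GrMod k) : GrMod l where
  carrier n := ((F.map (GrAlg.sqZeroAug M)).app n).ker
  smul h a x := ⟨(F.obj _).smul h a x.1, by
    rw [AddMonoidHom.mem_ker, (F.map _).map_smul, x.2, GrMod.smul_zero]⟩
  smul_add h a x y := Subtype.ext ((F.obj _).smul_add h a x.1 y.1)
  add_smul h a b x := Subtype.ext ((F.obj _).add_smul h a b x.1)
  one_smul h x := Subtype.ext ((F.obj _).one_smul h x.1)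
  mul_smul h₁ h₂ h₃ h₄ a b x := Subtype.ext ((F.obj _).mul_smul h₁ h₂ h₃ h₄ a b x.1)

lemma map_comp_app {C : Type (u + 1)} [Category.{u} C] (F : C ⥤ GrMod l) {X Y Z : C} (f : X ⟶ Y)
    (g : Y ⟶ Z) (n : ℤ) (x : (F.obj X).carrier n) :
    (F.map g).app n ((F.map f).app n x) = (F.map (f ≫ g)).app n x := by
  rw [F.map_comp]; rfl

/-- The indecomposables `𝒬(F)` of a formal module scheme. -/
def indec (F : GrAlg k ⥤ GrMod l) : GrMod k ⥤ GrMod l where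
  obj M := indecObj F M
  map {M N} g :=
    { app := fun n => AddMonoidHom.mk' (fun x => ⟨(F.map (GrAlg.sqZeroMap g)).app n x.1, by
          rw [AddMonoidHom.mem_ker, map_comp_app]
          exact x.2⟩) fun x y => Subtype.ext (map_add ((F.map (GrAlg.sqZeroMap g)).app n) x.1 y.1)
      map_smul := fun h a x => Subtype.ext ((F.map _).map_smul h a x.1) }
  map_id M := GrMod.hom_ext fun n x => Subtype.ext
    (congrArg (fun t => GrMod.Hom.app t n x.1) (F.map_id (GrAlg.sqZero M)))
  map_comp f g := GrMod.hom_ext fun n x => Subtype.ext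
    (map_comp_app F (GrAlg.sqZeroMap f) (GrAlg.sqZeroMap g) n x.1).symm

lemma nat_app {C : Type (u + 1)} [Category.{u} C] {F G : C ⥤ GrMod l} (σ : F ⟶ G) {X Y : C}
    (f : X ⟶ Y) (n : ℤ) (x : (F.obj X).carrier n) :
    (σ.app Y).app n ((F.map f).app n x) = (G.map f).app n ((σ.app X).app n x) :=
  congrArg (fun t => GrMod.Hom.app t n x) (σ.naturality f)

/-- The map `𝒬(F) → 𝒬(G)` induced by a map `F → G`. -/
def indecMap {F G : GrAlg k ⥤ GrMod l} (σ : F ⟶ G) : indec F ⟶ indec G where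
  app M :=
    { app := fun n => AddMonoidHom.mk' (fun x => ⟨(σ.app (GrAlg.sqZero M)).app n x.1, by
          rw [AddMonoidHom.mem_ker, ← nat_app,
            show (F.map (GrAlg.sqZeroAug M)).app n x.1 = 0 from x.2, map_zero]⟩)
          fun x y => Subtype.ext (map_add ((σ.app (GrAlg.sqZero M)).app n) x.1 y.1)
      map_smul := fun h a x => Subtype.ext ((σ.app _).map_smul h a x.1) }
  naturality M N f := GrMod.hom_ext fun n x => Subtype.ext
    (nat_app σ (GrAlg.sqZeroMap f) n x.1)

/-- The canonical map `𝒬(F) → 𝒫(F)`: the composite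
`𝒬(F)(M) ⊆ F(k ⊕ M) → 𝒫(F)(k ⊕ M) → 𝒫(F)(M)`. -/
def Primitives.fromIndec {F : GrAlg k ⥤ GrMod l} (P : Primitives F) : indec F ⟶ P.obj where
  app M :=
    { app := fun n => AddMonoidHom.mk' (fun x => (P.obj.map (GrAlg.sqZeroSnd M)).app n
          ((P.unit.app (GrAlg.sqZero M)).app n x.1)) fun x y =>
        (congrArg ((P.obj.map (GrAlg.sqZeroSnd M)).app n)
          (map_add ((P.unit.app (GrAlg.sqZero M)).app n) x.1 y.1)).trans
          (map_add ((P.obj.map (GrAlg.sqZeroSnd M)).app n) _ _)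
      map_smul := fun h a x => (congrArg ((P.obj.map (GrAlg.sqZeroSnd M)).app _)
          ((P.unit.app (GrAlg.sqZero M)).map_smul h a x.1)).trans
          ((P.obj.map (GrAlg.sqZeroSnd M)).map_smul h a _) }
  naturality M N f := GrMod.hom_ext fun n x =>
    (congrArg ((P.obj.map (GrAlg.sqZeroSnd N)).app n)
      (nat_app P.unit (GrAlg.sqZeroMap f) n x.1)).trans
      ((map_comp_app P.obj ((GrAlg.forget k).map (GrAlg.sqZeroMap f)) (GrAlg.sqZeroSnd N) n _).trans
        (map_comp_app P.obj (GrAlg.sqZeroSnd M) f n _).symm)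

end schemes

section bimodules

variable {k l : GrRing.{u}}

/-- A pairing of formal bimodules `B` and `C` with values in `D`: a family of `l`-bilinear maps
`B(X) × C(Y) → D(Z)`, indexed by the `k`-bilinear maps `X × Y → Z` and natural in these. It is the
same as a family of `l`-bilinear maps `B(X) × C(Y) → D(X ⊗ₖ Y)` that is natural in `X` and `Y`. -/
@[ext] structure Pairing (B C D : GrMod k ⥤ GrMod l) where
  bil : ∀ {X Y Z : GrMod k}, BilinMap X Y Z → BilinMap (B.obj X) (C.obj Y) (D.obj Z)
  natural : ∀ {X Y Z X' Y' Z' : GrMod k} (f : BilinMap X Y Z) (f' : BilinMap X' Y' Z')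
    (u : X ⟶ X') (v : Y ⟶ Y') (w : Z ⟶ Z'), f.post w = f'.pre u v →
    (bil f).post (D.map w) = (bil f').pre (B.map u) (C.map v)

/-- Postcomposition of a pairing with a map of bimodules. -/
def Pairing.post {B C D D' : GrMod k ⥤ GrMod l} (p : Pairing B C D) (σ : D ⟶ D') :
    Pairing B C D' where
  bil {X Y Z} f := (p.bil f).post (σ.app Z)
  natural {X Y Z X' Y' Z'} f f' u v w h := by
    have e := p.natural f f' u v w h
    have e' := congrArg (fun t => BilinMap.post t (σ.app Z')) e
    ext i j n hn x y
    have := congrArg (fun t => BilinMap.app t hn x y) e'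
    exact (nat_app σ w n _).symm.trans this

/-- Precomposition of a pairing with maps of bimodules. -/
def Pairing.pre {B C D B' C' : GrMod k ⥤ GrMod l} (p : Pairing B C D) (σ : B' ⟶ B) (τ : C' ⟶ C) :
    Pairing B' C' D where
  bil {X Y Z} f := (p.bil f).pre (σ.app X) (τ.app Y)
  natural {X Y Z X' Y' Z'} f f' u v w h := by
    have e := p.natural f f' u v w h
    ext i j n hn x y
    have := congrArg (fun t => BilinMap.app t hn ((σ.app X).app _ x) ((τ.app Y).app _ y)) e
    refine this.trans ?_
    change (p.bil f').app hn ((B.map u).app _ ((σ.app X).app _ x))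
      ((C.map v).app _ ((τ.app Y).app _ y)) =
      (p.bil f').app hn ((σ.app X').app _ ((B'.map u).app _ x))
        ((τ.app Y').app _ ((C'.map v).app _ y))
    rw [nat_app, nat_app]

/-- The tensor product `B ⊗ₗ C` of formal bimodules: the formal bimodule that is universal for
pairings of `B` and `C`. -/
structure BimodTensor (B C : GrMod k ⥤ GrMod l) where
  obj : GrMod k ⥤ GrMod l
  formal : IsFormal obj
  pairing : Pairing B C obj
  universal : ∀ D : GrMod k ⥤ GrMod l, IsFormal D → ∀ p : Pairing B C D,
    ∃! σ : obj ⟶ D, pairing.post σ = p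

/-- The map `σ ⊗ τ : B ⊗ₗ C → B' ⊗ₗ C'`. -/
noncomputable def BimodTensor.map {B C B' C' : GrMod k ⥤ GrMod l} (T : BimodTensor B C)
    (T' : BimodTensor B' C') (σ : B ⟶ B') (τ : C ⟶ C') : T.obj ⟶ T'.obj :=
  (T.universal T'.obj T'.formal (T'.pairing.pre σ τ)).choose

/-- A pushout of `Y ← X → Z` in the category of formal bimodules. -/
structure FormalPushout {X Y Z : GrMod k ⥤ GrMod l} (r : X ⟶ Y) (s : X ⟶ Z) where
  obj : GrMod k ⥤ GrMod l
  formal : IsFormal obj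
  inl : Y ⟶ obj
  inr : Z ⟶ obj
  condition : r ≫ inl = s ≫ inr
  universal : ∀ D : GrMod k ⥤ GrMod l, IsFormal D → ∀ (a : Y ⟶ D) (b : Z ⟶ D), r ≫ a = s ≫ b →
    ∃! σ : obj ⟶ D, inl ≫ σ = a ∧ inr ≫ σ = b

/-- The lax structure `𝒬(F) ⊗ₗ 𝒬(G) → 𝒬(F ⊗ₗ G)`, as a pairing. For `x ∈ 𝒬(F)(X) ⊆ F(k ⊕ X)`,
`y ∈ 𝒬(G)(Y) ⊆ G(k ⊕ Y)` and a bilinear map `f : X × Y → Z`, push `x` and `y` forward to the algebra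
`k ⊕ X ⊕ Y ⊕ Z` and take `x ⊗ y` there; this comes from a unique element of
`𝒬(F ⊗ₗ G)(Z) ⊆ (F ⊗ₗ G)(k ⊕ Z)`. -/
def IsLax {F G : GrAlg k ⥤ GrMod l} (T : SchTensor F G)
    (p : Pairing (indec F) (indec G) (indec T.obj)) : Prop :=
  ∀ {X Y Z : GrMod k} (f : BilinMap X Y Z) {i j n : ℤ} (h : i + j = n)
    (x : ((indec F).obj X).carrier i) (y : ((indec G).obj Y).carrier j),
    (T.obj.map f.inclProd).app n ((p.bil f).app h x y).1 =
      (T.bilin.bil f.algebra).app h ((F.map f.inclLeft).app i x.1) ((G.map f.inclRight).app j y.1)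

/-- Associativity for pairings `A × B → AB`, `AB × C → D`, `B × C → BC` and `A × BC → D`. -/
def PairingAssoc {A B C AB BC D : GrMod k ⥤ GrMod l} (p : Pairing A B AB) (q : Pairing AB C D)
    (p' : Pairing B C BC) (q' : Pairing A BC D) : Prop :=
  ∀ {X Y W XY YW Z : GrMod k} (f : BilinMap X Y XY) (g : BilinMap XY W Z) (f' : BilinMap Y W YW)
    (g' : BilinMap X YW Z),
    (∀ {i j m ij jm n : ℤ} (h₁ : i + j = ij) (h₂ : ij + m = n) (h₃ : j + m = jm) (h₄ : i + jm = n)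
      (x : X.carrier i) (y : Y.carrier j) (w : W.carrier m),
      g.app h₂ (f.app h₁ x y) w = g'.app h₄ x (f'.app h₃ y w)) →
    ∀ {i j m ij jm n : ℤ} (h₁ : i + j = ij) (h₂ : ij + m = n) (h₃ : j + m = jm) (h₄ : i + jm = n)
      (a : (A.obj X).carrier i) (b : (B.obj Y).carrier j) (c : (C.obj W).carrier m),
      (q.bil g).app h₂ ((p.bil f).app h₁ a b) c = (q'.bil g').app h₄ a ((p'.bil f').app h₃ b c)

/-- An element of degree `0` of `A(k)`, i.e. a map from the unit object of the tensor product
`⊗ₗ`, is a left unit for a pairing `A × N → N`. -/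
def IsLeftUnit {A N : GrMod k ⥤ GrMod l} (e : (A.obj (GrAlg.base k).toMod).carrier 0)
    (p : Pairing A N N) : Prop :=
  ∀ (X : GrMod k) {n : ℤ} (h : 0 + n = n) (x : (N.obj X).carrier n),
    (p.bil X.smulBil).app h e x = x

/-- An element of degree `0` of `A(k)` is a right unit for a pairing `N × A → N`. -/
def IsRightUnit {A N : GrMod k ⥤ GrMod l} (e : (A.obj (GrAlg.base k).toMod).carrier 0)
    (p : Pairing N A N) : Prop :=
  ∀ (X : GrMod k) {n : ℤ} (h : n + 0 = n) (x : (N.obj X).carrier n),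
    (p.bil X.smulBilRight).app h x e = x

/-- The structure of an algebra, i.e. of a monoid with respect to `⊗ₗ`, on a formal bimodule. -/
@[ext] structure BimodAlgebra (A : GrMod k ⥤ GrMod l) where
  one : (A.obj (GrAlg.base k).toMod).carrier 0
  mul : Pairing A A A
  mul_assoc : PairingAssoc mul mul mul mul
  one_mul : IsLeftUnit one mul
  mul_one : IsRightUnit one mul

/-- The pairings `L` and `R` make `N` a two-sided module over the algebra `A`. -/
structure IsTwoSidedModule {B N : GrMod k ⥤ GrMod l} (A : BimodAlgebra B) (L : Pairing B N N)
    (R : Pairing N B N) : Prop where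
  one_smul : IsLeftUnit A.one L
  smul_one : IsRightUnit A.one R
  mul_smul : PairingAssoc A.mul L L L
  smul_mul : PairingAssoc R R A.mul R
  smul_smul : PairingAssoc L R R L

/-- An algebra structure on `𝒫(F)` is the one induced by the multiplication of `F` if the universal
map `η : F → 𝒫(F)` is multiplicative: the product of `η(x)` and `η(y)`, pushed forward along the
multiplication `R × R → R`, is `η(x y)`, and the unit is `η(1)`. -/
structure IsPrimAlgebra {F : FormalAlgSch k l} {P : Primitives F.mod} (A : BimodAlgebra P.obj) :
    Prop where
  one : A.one = (P.unit.app (GrAlg.base k)).app 0 (F.functor.obj (GrAlg.base k)).one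
  mul : ∀ (R : GrAlg k) {i j n : ℤ} (h : i + j = n) (x : (F.functor.obj R).carrier i)
    (y : (F.functor.obj R).carrier j),
    (A.mul.bil R.mulBil).app h ((P.unit.app R).app i x) ((P.unit.app R).app j y) =
      (P.unit.app R).app n ((F.functor.obj R).mul h x y)

end bimodules

end FormalPlethory

open FormalPlethory

/-! Maps out of the tensor products and pushouts of the statement are the same as pairings, so
everything is a matter of families of bilinear maps. Formal functors are handled through their
universal elements: two elements of one degree come from a single object, and maps that agree on an
element are equalized by a map along which the element lifts (`IsFormal.common`,
`IsFormal.equalize`). In this sense formal functors are left exact; in particular they are jointly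
injective on jointly monic pairs and, on modules, additive. Conversely, these lifting properties and
a small weakly initial family imply formality (`isFormal_of_lifts`).

The core is a pairing in which the first argument is still an algebra. Let `b : F × G → H` be
natural and bilinear, `x ∈ F(R)` and `y ∈ 𝒬(G)(Y)`. In `H(R ⊗ (k ⊕ Y))` the element `b(x, y)` dies
in `H(R)`, because `y` dies under the augmentation. The kernel of `R ⊗ (k ⊕ Y) → R` is the
square-zero ideal `R ⊗ Y`, so `b(x, y)` comes from a unique element of `𝒬(H)(R ⊗ Y)`
(`IsFormal.exists_indec`, `IsFormal.indec_injective`). This is `indecPair`. For `R = k ⊕ X`,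
followed by the projection `R → X`, it gives the lax structure (`laxPairing`), which is unique
because `Z` embeds into `k ⊕ X ⊕ Y ⊕ Z`.

For fixed `y` the assignment `x ↦ x y` is a natural map from `F` to the restriction of `𝒬(H)(- ⊗
Y)`. If `Y` is flat, this target is a formal bimodule (`IsFormal.tensorLeft`), and the universal
property of `𝒫(F)`, applied to a shift in order to allow for the degree of `y`, extends the map to
`𝒫(F)`. In general, pro-flatness says that `y` comes from a flat module, and formality makes the
choice immaterial (`extCover_eq`). The outcome is `MPair.extend` and the pairing `primIndec : 𝒫(F) ×
𝒬(G) → 𝒬(H)`. Its restriction along `c_F` is the lax structure, straight from the definition of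
`c_F`; by Koszul symmetry the same holds on `𝒬(F) × 𝒫(G)`. Hence the two pairings glue over the
pushout.

The product on `𝒫(F)` is obtained by extending `(x, y) ↦ η((x ⊗ 1)(1 ⊗ y))` in one argument and then
in the other. At the first stage the fixed argument lies in `F(S)`. Pro-flatness of `F` concerns
only the underlying modules, which is why `FlatMap` merely asks a linear map to factor through a
flat module. The same principle proves identities: they may be checked on the image of `η`, one
argument at a time, while the other arguments are held over flat modules (`MPair.ext_of_restr`,
`MPair.Assoc.of_restr_fst` and its companions). All axioms thereby reduce to unit and associativity
laws in algebras `F(C)`, where for associativity `C` is a triple tensor product. The right action is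
the Koszul flip of the left one. Since `F` is commutative, the laws for the right action follow from
those for the left action, and only the compatibility of the two actions is checked separately. -/

namespace FormalPlethory

/-! ### Pro-representability in terms of universal elements. -/

section proRep

variable {C : Type (u + 1)} [Category.{u} C] {I : Type u} [SmallCategory I]

/-- The elements `e i ∈ F (A i)` exhibit `F` as the functor represented by the pro-object `A`. -/
structure IsProRep (A : I ⥤ C) (F : C ⥤ Type u) (e : ∀ i, F.obj (A.obj i)) : Prop where
  map_elt : ∀ {i j : I} (t : i ⟶ j), F.map (A.map t) (e i) = e j
  surj : ∀ {M : C} (x : F.obj M), ∃ (i : I) (g : A.obj i ⟶ M), F.map g (e i) = x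
  eq : ∀ {i : I} {M : C} (g g' : A.obj i ⟶ M), F.map g (e i) = F.map g' (e i) →
    ∃ (j : I) (t : j ⟶ i), A.map t ≫ g = A.map t ≫ g'

/-- The universal elements of `proHom A`. -/
noncomputable def proHomElt (A : I ⥤ C) (i : I) : (proHom A).obj (A.obj i) :=
  (colimit.ι (A.op ⋙ coyoneda) (Opposite.op i)).app (A.obj i) (𝟙 (A.obj i))

lemma proHom_map_elt (A : I ⥤ C) (i : I) {M : C} (g : A.obj i ⟶ M) :
    (proHom A).map g (proHomElt A i) =
      (colimit.ι (A.op ⋙ coyoneda) (Opposite.op i)).app M g := by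
  have := ConcreteCategory.congr_hom
    ((colimit.ι (A.op ⋙ coyoneda) (Opposite.op i)).naturality g) (𝟙 (A.obj i))
  refine this.symm.trans ?_
  exact congrArg ((colimit.ι (A.op ⋙ coyoneda) (Opposite.op i)).app M) (Category.id_comp g)

/-- The colimit cocone computing the values of `proHom A`. -/
noncomputable def isColimitProHom (A : I ⥤ C) (M : C) :
    IsColimit (((evaluation C (Type u)).obj M).mapCocone (colimit.cocone (A.op ⋙ coyoneda))) :=
  isColimitOfPreserves _ (colimit.isColimit _)

/-- The colimit is computed pointwise and is filtered. So every element is represented by a map out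
of some `A i`, and two such maps are identified exactly when a transition map equalizes them. -/
lemma isProRep_proHom [IsCofiltered I] (A : I ⥤ C) : IsProRep A (proHom A) (proHomElt A) where
  map_elt {i j} t := by
    rw [proHom_map_elt]
    have := ConcreteCategory.congr_hom (NatTrans.congr_app
      (colimit.w (A.op ⋙ coyoneda) t.op) (A.obj j)) (𝟙 (A.obj j))
    refine Eq.trans ?_ this
    change _ = (colimit.ι (A.op ⋙ coyoneda) (Opposite.op i)).app (A.obj j) (A.map t ≫ 𝟙 _)
    rw [Category.comp_id]
  surj {M} x := by
    obtain ⟨j, y, hy⟩ := Types.jointly_surjective_of_isColimit (isColimitProHom A M) x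
    exact ⟨j.unop, y, (proHom_map_elt A j.unop y).trans hy⟩
  eq {i M} g g' h := by
    rw [proHom_map_elt, proHom_map_elt] at h
    obtain ⟨j, f, hf⟩ :=
      (Types.FilteredColimit.isColimit_eq_iff' (isColimitProHom A M)
        (i := Opposite.op i) g g').1 h
    exact ⟨j.unop, f.unop, hf⟩

lemma IsProRep.of_iso {A : I ⥤ C} {F G : C ⥤ Type u} {e : ∀ i, F.obj (A.obj i)}
    (h : IsProRep A F e) (σ : F ≅ G) : IsProRep A G (fun i => σ.hom.app _ (e i)) where
  map_elt {i j} t := by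
    rw [← NatTrans.naturality_apply, h.map_elt]
  surj {M} x := by
    obtain ⟨i, g, hg⟩ := h.surj (σ.inv.app M x)
    refine ⟨i, g, ?_⟩
    rw [← NatTrans.naturality_apply, hg]
    exact ConcreteCategory.congr_hom (σ.inv_hom_id_app M) x
  eq {i M} g g' hg := by
    rw [← NatTrans.naturality_apply, ← NatTrans.naturality_apply] at hg
    refine h.eq g g' ?_
    have := congrArg (σ.inv.app M) hg
    have k : ∀ y, σ.inv.app M (σ.hom.app M y) = y :=
      fun y => ConcreteCategory.congr_hom (σ.hom_inv_id_app M) y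
    rwa [k, k] at this

/-- Both representing maps can be precomposed with transition maps from one index, and the universal
elements are compatible with these. -/
lemma IsProRep.common [IsCofiltered I] {A : I ⥤ C} {F : C ⥤ Type u} {e : ∀ i, F.obj (A.obj i)}
    (h : IsProRep A F e) {M N : C} (x : F.obj M) (y : F.obj N) :
    ∃ (i : I) (g : A.obj i ⟶ M) (g' : A.obj i ⟶ N), F.map g (e i) = x ∧ F.map g' (e i) = y := by
  obtain ⟨i, g, rfl⟩ := h.surj x
  obtain ⟨j, g', rfl⟩ := h.surj y
  refine ⟨IsCofiltered.min i j, A.map (IsCofiltered.minToLeft i j) ≫ g,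
    A.map (IsCofiltered.minToRight i j) ≫ g', ?_, ?_⟩
  · rw [F.map_comp, ConcreteCategory.comp_apply, h.map_elt]
  · rw [F.map_comp, ConcreteCategory.comp_apply, h.map_elt]

/-- The map `proHom A → F` given by a compatible family of elements. -/
noncomputable def proHomDesc (A : I ⥤ C) (F : C ⥤ Type u) (e : ∀ i, F.obj (A.obj i))
    (he : ∀ {i j : I} (t : i ⟶ j), F.map (A.map t) (e i) = e j) : proHom A ⟶ F :=
  colimit.desc (A.op ⋙ coyoneda)
    { pt := F
      ι :=
        { app := fun i => coyonedaEquiv.symm (e i.unop)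
          naturality := fun i j t => by
            ext M g
            change F.map (A.map t.unop ≫ g) (e j.unop) = F.map g (e i.unop)
            rw [F.map_comp, ConcreteCategory.comp_apply, he] } }

lemma proHomDesc_elt (A : I ⥤ C) (F : C ⥤ Type u) (e : ∀ i, F.obj (A.obj i))
    (he : ∀ {i j : I} (t : i ⟶ j), F.map (A.map t) (e i) = e j) (i : I) {M : C}
    (g : A.obj i ⟶ M) :
    (proHomDesc A F e he).app M ((proHom A).map g (proHomElt A i)) = F.map g (e i) := by
  rw [proHom_map_elt]
  exact ConcreteCategory.congr_hom (NatTrans.congr_app (colimit.ι_desc (F := A.op ⋙ coyoneda) _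
    (Opposite.op i)) M) g

lemma IsProRep.nonempty_iso [IsCofiltered I] {A : I ⥤ C} {F : C ⥤ Type u}
    {e : ∀ i, F.obj (A.obj i)} (h : IsProRep A F e) : Nonempty (proHom A ≅ F) := by
  have hA := isProRep_proHom A
  have : ∀ M, IsIso ((proHomDesc A F e h.map_elt).app M) := fun M => by
    rw [isIso_iff_bijective]
    constructor
    · intro x y hxy
      obtain ⟨i, g, g', rfl, rfl⟩ := hA.common x y
      rw [proHomDesc_elt, proHomDesc_elt] at hxy
      obtain ⟨j, t, ht⟩ := h.eq g g' hxy
      rw [← hA.map_elt t, ← ConcreteCategory.comp_apply, ← ConcreteCategory.comp_apply,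
        ← Functor.map_comp, ← Functor.map_comp, ht]
    · intro x
      obtain ⟨i, g, rfl⟩ := h.surj x
      exact ⟨_, proHomDesc_elt A F e h.map_elt i g⟩
  have := NatIso.isIso_of_isIso_app (proHomDesc A F e h.map_elt)
  exact ⟨asIso (proHomDesc A F e h.map_elt)⟩

end proRep

/-! ### Lifting properties of formal functors, and a criterion for formality. -/

section formalCriterion

variable {k l : GrRing.{u}} {C : Type (u + 1)} [Category.{u} C]

lemma IsFormal.exists_isProRep {F : C ⥤ GrMod l} (h : IsFormal F) (q : ℤ) :
    ∃ (I : Type u) (_ : SmallCategory I) (_ : IsCofiltered I) (A : I ⥤ C)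
      (e : ∀ i, (F.obj (A.obj i)).carrier q), IsProRep A (F ⋙ GrMod.deg l q) e := by
  obtain ⟨I, _, _, A, ⟨σ⟩⟩ := h q
  exact ⟨I, _, ‹_›, A, _, (isProRep_proHom A).of_iso σ⟩

lemma IsFormal.of_isProRep {F : C ⥤ GrMod l}
    (h : ∀ q : ℤ, ∃ (I : Type u) (_ : SmallCategory I) (_ : IsCofiltered I) (A : I ⥤ C)
      (e : ∀ i, (F.obj (A.obj i)).carrier q), IsProRep A (F ⋙ GrMod.deg l q) e) : IsFormal F := by
  intro q
  obtain ⟨I, _, _, A, e, he⟩ := h q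
  exact ⟨I, _, ‹_›, A, he.nonempty_iso⟩

lemma IsFormal.of_iso {F G : C ⥤ GrMod l} (h : IsFormal F) (σ : F ≅ G) : IsFormal G := by
  intro q
  obtain ⟨I, _, _, A, ⟨τ⟩⟩ := h q
  exact ⟨I, _, ‹_›, A, ⟨τ ≪≫ Functor.isoWhiskerRight σ (GrMod.deg l q)⟩⟩

lemma map_id_app (F : C ⥤ GrMod l) (X : C) (n : ℤ) (x : (F.obj X).carrier n) :
    (F.map (𝟙 X)).app n x = x := by
  rw [F.map_id]; rfl

/-- Two elements of a formal functor, of the same degree, come from a common object. -/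
lemma IsFormal.common {F : C ⥤ GrMod l} (h : IsFormal F) {q : ℤ} {M N : C}
    (x : (F.obj M).carrier q) (y : (F.obj N).carrier q) :
    ∃ (P : C) (z : (F.obj P).carrier q) (g : P ⟶ M) (g' : P ⟶ N),
      (F.map g).app q z = x ∧ (F.map g').app q z = y := by
  obtain ⟨I, _, _, A, e, he⟩ := h.exists_isProRep q
  obtain ⟨i, g, g', h₁, h₂⟩ := he.common (M := M) (N := N) x y
  exact ⟨A.obj i, e i, g, g', h₁, h₂⟩

/-- Maps that agree on an element of a formal functor are equalized by a map through which the
element lifts. -/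
lemma IsFormal.equalize {F : C ⥤ GrMod l} (h : IsFormal F) {q : ℤ} {M N : C} (f g : M ⟶ N)
    (x : (F.obj M).carrier q) (hx : (F.map f).app q x = (F.map g).app q x) :
    ∃ (P : C) (z : (F.obj P).carrier q) (p : P ⟶ M), (F.map p).app q z = x ∧ p ≫ f = p ≫ g := by
  obtain ⟨I, _, _, A, e, he⟩ := h.exists_isProRep q
  obtain ⟨i, a, rfl⟩ := he.surj (M := M) x
  have h₂ := he.eq (M := N) (a ≫ f) (a ≫ g) (by
    change (F.map (a ≫ f)).app q (e i) = (F.map (a ≫ g)).app q (e i)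
    rw [← map_comp_app, ← map_comp_app]
    exact hx)
  obtain ⟨j, t, ht⟩ := h₂
  refine ⟨A.obj j, e j, A.map t ≫ a, ?_, by simpa using ht⟩
  rw [← map_comp_app]
  exact congrArg ((F.map a).app q) (he.map_elt t)

/-- Formal functors turn jointly monic pairs into jointly injective ones. -/
lemma IsFormal.joint_injective {F : C ⥤ GrMod l} (h : IsFormal F) {M N N' : C} (γ : M ⟶ N)
    (γ' : M ⟶ N') (hγ : ∀ {B : C} (g g' : B ⟶ M), g ≫ γ = g' ≫ γ → g ≫ γ' = g' ≫ γ' → g = g')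
    {q : ℤ} {x x' : (F.obj M).carrier q} (h₁ : (F.map γ).app q x = (F.map γ).app q x')
    (h₂ : (F.map γ').app q x = (F.map γ').app q x') : x = x' := by
  obtain ⟨P, z, g, g', rfl, rfl⟩ := h.common x x'
  rw [map_comp_app, map_comp_app] at h₁ h₂
  -- The second equalization starts from the result of the first, so that `p₂ ≫ p₁` equalizes the
  -- composites with `γ` and with `γ'` simultaneously.
  obtain ⟨P₁, z₁, p₁, rfl, e₁⟩ := h.equalize _ _ z h₁
  rw [map_comp_app, map_comp_app] at h₂
  obtain ⟨P₂, z₂, p₂, rfl, e₂⟩ := h.equalize _ _ z₁ h₂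
  have := hγ (p₂ ≫ p₁ ≫ g) (p₂ ≫ p₁ ≫ g') (by simp [e₁]) (by simpa using e₂)
  rw [map_comp_app, map_comp_app, map_comp_app, map_comp_app, this]

/-- The elements of degree `q` of `F (S i)`, as a small category. -/
structure EltIdx (F : C ⥤ GrMod l) (q : ℤ) {ι : Type u} (S : ι → C) : Type u where
  idx : ι
  elt : (F.obj (S idx)).carrier q

instance (F : C ⥤ GrMod l) (q : ℤ) {ι : Type u} (S : ι → C) : SmallCategory (EltIdx F q S) where
  Hom a b := {g : S a.idx ⟶ S b.idx // (F.map g).app q a.elt = b.elt}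
  id a := ⟨𝟙 _, map_id_app F _ q _⟩
  comp f g := ⟨f.1 ≫ g.1, by rw [← map_comp_app, f.2, g.2]⟩

/-- The diagram of the objects `S i`. -/
def EltIdx.diagram (F : C ⥤ GrMod l) (q : ℤ) {ι : Type u} (S : ι → C) : EltIdx F q S ⥤ C where
  obj a := S a.idx
  map f := f.1

/-- A functor whose categories of elements are cofiltered with a weakly initial small family is
formal. -/
lemma isFormal_of_lifts [Nonempty C] {F : C ⥤ GrMod l}
    (h₁ : ∀ {q : ℤ} {M N : C} (x : (F.obj M).carrier q) (y : (F.obj N).carrier q),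
      ∃ (P : C) (z : (F.obj P).carrier q) (g : P ⟶ M) (g' : P ⟶ N),
        (F.map g).app q z = x ∧ (F.map g').app q z = y)
    (h₂ : ∀ {q : ℤ} {M N : C} (f g : M ⟶ N) (x : (F.obj M).carrier q),
      (F.map f).app q x = (F.map g).app q x →
      ∃ (P : C) (z : (F.obj P).carrier q) (p : P ⟶ M), (F.map p).app q z = x ∧ p ≫ f = p ≫ g)
    (h₃ : ∀ q : ℤ, ∃ (ι : Type u) (S : ι → C), ∀ (M : C) (x : (F.obj M).carrier q),
      ∃ (i : ι) (z : (F.obj (S i)).carrier q) (g : S i ⟶ M), (F.map g).app q z = x) :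
    IsFormal F := by
  refine IsFormal.of_isProRep fun q => ?_
  obtain ⟨ι, S, hS⟩ := h₃ q
  have hne : Nonempty (EltIdx F q S) := by
    obtain ⟨M⟩ := ‹Nonempty C›
    obtain ⟨i, z, -, -⟩ := hS M 0
    exact ⟨⟨i, z⟩⟩
  -- The lifts given by `h₁` and `h₂` live on arbitrary objects; weak initiality of the family `S`
  -- replaces them by lifts on its members.
  have hcof : IsCofiltered (EltIdx F q S) :=
    { cone_objs := fun a b => by
        obtain ⟨P, z, g, g', e, e'⟩ := h₁ a.elt b.elt
        obtain ⟨i, y, p, rfl⟩ := hS P z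
        rw [map_comp_app] at e e'
        exact ⟨⟨i, y⟩, ⟨p ≫ g, e⟩, ⟨p ≫ g', e'⟩, trivial⟩
      cone_maps := fun a b f g => by
        obtain ⟨P, z, p, e, e'⟩ := h₂ f.1 g.1 a.elt (f.2.trans g.2.symm)
        obtain ⟨i, y, p', rfl⟩ := hS P z
        rw [map_comp_app] at e
        refine ⟨⟨i, y⟩, ⟨p' ≫ p, e⟩, Subtype.ext ?_⟩
        change (p' ≫ p) ≫ f.1 = (p' ≫ p) ≫ g.1
        simp [e'] }
  refine ⟨EltIdx F q S, _, hcof, EltIdx.diagram F q S, fun a => a.elt, fun t => t.2, ?_, ?_⟩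
  · intro M x
    obtain ⟨i, z, g, hg⟩ := hS M x
    exact ⟨⟨i, z⟩, g, hg⟩
  · intro a M g g' hg
    obtain ⟨P, z, p, e, e'⟩ := h₂ g g' a.elt hg
    obtain ⟨i, y, p', rfl⟩ := hS P z
    rw [map_comp_app] at e
    refine ⟨⟨i, y⟩, ⟨p' ≫ p, e⟩, ?_⟩
    change (p' ≫ p) ≫ g = (p' ≫ p) ≫ g'
    simp [e']

end formalCriterion

/-! ### Direct sums, and additivity of formal functors of modules. -/

section additive

variable {k l : GrRing.{u}}

/-- The direct sum of two modules. -/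
abbrev GrMod.prod (M N : GrMod k) : GrMod k where
  carrier n := M.carrier n × N.carrier n
  smul h a v := (M.smul h a v.1, N.smul h a v.2)
  smul_add h a v w := by simp [M.smul_add, N.smul_add]
  add_smul h a b v := by simp [M.add_smul, N.add_smul]
  one_smul h v := by simp [M.one_smul, N.one_smul]
  mul_smul h₁ h₂ h₃ h₄ a b v := by rw [M.mul_smul h₁ h₂ h₃ h₄, N.mul_smul h₁ h₂ h₃ h₄]

def GrMod.inl (M N : GrMod k) : M ⟶ M.prod N :=
  GrMod.Hom.mk (fun _ => AddMonoidHom.inl _ _) (by simp)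

def GrMod.inr (M N : GrMod k) : N ⟶ M.prod N :=
  GrMod.Hom.mk (fun _ => AddMonoidHom.inr _ _) (by simp)

def GrMod.fst (M N : GrMod k) : M.prod N ⟶ M :=
  GrMod.Hom.mk (fun _ => AddMonoidHom.fst _ _) (fun _ _ _ => rfl)

def GrMod.snd (M N : GrMod k) : M.prod N ⟶ N :=
  GrMod.Hom.mk (fun _ => AddMonoidHom.snd _ _) (fun _ _ _ => rfl)

def GrMod.pair {L M N : GrMod k} (f : L ⟶ M) (g : L ⟶ N) : L ⟶ M.prod N :=
  GrMod.Hom.mk (fun n => (f.app n).prod (g.app n))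
    (fun h a x => Prod.ext (f.map_smul h a x) (g.map_smul h a x))

def GrMod.copair {L M N : GrMod k} (f : M ⟶ L) (g : N ⟶ L) : M.prod N ⟶ L :=
  GrMod.Hom.mk (fun n => (f.app n).coprod (g.app n)) (fun h a x => by
    simp [f.map_smul, g.map_smul, L.smul_add])

/-- `x` and `0` come from one element `z` along `g` and `g'`. As `w` vanishes, `g ≫ w = g' ≫ w`, so
the images of `x` and of `0` coincide. -/
lemma IsFormal.map_eq_zero {D : GrMod k ⥤ GrMod l} (hD : IsFormal D) {M N : GrMod k} (w : M ⟶ N)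
    (hw : ∀ n x, w.app n x = 0) {q : ℤ} (x : (D.obj M).carrier q) : (D.map w).app q x = 0 := by
  obtain ⟨P, z, g, g', rfl, h⟩ := hD.common x (0 : (D.obj M).carrier q)
  have e : g ≫ w = g' ≫ w := GrMod.hom_ext fun n x => by simp [hw]
  rw [map_comp_app, e, ← map_comp_app, h, map_zero]

/-- A formal functor of modules is additive. -/
lemma IsFormal.map_hom_add {D : GrMod k ⥤ GrMod l} (hD : IsFormal D) {M N : GrMod k} (u v w : M ⟶ N)
    (hw : ∀ n x, w.app n x = u.app n x + v.app n x) {q : ℤ} (x : (D.obj M).carrier q) :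
    (D.map w).app q x = (D.map u).app q x + (D.map v).app q x := by
  -- Both sides have the same two components over `N ⊕ N`, and formal functors detect this. The
  -- codiagonal then turns the pair `(u, v)` into `u + v`.
  have key : (D.map (GrMod.pair u v)).app q x =
      (D.map (u ≫ GrMod.inl N N)).app q x + (D.map (v ≫ GrMod.inr N N)).app q x := by
    refine hD.joint_injective (GrMod.fst N N) (GrMod.snd N N) (fun g g' h h' => ?_) ?_ ?_
    · refine GrMod.hom_ext fun n x => Prod.ext ?_ ?_
      · exact congrArg (fun t => GrMod.Hom.app t n x) h
      · exact congrArg (fun t => GrMod.Hom.app t n x) h'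
    · rw [map_add, map_comp_app, map_comp_app, map_comp_app,
        hD.map_eq_zero ((v ≫ GrMod.inr N N) ≫ GrMod.fst N N) (fun _ _ => rfl), add_zero]
      rfl
    · rw [map_add, map_comp_app, map_comp_app, map_comp_app,
        hD.map_eq_zero ((u ≫ GrMod.inl N N) ≫ GrMod.snd N N) (fun _ _ => rfl), zero_add]
      rfl
  have e := congrArg ((D.map (GrMod.copair (𝟙 N) (𝟙 N))).app q) key
  rw [map_add, map_comp_app, map_comp_app, map_comp_app] at e
  have e₁ : GrMod.pair u v ≫ GrMod.copair (𝟙 N) (𝟙 N) = w :=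
    GrMod.hom_ext fun n x => (hw n x).symm
  have e₂ : (u ≫ GrMod.inl N N) ≫ GrMod.copair (𝟙 N) (𝟙 N) = u :=
    GrMod.hom_ext fun n x => add_zero _
  have e₃ : (v ≫ GrMod.inr N N) ≫ GrMod.copair (𝟙 N) (𝟙 N) = v :=
    GrMod.hom_ext fun n x => zero_add _
  rwa [e₁, e₂, e₃] at e

end additive

/-! ### The graded tensor product, its universal property and its symmetry. -/

section tensor

variable {k : GrRing.{u}}

namespace GrMod

/-- The class of a symbol in the tensor product. -/
def Tensor.mk {X Y : GrMod k} {i j n : ℤ} (h : i + j = n) (x : X.carrier i) (y : Y.carrier j) :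
    X.Tensor Y n :=
  QuotientAddGroup.mk (FreeAbelianGroup.of ⟨h, x, y⟩)

variable {X Y : GrMod k}

lemma Tensor.mk_eq_of_rel {n : ℤ} {a b : FreeAbelianGroup (PureTensor X Y n)}
    (h : TensorRel X Y n (a - b)) :
    (QuotientAddGroup.mk a : X.Tensor Y n) = QuotientAddGroup.mk b :=
  (QuotientAddGroup.eq_iff_sub_mem).2 (AddSubgroup.subset_closure h)

lemma Tensor.add_mk {i j n : ℤ} (h : i + j = n) (x x' : X.carrier i) (y : Y.carrier j) :
    Tensor.mk h (x + x') y = Tensor.mk h x y + Tensor.mk h x' y := by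
  have := Tensor.mk_eq_of_rel (a := FreeAbelianGroup.of (PureTensor.mk h (x + x') y))
    (b := FreeAbelianGroup.of (PureTensor.mk h x y) + FreeAbelianGroup.of (PureTensor.mk h x' y))
    (by rw [← sub_sub]; exact .add_left h x x' y)
  exact this

lemma Tensor.mk_add {i j n : ℤ} (h : i + j = n) (x : X.carrier i) (y y' : Y.carrier j) :
    Tensor.mk h x (y + y') = Tensor.mk h x y + Tensor.mk h x y' := by
  have := Tensor.mk_eq_of_rel (a := FreeAbelianGroup.of (PureTensor.mk h x (y + y')))
    (b := FreeAbelianGroup.of (PureTensor.mk h x y) + FreeAbelianGroup.of (PureTensor.mk h x y'))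
    (by rw [← sub_sub]; exact .add_right h x y y')
  exact this

lemma Tensor.rsmul_mk {i d j i' j' n : ℤ} (h₁ : i + d = i') (h₂ : i' + j = n) (h₃ : d + j = j')
    (h₄ : i + j' = n) (x : X.carrier i) (a : k.carrier d) (y : Y.carrier j) :
    Tensor.mk h₂ (X.rsmul h₁ x a) y = Tensor.mk h₄ x (Y.smul h₃ a y) :=
  Tensor.mk_eq_of_rel
    (a := FreeAbelianGroup.of ⟨h₂, X.rsmul h₁ x a, y⟩)
    (b := FreeAbelianGroup.of ⟨h₄, x, Y.smul h₃ a y⟩) (.balanced h₁ h₂ h₃ h₄ x a y)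

@[simp] lemma Tensor.zero_mk {i j n : ℤ} (h : i + j = n) (y : Y.carrier j) :
    Tensor.mk h (0 : X.carrier i) y = 0 := by
  have := Tensor.add_mk h (0 : X.carrier i) 0 y
  simpa using this

@[simp] lemma Tensor.mk_zero {i j n : ℤ} (h : i + j = n) (x : X.carrier i) :
    Tensor.mk h x (0 : Y.carrier j) = 0 := by
  have := Tensor.mk_add h x (0 : Y.carrier j) 0
  simpa using this

lemma Tensor.neg_mk {i j n : ℤ} (h : i + j = n) (x : X.carrier i) (y : Y.carrier j) :
    Tensor.mk h (-x) y = - Tensor.mk h x y := by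
  rw [eq_neg_iff_add_eq_zero, ← Tensor.add_mk]; simp

lemma Tensor.mk_neg {i j n : ℤ} (h : i + j = n) (x : X.carrier i) (y : Y.carrier j) :
    Tensor.mk h x (-y) = - Tensor.mk h x y := by
  rw [eq_neg_iff_add_eq_zero, ← Tensor.mk_add]; simp

lemma Tensor.induction {n : ℤ} {p : X.Tensor Y n → Prop}
    (mk : ∀ {i j : ℤ} (h : i + j = n) (x : X.carrier i) (y : Y.carrier j), p (Tensor.mk h x y))
    (add : ∀ t t', p t → p t' → p (t + t')) (t : X.Tensor Y n) : p t := by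
  obtain ⟨t, rfl⟩ := QuotientAddGroup.mk_surjective t
  induction t using FreeAbelianGroup.induction_on with
  | zero =>
    have := mk (zero_add n) (0 : X.carrier 0) (0 : Y.carrier n)
    rwa [Tensor.zero_mk] at this
  | of x => exact mk x.deg x.left x.right
  | neg x _ =>
    have := mk x.deg (-x.left) x.right
    rw [Tensor.neg_mk] at this
    exact this
  | add x y hx hy => exact add _ _ hx hy

/-- Additive maps out of a tensor product. -/
def Tensor.lift {n : ℤ} {A : Type*} [AddCommGroup A]
    (f : ∀ {i j : ℤ}, i + j = n → X.carrier i → Y.carrier j → A)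
    (add_left : ∀ {i j : ℤ} (h : i + j = n) (x x' : X.carrier i) (y : Y.carrier j),
      f h (x + x') y = f h x y + f h x' y)
    (add_right : ∀ {i j : ℤ} (h : i + j = n) (x : X.carrier i) (y y' : Y.carrier j),
      f h x (y + y') = f h x y + f h x y')
    (balanced : ∀ {i d j i' j' : ℤ} (h₁ : i + d = i') (h₂ : i' + j = n) (h₃ : d + j = j')
      (h₄ : i + j' = n) (x : X.carrier i) (a : k.carrier d) (y : Y.carrier j),
      f h₂ (X.rsmul h₁ x a) y = f h₄ x (Y.smul h₃ a y)) : X.Tensor Y n →+ A :=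
  QuotientAddGroup.lift _ (FreeAbelianGroup.lift fun t : PureTensor X Y n => f t.deg t.left t.right)
    (by
      rw [AddSubgroup.closure_le]
      rintro r (⟨h, x, x', y⟩ | ⟨h, x, y, y'⟩ | ⟨h₁, h₂, h₃, h₄, x, a, y⟩)
      · simp [add_left]
      · simp [add_right]
      · simp [balanced h₁ h₂ h₃ h₄])

@[simp] lemma Tensor.lift_mk {n : ℤ} {A : Type*} [AddCommGroup A]
    (f : ∀ {i j : ℤ}, i + j = n → X.carrier i → Y.carrier j → A) (h₁ h₂ h₃) {i j : ℤ}
    (h : i + j = n) (x : X.carrier i) (y : Y.carrier j) :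
    Tensor.lift f h₁ h₂ h₃ (Tensor.mk h x y) = f h x y :=
  FreeAbelianGroup.lift_apply_of _ _

/-- The action of a scalar on a tensor product. -/
def tensorSMul (X Y : GrMod k) {d m n : ℤ} (h : d + m = n) (a : k.carrier d) :
    X.Tensor Y m →+ X.Tensor Y n :=
  Tensor.lift (fun {i j} h' x y => Tensor.mk (show d + i + j = n by omega) (X.smul rfl a x) y)
    (fun h' x x' y => by rw [X.smul_add, Tensor.add_mk])
    (fun h' x y y' => by rw [Tensor.mk_add])
    (fun {i d' j i' j'} h₁ h₂ h₃ h₄ x b y => by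
      subst h₁
      rw [← X.smul_rsmul (ij := d + i) rfl (by omega) rfl rfl,
        Tensor.rsmul_mk (j' := j') _ _ h₃ (by omega)])

lemma tensorSMul_mk {d i j m n di : ℤ} (h : d + m = n) (a : k.carrier d) (h' : i + j = m)
    (h₁ : d + i = di) (h₂ : di + j = n) (x : X.carrier i) (y : Y.carrier j) :
    tensorSMul X Y h a (Tensor.mk h' x y) = Tensor.mk h₂ (X.smul h₁ a x) y := by
  subst h₁
  exact Tensor.lift_mk _ _ _ _ _ _ _

/-- The tensor product of graded modules. -/
def tensor (X Y : GrMod k) : GrMod k where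
  carrier n := X.Tensor Y n
  smul h a t := tensorSMul X Y h a t
  smul_add h a t t' := map_add _ _ _
  add_smul {i j n} h a b t := by
    induction t using Tensor.induction with
    | mk h' x y =>
      rw [tensorSMul_mk _ _ _ rfl (by omega), tensorSMul_mk _ _ _ rfl (by omega),
        tensorSMul_mk _ _ _ rfl (by omega), X.add_smul, Tensor.add_mk]
    | add t t' ht ht' => rw [map_add, map_add, map_add, ht, ht']; abel
  one_smul {n} h t := by
    induction t using Tensor.induction with
    | @mk i j h' x y => rw [tensorSMul_mk _ _ _ (zero_add i) h', X.one_smul]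
    | add t t' ht ht' => rw [map_add, ht, ht']
  mul_smul {i j m ij jm n} h₁ h₂ h₃ h₄ a b t := by
    induction t using Tensor.induction with
    | @mk i' j' h' x y =>
      rw [tensorSMul_mk _ _ _ (di := ij + i') rfl (by omega),
        tensorSMul_mk _ _ _ (di := j + i') rfl (by omega),
        tensorSMul_mk _ _ _ (di := ij + i') (by omega) (by omega),
        X.mul_smul h₁ rfl rfl]
    | add t t' ht ht' => rw [map_add, map_add, map_add, ht, ht']

/-- The element `x ⊗ y` of the tensor product. -/
def tmul {i j n : ℤ} (h : i + j = n) (x : X.carrier i) (y : Y.carrier j) :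
    (X.tensor Y).carrier n :=
  Tensor.mk h x y

lemma add_tmul {i j n : ℤ} (h : i + j = n) (x x' : X.carrier i) (y : Y.carrier j) :
    tmul h (x + x') y = tmul h x y + tmul h x' y :=
  Tensor.add_mk h x x' y

lemma tmul_add {i j n : ℤ} (h : i + j = n) (x : X.carrier i) (y y' : Y.carrier j) :
    tmul h x (y + y') = tmul h x y + tmul h x y' :=
  Tensor.mk_add h x y y'

lemma rsmul_tmul {i d j i' j' n : ℤ} (h₁ : i + d = i') (h₂ : i' + j = n) (h₃ : d + j = j')
    (h₄ : i + j' = n) (x : X.carrier i) (a : k.carrier d) (y : Y.carrier j) :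
    tmul h₂ (X.rsmul h₁ x a) y = tmul h₄ x (Y.smul h₃ a y) :=
  Tensor.rsmul_mk h₁ h₂ h₃ h₄ x a y

@[simp] lemma tmul_zero {i j n : ℤ} (h : i + j = n) (x : X.carrier i) :
    tmul h x (0 : Y.carrier j) = 0 :=
  Tensor.mk_zero h x

lemma sign_tmul {i j n : ℤ} (h : i + j = n) (x : X.carrier i) (y : Y.carrier j) (s : ℤˣ) :
    tmul h (s • x) y = s • tmul h x y :=
  sign_smul (fun x => tmul h x y) (fun x => Tensor.neg_mk h x y) s x

lemma tmul_sign {i j n : ℤ} (h : i + j = n) (x : X.carrier i) (y : Y.carrier j) (s : ℤˣ) :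
    tmul h x (s • y) = s • tmul h x y :=
  sign_smul (fun y => tmul h x y) (fun y => Tensor.mk_neg h x y) s y

lemma smul_tmul {d i j m n di : ℤ} (h : d + m = n) (a : k.carrier d) (h' : i + j = m)
    (h₁ : d + i = di) (h₂ : di + j = n) (x : X.carrier i) (y : Y.carrier j) :
    (X.tensor Y).smul h a (tmul h' x y) = tmul h₂ (X.smul h₁ a x) y :=
  tensorSMul_mk h a h' h₁ h₂ x y

@[elab_as_elim]
lemma tensor_induction {n : ℤ} {p : (X.tensor Y).carrier n → Prop} (t : (X.tensor Y).carrier n)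
    (tmul : ∀ {i j : ℤ} (h : i + j = n) (x : X.carrier i) (y : Y.carrier j), p (tmul h x y))
    (add : ∀ t t', p t → p t' → p (t + t')) : p t :=
  Tensor.induction tmul add t

/-- Additive maps out of a tensor product. -/
def liftAdd {n : ℤ} {A : Type*} [AddCommGroup A]
    (f : ∀ {i j : ℤ}, i + j = n → X.carrier i → Y.carrier j → A)
    (add_left : ∀ {i j : ℤ} (h : i + j = n) (x x' : X.carrier i) (y : Y.carrier j),
      f h (x + x') y = f h x y + f h x' y)
    (add_right : ∀ {i j : ℤ} (h : i + j = n) (x : X.carrier i) (y y' : Y.carrier j),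
      f h x (y + y') = f h x y + f h x y')
    (balanced : ∀ {i d j i' j' : ℤ} (h₁ : i + d = i') (h₂ : i' + j = n) (h₃ : d + j = j')
      (h₄ : i + j' = n) (x : X.carrier i) (a : k.carrier d) (y : Y.carrier j),
      f h₂ (X.rsmul h₁ x a) y = f h₄ x (Y.smul h₃ a y)) : (X.tensor Y).carrier n →+ A :=
  Tensor.lift f add_left add_right balanced

@[simp] lemma liftAdd_tmul {n : ℤ} {A : Type*} [AddCommGroup A]
    (f : ∀ {i j : ℤ}, i + j = n → X.carrier i → Y.carrier j → A) (h₁ h₂ h₃) {i j : ℤ}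
    (h : i + j = n) (x : X.carrier i) (y : Y.carrier j) :
    liftAdd f h₁ h₂ h₃ (tmul h x y) = f h x y :=
  Tensor.lift_mk f h₁ h₂ h₃ h x y

lemma liftAdd_ext {n : ℤ} {A : Type*} [AddCommGroup A] {f g : (X.tensor Y).carrier n →+ A}
    (h : ∀ {i j : ℤ} (h : i + j = n) (x : X.carrier i) (y : Y.carrier j),
      f (tmul h x y) = g (tmul h x y)) : f = g := by
  ext t
  induction t using tensor_induction with
  | tmul h' x y => exact h h' x y
  | add t t' ht ht' => rw [map_add, map_add, ht, ht']

/-- The universal bilinear map `X × Y → X ⊗ Y`. -/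
def tmulBil (X Y : GrMod k) : BilinMap X Y (X.tensor Y) where
  app h x y := tmul h x y
  add_left h x x' y := add_tmul h x x' y
  add_right h x y y' := tmul_add h x y y'
  smul_left h₁ h₂ h₃ h₄ a x y := (smul_tmul h₄ a h₃ h₁ h₂ x y).symm
  smul_right {d i j dj ij n} h₁ h₂ h₃ h₄ a x y := by
    -- The scalar crosses `x` by the balancing relation, which involves the right action on `X`; the
    -- definition of that action supplies the Koszul sign.
    rw [smul_tmul h₄ a h₃ rfl (show d + i + j = n by omega) x y,
      ← rsmul_tmul (i' := d + i) (add_comm i d) (by omega) h₁ h₂, GrMod.rsmul, sign_tmul]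

variable {Z W : GrMod k}

lemma tensor_hom_ext {f g : X.tensor Y ⟶ Z}
    (h : ∀ {i j n : ℤ} (h : i + j = n) (x : X.carrier i) (y : Y.carrier j),
      f.app n (tmul h x y) = g.app n (tmul h x y)) : f = g :=
  GrMod.Hom.ext (funext fun _ => liftAdd_ext fun h' x y => h h' x y)

/-- The linear map out of the tensor product given by a bilinear map. -/
def tensorLift (f : BilinMap X Y Z) : X.tensor Y ⟶ Z :=
  GrMod.Hom.mk (M := X.tensor Y)
    (fun n => liftAdd (fun h x y => f.app h x y) (fun h => f.add_left h)
      (fun h => f.add_right h) (fun h₁ h₂ h₃ h₄ x a y => f.rsmul_left h₁ h₂ h₃ h₄ x a y))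
    (fun {d m n} h a t => by
      induction t using tensor_induction with
      | @tmul i j h' x y =>
        rw [smul_tmul h a h' rfl (show d + i + j = n by omega), liftAdd_tmul, liftAdd_tmul,
          f.smul_left rfl _ h' h]
      | add t t' ht ht' =>
        rw [map_add, Z.smul_add, ← ht, ← ht', ← map_add]
        congr 1
        exact (X.tensor Y).smul_add h a t t')

@[simp] lemma tensorLift_tmul (f : BilinMap X Y Z) {i j n : ℤ} (h : i + j = n) (x : X.carrier i)
    (y : Y.carrier j) : (tensorLift f).app n (tmul h x y) = f.app h x y :=
  liftAdd_tmul (fun h x y => f.app h x y) (fun h => f.add_left h) (fun h => f.add_right h)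
    (fun h₁ h₂ h₃ h₄ x a y => f.rsmul_left h₁ h₂ h₃ h₄ x a y) h x y

/-- Functoriality of the tensor product. -/
def tensorHom (f : X ⟶ Z) (g : Y ⟶ W) : X.tensor Y ⟶ Z.tensor W :=
  tensorLift ((tmulBil Z W).pre f g)

@[simp] lemma tensorHom_tmul (f : X ⟶ Z) (g : Y ⟶ W) {i j n : ℤ} (h : i + j = n)
    (x : X.carrier i) (y : Y.carrier j) :
    (tensorHom f g).app n (tmul h x y) = tmul h (f.app i x) (g.app j y) :=
  tensorLift_tmul _ h x y

lemma tensorMap_tmul (X : GrMod k) {N N' : GrMod k} (g : N ⟶ N') {i j n : ℤ} (h : i + j = n)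
    (x : X.carrier i) (y : N.carrier j) :
    X.tensorMap g n (tmul h x y) = tmul h x (g.app j y) := by
  change QuotientAddGroup.mk (FreeAbelianGroup.map _ _) = _
  rw [FreeAbelianGroup.map_of_apply]
  rfl

lemma tensorMap_eq (X : GrMod k) {N N' : GrMod k} (g : N ⟶ N') (n : ℤ) :
    X.tensorMap g n = (tensorHom (𝟙 X) g).app n :=
  liftAdd_ext fun h x y =>
    (tensorMap_tmul X g h x y).trans (tensorHom_tmul (𝟙 X) g h x y).symm

/-- The functor `X ⊗ -`. -/
def tensorLeft (X : GrMod k) : GrMod k ⥤ GrMod k where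
  obj Y := X.tensor Y
  map g := tensorHom (𝟙 X) g
  map_id Y := tensor_hom_ext fun h x y => by simp
  map_comp f g := tensor_hom_ext fun h x y => by simp

/-- The functor `- ⊗ Y`. -/
def tensorRight (Y : GrMod k) : GrMod k ⥤ GrMod k where
  obj X := X.tensor Y
  map g := tensorHom g (𝟙 Y)
  map_id Y := tensor_hom_ext fun h x y => by simp
  map_comp f g := tensor_hom_ext fun h x y => by simp

end GrMod

/-- The bilinear map `(y, x) ↦ (-1)^{|x||y|} f (x, y)`. -/
def BilinMap.flip {X Y Z : GrMod k} (f : BilinMap X Y Z) : BilinMap Y X Z where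
  app {i j _} h y x := (i * j).negOnePow • f.app ((add_comm j i).trans h) x y
  add_left h y y' x := by rw [f.add_right, smul_add]
  add_right h y x x' := by rw [f.add_left, smul_add]
  smul_left {d i j di ij n} h₁ h₂ h₃ h₄ a x y := by
    subst h₁ h₃
    rw [f.smul_right rfl _ (add_comm j i) h₄, Z.smul_sign, smul_smul, ← Int.negOnePow_add]
    congr 1
    rw [Int.negOnePow_eq_iff]
    exact ⟨d * j, by ring⟩
  smul_right {d i j dj ij n} h₁ h₂ h₃ h₄ a x y := by
    subst h₁ h₃
    rw [f.smul_left rfl _ (add_comm j i) h₄, Z.smul_sign, smul_smul, ← Int.negOnePow_add]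
    congr 2
    ring

lemma BilinMap.flip_app {X Y Z : GrMod k} (f : BilinMap X Y Z) {i j n : ℤ} (h : i + j = n)
    (h' : j + i = n) (y : Y.carrier i) (x : X.carrier j) :
    f.flip.app h y x = (i * j).negOnePow • f.app h' x y := rfl

lemma negOnePow_mul_self_smul {A : Type*} [AddCommGroup A] (i : ℤ) (a : A) :
    i.negOnePow • i.negOnePow • a = a := by
  rw [smul_smul, ← Int.negOnePow_add, Int.negOnePow_even _ ⟨i, rfl⟩, one_smul]

@[simp] lemma BilinMap.flip_flip {X Y Z : GrMod k} (f : BilinMap X Y Z) : f.flip.flip = f := by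
  ext i j n h x y
  rw [flip_app _ h (by omega), flip_app _ _ h, mul_comm j i, negOnePow_mul_self_smul]

lemma BilinMap.flip_post {X Y Z Z' : GrMod k} (f : BilinMap X Y Z) (w : Z ⟶ Z') :
    (f.post w).flip = f.flip.post w := by
  ext i j n h x y
  exact (sign_smul (w.app n) (map_neg _) _ _).symm

lemma BilinMap.flip_pre {X Y Z X' Y' : GrMod k} (f : BilinMap X Y Z) (u : X' ⟶ X) (v : Y' ⟶ Y) :
    (f.pre u v).flip = f.flip.pre v u := rfl

namespace GrMod

/-- The symmetry `X ⊗ Y → Y ⊗ X`. -/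
def braiding (X Y : GrMod k) : X.tensor Y ⟶ Y.tensor X :=
  tensorLift (tmulBil Y X).flip

lemma braiding_tmul {X Y : GrMod k} {i j n : ℤ} (h : i + j = n) (h' : j + i = n)
    (x : X.carrier i) (y : Y.carrier j) :
    (braiding X Y).app n (tmul h x y) = (i * j).negOnePow • tmul h' y x :=
  tensorLift_tmul _ h x y

@[simp] lemma braiding_braiding (X Y : GrMod k) : braiding X Y ≫ braiding Y X = 𝟙 _ :=
  tensor_hom_ext fun {i j n} h x y => by
    rw [comp_app, braiding_tmul h (by omega), sign_smul ((braiding Y X).app n) (map_neg _),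
      braiding_tmul _ h, mul_comm j i, negOnePow_mul_self_smul, id_app]

/-- The symmetry of the tensor product as an isomorphism of functors. -/
def tensorLeftIso (X : GrMod k) : tensorLeft X ≅ tensorRight X :=
  NatIso.ofComponents (fun Y => ⟨braiding X Y, braiding Y X, braiding_braiding X Y,
      braiding_braiding Y X⟩) fun {Y Z} f => tensor_hom_ext fun {i j n} h x y => by
    change (braiding X Z).app n ((tensorHom (𝟙 X) f).app n (tmul h x y)) =
      (tensorHom f (𝟙 X)).app n ((braiding X Y).app n (tmul h x y))
    rw [tensorHom_tmul, braiding_tmul h (by omega), braiding_tmul h (by omega),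
      sign_smul ((tensorHom f (𝟙 X)).app n) (map_neg _), tensorHom_tmul]

lemma tmul_rsmul {X Y : GrMod k} {i j m ij jm n : ℤ} (h₁ : i + j = ij) (h₂ : ij + m = n)
    (h₃ : j + m = jm) (h₄ : i + jm = n) (x : X.carrier i) (y : Y.carrier j) (b : k.carrier m) :
    tmul h₄ x (Y.rsmul h₃ y b) = (X.tensor Y).rsmul h₂ (tmul h₁ x y) b :=
  ((tmulBil X Y).rsmul_right h₁ h₂ h₃ h₄ x y b).symm

lemma tmul_smul {X Y : GrMod k} {d i j dj ij n : ℤ} (h₁ : d + j = dj) (h₂ : i + dj = n)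
    (h₃ : i + j = ij) (h₄ : d + ij = n) (a : k.carrier d) (x : X.carrier i) (y : Y.carrier j) :
    tmul h₂ x (Y.smul h₁ a y) = (d * i).negOnePow • (X.tensor Y).smul h₄ a (tmul h₃ x y) :=
  (tmulBil X Y).smul_right h₁ h₂ h₃ h₄ a x y

/-- The bilinear map `X × (Y ⊗ W) → (X ⊗ Y) ⊗ W`. -/
def assocBil (X Y W : GrMod k) : BilinMap X (Y.tensor W) ((X.tensor Y).tensor W) where
  app {i m n} h x t := liftAdd
    (fun {j p} h' y w => tmul (show i + j + p = n by omega) (tmul rfl x y) w)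
    (fun h' y y' w => by rw [tmul_add, ← add_tmul])
    (fun h' y w w' => by rw [tmul_add])
    (fun {j d p j' p'} h₁ h₂ h₃ h₄ y a w => by
      rw [← rsmul_tmul (i' := i + j') (by omega) (by omega) h₃, tmul_rsmul rfl]) t
  add_left {i m n} h x x' t := by
    induction t using tensor_induction with
    | tmul h' y w =>
      rw [liftAdd_tmul, liftAdd_tmul, liftAdd_tmul, add_tmul, add_tmul]
    | add t t' ht ht' =>
      rw [map_add, map_add, map_add, ht, ht']
      abel
  add_right h x t t' := map_add _ _ _
  smul_left {d i j di ij n} h₁ h₂ h₃ h₄ a x t := by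
    induction t using tensor_induction with
    | @tmul j' p h' y w =>
      subst h₁ h₃
      rw [liftAdd_tmul, liftAdd_tmul, smul_tmul _ _ _ (di := d + i + j') (by omega) (by omega),
        smul_tmul]
    | add t t' ht ht' =>
      rw [map_add, map_add, ht, ht', GrMod.smul_add]
  smul_right {d i j dj ij n} h₁ h₂ h₃ h₄ a x t := by
    induction t using tensor_induction with
    | @tmul j' p h' y w =>
      subst h₁ h₃
      rw [smul_tmul _ a h' (di := d + j') rfl (by omega), liftAdd_tmul, liftAdd_tmul,
        smul_tmul _ _ _ (di := i + (d + j')) (by omega) (by omega),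
        ← sign_tmul, tmul_smul]
    | add t t' ht ht' =>
      rw [GrMod.smul_add, map_add, ht, ht', map_add, GrMod.smul_add, _root_.smul_add]

lemma assocBil_tmul {X Y W : GrMod k} {i j m ij jm n : ℤ} (h₁ : i + j = ij) (h₂ : ij + m = n)
    (h₃ : j + m = jm) (h₄ : i + jm = n) (x : X.carrier i) (y : Y.carrier j) (w : W.carrier m) :
    (assocBil X Y W).app h₄ x (tmul h₃ y w) =
      tmul h₂ (tmul h₁ x y) w := by
  subst h₁
  exact liftAdd_tmul (fun {j p} h' y w => tmul (show i + j + p = n by omega) (tmul rfl x y) w)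
    _ _ _ h₃ y w

end GrMod

end tensor

/-! ### Flat modules, and formality of `D (X ⊗ -)` for flat `X`. -/

section flatness

variable {k l : GrRing.{u}}

namespace GrMod

variable {X Y Z W M N : GrMod k}

lemma hom_congr {f g : M ⟶ N} (h : f = g) (n : ℤ) (x : M.carrier n) : f.app n x = g.app n x := by
  rw [h]

/-- A map with values in the range of an injection factors through it. -/
lemma exists_lift {P A B : GrMod k} (ι : A ⟶ B) (hι : ∀ n, Function.Injective (ι.app n)) (p : P ⟶ B)
    (hp : ∀ n x, ∃ y, ι.app n y = p.app n x) : ∃ q : P ⟶ A, q ≫ ι = p := by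
  choose q hq using hp
  refine ⟨GrMod.Hom.mk (fun n => AddMonoidHom.mk' (q n) fun x y => hι n ?_) ?_, ?_⟩
  · rw [hq, map_add, map_add, hq, hq]
  · intro i j n h a x
    apply hι n
    change ι.app n (q n _) = ι.app n (A.smul h a (q j x))
    rw [hq, p.map_smul, ι.map_smul, hq]
  · exact hom_ext fun n x => hq n x

/-- The difference of two maps. -/
def subHom (f g : M ⟶ N) : M ⟶ N :=
  GrMod.Hom.mk (fun n => f.app n - g.app n) (fun h a x => by
    rw [AddMonoidHom.sub_apply, AddMonoidHom.sub_apply, f.map_smul, g.map_smul, sub_eq_add_neg,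
      sub_eq_add_neg, N.smul_add, N.smul_neg])

@[simp] lemma subHom_app (f g : M ⟶ N) (n : ℤ) (x : M.carrier n) :
    (subHom f g).app n x = f.app n x - g.app n x := rfl

/-- The kernel of a map. -/
def ker (f : M ⟶ N) : GrMod k where
  carrier n := (f.app n).ker
  smul h a x := ⟨M.smul h a x.1, by
    rw [AddMonoidHom.mem_ker, f.map_smul, show f.app _ x.1 = 0 from x.2, GrMod.smul_zero]⟩
  smul_add h a x y := Subtype.ext (M.smul_add h a x.1 y.1)
  add_smul h a b x := Subtype.ext (M.add_smul h a b x.1)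
  one_smul h x := Subtype.ext (M.one_smul h x.1)
  mul_smul h₁ h₂ h₃ h₄ a b x := Subtype.ext (M.mul_smul h₁ h₂ h₃ h₄ a b x.1)

/-- The inclusion of the kernel. -/
def kerι (f : M ⟶ N) : ker f ⟶ M :=
  GrMod.Hom.mk (M := ker f) (fun n => (f.app n).ker.subtype) (fun _ _ _ => rfl)

lemma kerι_injective (f : M ⟶ N) (n : ℤ) : Function.Injective ((kerι f).app n) :=
  Subtype.val_injective

/-- Families of subgroups that are closed under the action. -/
structure Sub (M : GrMod k) where
  grp : ∀ n, AddSubgroup (M.carrier n)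
  smul_mem : ∀ {i j n : ℤ} (h : i + j = n) (a : k.carrier i) (x : M.carrier j), x ∈ grp j →
    M.smul h a x ∈ grp n

/-- The action of a scalar on a quotient module. -/
def Sub.smulQuot (K : Sub M) {i j n : ℤ} (h : i + j = n) (a : k.carrier i) :
    M.carrier j ⧸ K.grp j →+ M.carrier n ⧸ K.grp n :=
  QuotientAddGroup.map _ _ (AddMonoidHom.mk' (M.smul h a) (M.smul_add h a))
    (fun x hx => K.smul_mem h a x hx)

/-- The quotient of a module. -/
def quot (M : GrMod k) (K : Sub M) : GrMod k where
  carrier n := M.carrier n ⧸ K.grp n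
  smul h a := K.smulQuot h a
  smul_add h a x y := map_add _ _ _
  add_smul {i j n} h a b x := by
    induction x using QuotientAddGroup.induction_on with
    | H x => exact congrArg (QuotientAddGroup.mk (s := K.grp n)) (M.add_smul h a b x)
  one_smul {n} h x := by
    induction x using QuotientAddGroup.induction_on with
    | H x => exact congrArg (QuotientAddGroup.mk (s := K.grp n)) (M.one_smul h x)
  mul_smul {i j m ij jm n} h₁ h₂ h₃ h₄ a b x := by
    induction x using QuotientAddGroup.induction_on with
    | H x => exact congrArg (QuotientAddGroup.mk (s := K.grp n)) (M.mul_smul h₁ h₂ h₃ h₄ a b x)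

/-- The projection to a quotient. -/
def quotπ (K : Sub M) : M ⟶ quot M K :=
  GrMod.Hom.mk (N := quot M K) (fun n => QuotientAddGroup.mk' (K.grp n)) (fun _ _ _ => rfl)

/-- The kernel of a map as a family of subgroups. -/
def kerSub (f : M ⟶ N) : Sub M where
  grp n := (f.app n).ker
  smul_mem h a x hx := by
    rw [AddMonoidHom.mem_ker] at hx ⊢
    rw [f.map_smul, hx, GrMod.smul_zero]

/-- The injection of the coimage of a map. -/
def coimι (f : M ⟶ N) : quot M (kerSub f) ⟶ N :=
  GrMod.Hom.mk (M := quot M (kerSub f)) (fun n => QuotientAddGroup.kerLift (f.app n))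
    (fun {i j n} h a x => by
      induction x using QuotientAddGroup.induction_on with
      | H x => exact f.map_smul h a x)

@[simp] lemma quotπ_coimι (f : M ⟶ N) : quotπ (kerSub f) ≫ coimι f = f := rfl

lemma coimι_injective (f : M ⟶ N) (n : ℤ) : Function.Injective ((coimι f).app n) :=
  QuotientAddGroup.kerLift_injective (f.app n)

lemma quotπ_surjective (K : Sub M) (n : ℤ) : Function.Surjective ((quotπ K).app n) :=
  QuotientAddGroup.mk_surjective

lemma Flat.injective (hX : X.Flat) (g : M ⟶ N) (hg : ∀ n, Function.Injective (g.app n)) (n : ℤ) :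
    Function.Injective ((tensorHom (𝟙 X) g).app n) := by
  have := hX g hg n
  rwa [tensorMap_eq] at this

lemma flat_of_injective (h : ∀ ⦃N N' : GrMod k⦄ (g : N ⟶ N'),
    (∀ n, Function.Injective (g.app n)) → ∀ n, Function.Injective ((tensorHom (𝟙 X) g).app n)) :
    X.Flat := fun N N' g hg n => by
  rw [tensorMap_eq]
  exact h g hg n

lemma tensorHom_comp {X' X'' Y' Y'' : GrMod k} (f : X ⟶ X') (f' : X' ⟶ X'') (g : Y ⟶ Y')
    (g' : Y' ⟶ Y'') : tensorHom f g ≫ tensorHom f' g' = tensorHom (f ≫ f') (g ≫ g') :=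
  tensor_hom_ext fun h x y => by simp

lemma tensorHom_add_left {f g w : X ⟶ Z} (v : Y ⟶ W)
    (hw : ∀ n x, w.app n x = f.app n x + g.app n x) (n : ℤ) (t : (X.tensor Y).carrier n) :
    (tensorHom w v).app n t = (tensorHom f v).app n t + (tensorHom g v).app n t := by
  induction t using tensor_induction with
  | tmul h x y => rw [tensorHom_tmul, hw, add_tmul, tensorHom_tmul, tensorHom_tmul]
  | add t t' ht ht' => rw [map_add, map_add, map_add, ht, ht']; abel

lemma tensorHom_add_right {f g w : Y ⟶ W} (v : X ⟶ Z)
    (hw : ∀ n x, w.app n x = f.app n x + g.app n x) (n : ℤ) (t : (X.tensor Y).carrier n) :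
    (tensorHom v w).app n t = (tensorHom v f).app n t + (tensorHom v g).app n t := by
  induction t using tensor_induction with
  | tmul h x y => rw [tensorHom_tmul, hw, tmul_add, tensorHom_tmul, tensorHom_tmul]
  | add t t' ht ht' => rw [map_add, map_add, map_add, ht, ht']; abel

lemma tensorHom_zero_right {w : Y ⟶ W} (v : X ⟶ Z) (hw : ∀ n x, w.app n x = 0) (n : ℤ)
    (t : (X.tensor Y).carrier n) : (tensorHom v w).app n t = 0 := by
  induction t using tensor_induction with
  | tmul h x y => rw [tensorHom_tmul, hw, tmul_zero]
  | add t t' ht ht' => rw [map_add, ht, ht', add_zero]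

/-- A tensor killed by `id ⊗ g` is sent to zero by both projections, since these commute with `id ⊗
g` and the summands are flat. It is the sum of its two components, hence zero. -/
lemma Flat.prod (hX : X.Flat) (hY : Y.Flat) : (X.prod Y).Flat := by
  refine flat_of_injective fun N N' g hg n => (injective_iff_map_eq_zero _).2 fun t ht => ?_
  have key : ∀ {V : GrMod k} (_ : V.Flat) (p : X.prod Y ⟶ V),
      (tensorHom p (𝟙 N)).app n t = 0 := fun {V} hV p => by
    refine (injective_iff_map_eq_zero _).1 (hV.injective g hg n) _ ?_
    have e := hom_congr (show tensorHom p (𝟙 N) ≫ tensorHom (𝟙 V) g =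
      tensorHom (𝟙 (X.prod Y)) g ≫ tensorHom p (𝟙 N') by simp [tensorHom_comp]) n t
    rw [comp_app, comp_app, ht, map_zero] at e
    exact e
  have e := tensorHom_add_left (f := fst X Y ≫ inl X Y) (g := snd X Y ≫ inr X Y)
    (w := 𝟙 (X.prod Y)) (𝟙 N) (fun n x => by
      exact Prod.ext (add_zero _).symm (zero_add _).symm) n t
  have e₁ := hom_congr (tensorHom_comp (fst X Y) (inl X Y) (𝟙 N) (𝟙 N)) n t
  have e₂ := hom_congr (tensorHom_comp (snd X Y) (inr X Y) (𝟙 N) (𝟙 N)) n t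
  rw [comp_app, key hX, map_zero, Category.comp_id] at e₁
  rw [comp_app, key hY, map_zero, Category.comp_id] at e₂
  rw [← e₁, ← e₂, add_zero, (tensorLeft (X.prod Y)).map_id N |> fun h => show
    tensorHom (𝟙 (X.prod Y)) (𝟙 N) = 𝟙 _ from h] at e
  exact e

/-- The associativity map `X ⊗ (Y ⊗ W) → (X ⊗ Y) ⊗ W`. -/
def assocHom (X Y W : GrMod k) : X.tensor (Y.tensor W) ⟶ (X.tensor Y).tensor W :=
  tensorLift (assocBil X Y W)

lemma assocHom_tmul {i j m ij jm n : ℤ} (h₁ : i + j = ij) (h₂ : ij + m = n)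
    (h₃ : j + m = jm) (h₄ : i + jm = n) (x : X.carrier i) (y : Y.carrier j) (w : W.carrier m) :
    (assocHom X Y W).app n (tmul h₄ x (tmul h₃ y w)) = tmul h₂ (tmul h₁ x y) w :=
  (tensorLift_tmul _ _ _ _).trans (assocBil_tmul h₁ h₂ h₃ h₄ x y w)

/-- The associativity map `(X ⊗ Y) ⊗ W → X ⊗ (Y ⊗ W)`. -/
def assocInv (X Y W : GrMod k) : (X.tensor Y).tensor W ⟶ X.tensor (Y.tensor W) :=
  -- The associativity map for the reversed triple `W, Y, X`, conjugated with symmetries. Each of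
  -- the three pairs of factors is exchanged twice, so no sign remains.
  tensorHom (braiding X Y) (𝟙 W) ≫ braiding (Y.tensor X) W ≫ assocHom W Y X ≫
    braiding (W.tensor Y) X ≫ tensorHom (𝟙 X) (braiding W Y)

lemma assocInv_tmul {i j m ij jm n : ℤ} (h₁ : i + j = ij) (h₂ : ij + m = n)
    (h₃ : j + m = jm) (h₄ : i + jm = n) (x : X.carrier i) (y : Y.carrier j) (w : W.carrier m) :
    (assocInv X Y W).app n (tmul h₂ (tmul h₁ x y) w) = tmul h₄ x (tmul h₃ y w) := by
  subst h₁ h₃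
  simp only [assocInv, comp_app]
  rw [tensorHom_tmul, braiding_tmul rfl (add_comm j i), id_app, sign_tmul, map_zsmul_unit,
    braiding_tmul _ (show m + (i + j) = n by omega)]
  simp only [map_zsmul_unit]
  rw [assocHom_tmul (ij := j + m) (add_comm m j) (by omega) _ _, braiding_tmul _ (by omega)]
  simp only [map_zsmul_unit]
  rw [tensorHom_tmul, id_app, braiding_tmul (add_comm m j) rfl, tmul_sign, smul_smul, smul_smul,
    smul_smul, ← Int.negOnePow_add, ← Int.negOnePow_add, ← Int.negOnePow_add,
    Int.negOnePow_even _ ⟨i * j + m * i + m * j, by ring⟩, _root_.one_smul]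

/-- This composite shows that `assocInv` is injective, which is all that `Flat.tensor` needs. -/
lemma assocHom_assocInv (X Y W : GrMod k) : assocInv X Y W ≫ assocHom X Y W = 𝟙 _ := by
  refine tensor_hom_ext fun {i m n} h t w => ?_
  induction t using tensor_induction with
  | @tmul i j h' x y =>
    rw [comp_app, assocInv_tmul h' h (jm := j + m) rfl (by omega), assocHom_tmul h' h, id_app]
  | add t t' ht ht' => rw [add_tmul, map_add, map_add, ht, ht']

lemma assocInv_naturality (X Y : GrMod k) (g : M ⟶ N) :
    tensorHom (𝟙 (X.tensor Y)) g ≫ assocInv X Y N =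
      assocInv X Y M ≫ tensorHom (𝟙 X) (tensorHom (𝟙 Y) g) := by
  refine tensor_hom_ext fun {i m n} h t w => ?_
  induction t using tensor_induction with
  | @tmul i j h' x y =>
    rw [comp_app, comp_app, tensorHom_tmul, id_app,
      assocInv_tmul h' h (jm := j + m) rfl (by omega),
      assocInv_tmul h' h (jm := j + m) rfl (by omega), tensorHom_tmul, tensorHom_tmul, id_app,
      id_app]
  | add t t' ht ht' => rw [add_tmul, map_add, map_add, ht, ht']

/-- Up to associativity, tensoring with `X ⊗ Y` is tensoring with `Y` and then with `X`. -/
lemma Flat.tensor (hX : X.Flat) (hY : Y.Flat) : (X.tensor Y).Flat := by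
  refine flat_of_injective fun N N' g hg n t t' h => ?_
  have e := congrArg ((assocInv X Y N').app n) h
  rw [← comp_app, ← comp_app, assocInv_naturality, comp_app, comp_app] at e
  have e' := congrArg ((assocHom X Y N).app n) (hX.injective _ (hY.injective g hg) n e)
  rwa [← comp_app, ← comp_app, assocHom_assocInv] at e'

lemma tmul_sub {i j n : ℤ} (h : i + j = n) (x : X.carrier i) (y y' : Y.carrier j) :
    tmul h x (y - y') = tmul h x y - tmul h x y' := by
  rw [eq_sub_iff_add_eq, ← tmul_add, sub_add_cancel]

/-- Right exactness of the tensor product, for the projection to a quotient. -/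
lemma exists_of_tensorHom_quotπ_eq_zero (X : GrMod k) (K : Sub M) {A : GrMod k} (ι : A ⟶ M)
    (hι : ∀ n, ∀ x ∈ K.grp n, ∃ y, ι.app n y = x) (n : ℤ) (t : (X.tensor M).carrier n)
    (ht : (tensorHom (𝟙 X) (quotπ K)).app n t = 0) :
    ∃ t', (tensorHom (𝟙 X) ι).app n t' = t := by
  have hmem : ∀ {i j : ℤ} (h : i + j = n) (x : X.carrier i) (y : M.carrier j), y ∈ K.grp j →
      tmul h x y ∈ ((tensorHom (𝟙 X) ι).app n).range := fun h x y hy => by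
    obtain ⟨y', rfl⟩ := hι _ y hy
    exact ⟨tmul h x y', tensorHom_tmul _ _ _ _ _⟩
  have hsv : ∀ j y, (quotπ K).app j (Function.surjInv (quotπ_surjective K j) y) = y :=
    fun j y => Function.surjInv_eq _ y
  have hout : ∀ {i j : ℤ} (h : i + j = n) (x : X.carrier i) (y : (quot M K).carrier j)
      (y' : M.carrier j), (quotπ K).app j y' = y →
      (QuotientAddGroup.mk (s := ((tensorHom (𝟙 X) ι).app n).range)
        (tmul h x (Function.surjInv (quotπ_surjective K j) y))) =
      QuotientAddGroup.mk (tmul h x y') := fun {i j} h x y y' hy => by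
    rw [QuotientAddGroup.eq_iff_sub_mem, ← tmul_sub]
    refine hmem h x _ ?_
    rw [← QuotientAddGroup.eq_iff_sub_mem]
    exact (Function.surjInv_eq (quotπ_surjective K j) y).trans hy.symm
  -- A map from `X ⊗ (M / K)` back to the cokernel of `id ⊗ ι`, obtained by lifting the second
  -- factor. By `hout` its values do not depend on the lift, and this is what makes it additive and
  -- balanced.
  let s : (X.tensor (quot M K)).carrier n →+
      (X.tensor M).carrier n ⧸ ((tensorHom (𝟙 X) ι).app n).range :=
    liftAdd (fun {i j} h x y => QuotientAddGroup.mk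
      (tmul h x (Function.surjInv (quotπ_surjective K j) y)))
      (fun h x x' y => by rw [add_tmul]; rfl)
      (fun {i j} h x y y' => by
        rw [hout h x (y + y') (Function.surjInv (quotπ_surjective K j) y +
          Function.surjInv (quotπ_surjective K j) y'), tmul_add]
        · rfl
        · rw [map_add, hsv, hsv])
      (fun {i d j i' j'} h₁ h₂ h₃ h₄ x a y => by
        rw [rsmul_tmul h₁ h₂ h₃ h₄, hout h₄ x ((quot M K).smul h₃ a y)
          (M.smul h₃ a (Function.surjInv (quotπ_surjective K j) y))]
        rw [(quotπ K).map_smul, hsv])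
  have hs : ∀ t : (X.tensor M).carrier n,
      s ((tensorHom (𝟙 X) (quotπ K)).app n t) = QuotientAddGroup.mk t := fun t => by
    induction t using tensor_induction with
    | tmul h x y =>
      rw [tensorHom_tmul, id_app]
      exact (liftAdd_tmul _ _ _ _ _ _ _).trans (hout h x _ y rfl)
    | add t t' ht ht' => rw [map_add, map_add, ht, ht']; rfl
  have := hs t
  rw [ht, map_zero] at this
  exact (QuotientAddGroup.eq_zero_iff t).1 this.symm

/-- Tensoring with a flat module preserves kernels. -/
lemma Flat.exists_of_tensorHom_eq_zero (hX : X.Flat) (w : M ⟶ N) (n : ℤ)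
    (t : (X.tensor M).carrier n) (ht : (tensorHom (𝟙 X) w).app n t = 0) :
    ∃ t', (tensorHom (𝟙 X) (kerι w)).app n t' = t := by
  refine exists_of_tensorHom_quotπ_eq_zero X (kerSub w) (kerι w) (fun n x hx => ⟨⟨x, hx⟩, rfl⟩) n t ?_
  -- The coimage injects into `N`, so by flatness a tensor killed by `w` is already zero in `X ⊗ (M
  -- / ker w)`; right exactness does the rest.
  refine (injective_iff_map_eq_zero _).1 (hX.injective (coimι w) (coimι_injective w) n) _ ?_
  rw [← comp_app, tensorHom_comp, quotπ_coimι, Category.comp_id, ht]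

/-- An element of a tensor product only involves finitely many elements of the second factor. -/
lemma exists_list_support (X M : GrMod k) (n : ℤ) (t : (X.tensor M).carrier n) :
    ∃ L : List (Σ j, M.carrier j), ∀ (A : GrMod k) (ι : A ⟶ M),
      (∀ p ∈ L, ∃ y, ι.app p.1 y = p.2) → ∃ t', (tensorHom (𝟙 X) ι).app n t' = t := by
  induction t using tensor_induction with
  | @tmul i j h x y =>
    refine ⟨[⟨j, y⟩], fun A ι hι => ?_⟩
    obtain ⟨y', hy'⟩ := hι ⟨j, y⟩ (by simp)
    exact ⟨tmul h x y', by rw [tensorHom_tmul, hy', id_app]⟩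
  | add t t' ht ht' =>
    obtain ⟨L, hL⟩ := ht
    obtain ⟨L', hL'⟩ := ht'
    refine ⟨L ++ L', fun A ι hι => ?_⟩
    obtain ⟨s, hs⟩ := hL A ι fun p hp => hι p (by simp [hp])
    obtain ⟨s', hs'⟩ := hL' A ι fun p hp => hι p (by simp [hp])
    exact ⟨s + s', by rw [map_add, hs, hs']⟩

open scoped Classical in
/-- The free module on generators of degrees `δ s`. -/
noncomputable def free (k : GrRing.{u}) {S : Type u} (δ : S → ℤ) : GrMod k where
  carrier n := Π₀ s : S, k.carrier (n - δ s)
  smul {i j n} h a := DFinsupp.mapRange.addMonoidHom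
    (fun s => AddMonoidHom.mk' (k.mul (show i + (j - δ s) = n - δ s by omega) a) (k.mul_add _ a))
  smul_add h a x y := map_add _ _ _
  add_smul h a b x := by ext s; simp [k.add_mul]
  one_smul h x := by ext s; simp [k.one_mul]
  mul_smul {i j m ij jm n} h₁ h₂ h₃ h₄ a b x := by
    ext s
    exact k.mul_assoc h₁ _ _ _ a b (x s)

open scoped Classical in
/-- The map out of a free module given by the images of the generators. -/
noncomputable def freeLift {S : Type u} {δ : S → ℤ} (m : ∀ s, M.carrier (δ s)) : free k δ ⟶ M :=
  GrMod.Hom.mk (M := free k δ)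
    (fun n => DFinsupp.sumAddHom fun s => AddMonoidHom.mk'
      (fun a : k.carrier (n - δ s) => M.smul (sub_add_cancel n (δ s)) a (m s))
      fun a b => M.add_smul _ a b _)
    (fun {i j n} h a x => by
      have : (DFinsupp.sumAddHom fun s => AddMonoidHom.mk'
          (fun a : k.carrier (n - δ s) => M.smul (sub_add_cancel n (δ s)) a (m s))
          fun a b => M.add_smul _ a b _).comp (DFinsupp.mapRange.addMonoidHom (fun s =>
          AddMonoidHom.mk' (k.mul (show i + (j - δ s) = n - δ s by omega) a) (k.mul_add _ a))) =
          (AddMonoidHom.mk' (M.smul h a) (M.smul_add h a)).comp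
          (DFinsupp.sumAddHom fun s => AddMonoidHom.mk'
            (fun a : k.carrier (j - δ s) => M.smul (sub_add_cancel j (δ s)) a (m s))
            fun a b => M.add_smul _ a b _) := by
        refine DFinsupp.addHom_ext fun s b => ?_
        simp only [AddMonoidHom.comp_apply, DFinsupp.mapRange.addMonoidHom_apply,
          DFinsupp.mapRange_single, DFinsupp.sumAddHom_single, AddMonoidHom.mk'_apply]
        exact M.mul_smul _ _ _ _ _ _ _
      exact DFunLike.congr_fun this x)

/-- In `free` the coefficient of a generator has degree `δ s - δ s`, which is zero but not by
definition; this provides the unit of `k` in such a degree. -/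
lemma exists_smul_eq_self (k : GrRing.{u}) {d : ℤ} (h : d = 0) :
    ∃ a : k.carrier d, ∀ (M : GrMod k) {n : ℤ} (h : d + n = n) (x : M.carrier n),
      M.smul h a x = x := by
  subst h
  exact ⟨k.one, fun M _ h x => M.one_smul h x⟩

lemma exists_freeLift_eq {S : Type u} {δ : S → ℤ} (m : ∀ s, M.carrier (δ s)) (s : S) :
    ∃ x, (freeLift m).app (δ s) x = m s := by
  classical
  obtain ⟨a, ha⟩ := exists_smul_eq_self k (sub_self (δ s))
  refine ⟨DFinsupp.single s a, ?_⟩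
  refine Eq.trans ?_ (ha M (sub_add_cancel (δ s) (δ s)) (m s))
  exact DFinsupp.sumAddHom_single (β := fun s' => k.carrier (δ s - δ s')) (fun s' =>
    AddMonoidHom.mk' (fun a : k.carrier (δ s - δ s') => M.smul (sub_add_cancel (δ s) (δ s')) a (m s'))
      fun a b => M.add_smul _ a b _) s a

end GrMod

/-- For a flat module `X` and a formal bimodule `D`, the functor `D (X ⊗ -)` is formal. -/
lemma IsFormal.tensorLeft {D : GrMod k ⥤ GrMod l} (hD : IsFormal D) {X : GrMod k} (hX : X.Flat) :
    IsFormal (GrMod.tensorLeft X ⋙ D) := by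
  have : Nonempty (GrMod k) := ⟨X⟩
  refine isFormal_of_lifts ?_ ?_ ?_
  · intro q M N x y
    have hz : ∀ {A B C : GrMod k} (f : A ⟶ B) (g : B ⟶ C), (∀ n x, (f ≫ g).app n x = 0) →
        ∀ x : (D.obj (X.tensor A)).carrier q, (D.map (GrMod.tensorHom (𝟙 X) g)).app q
          ((D.map (GrMod.tensorHom (𝟙 X) f)).app q x) = 0 := fun f g h x => by
      rw [map_comp_app, GrMod.tensorHom_comp]
      exact hD.map_eq_zero _ (fun n t => GrMod.tensorHom_zero_right _ h n t) x
    have hi : ∀ {A B : GrMod k} (f : A ⟶ B) (g : B ⟶ A), f ≫ g = 𝟙 A →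
        ∀ x : (D.obj (X.tensor A)).carrier q, (D.map (GrMod.tensorHom (𝟙 X) g)).app q
          ((D.map (GrMod.tensorHom (𝟙 X) f)).app q x) = x := fun {A B} f g h x => by
      rw [map_comp_app, GrMod.tensorHom_comp, h, Category.id_comp,
        show GrMod.tensorHom (𝟙 X) (𝟙 A) = 𝟙 _ from (GrMod.tensorLeft X).map_id A]
      exact map_id_app D _ q x
    -- By additivity of `D`, the sum of the two images over `X ⊗ (M ⊕ N)` projects to `x` and to
    -- `y`.
    refine ⟨M.prod N, (D.map (GrMod.tensorHom (𝟙 X) (GrMod.inl M N))).app q x +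
      (D.map (GrMod.tensorHom (𝟙 X) (GrMod.inr M N))).app q y, GrMod.fst M N, GrMod.snd M N, ?_, ?_⟩
    · refine (map_add ((D.map (GrMod.tensorHom (𝟙 X) (GrMod.fst M N))).app q) _ _).trans ?_
      exact (congrArg₂ _ (hi _ _ rfl x) (hz _ _ (fun _ _ => rfl) y)).trans (add_zero x)
    · refine (map_add ((D.map (GrMod.tensorHom (𝟙 X) (GrMod.snd M N))).app q) _ _).trans ?_
      exact (congrArg₂ _ (hz _ _ (fun _ _ => rfl) x) (hi _ _ rfl y)).trans (zero_add y)
  · intro q M N f g x hx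
    obtain ⟨P, z, p, hz, hp⟩ := hD.equalize (GrMod.tensorHom (𝟙 X) f) (GrMod.tensorHom (𝟙 X) g) x hx
    -- As `X` is flat, the kernel of `X ⊗ (f - g)` is the submodule `X ⊗ ker (f - g)`, so the
    -- equalizing map `p` factors through it.
    obtain ⟨p', rfl⟩ := GrMod.exists_lift (GrMod.tensorHom (𝟙 X) (GrMod.kerι (GrMod.subHom f g)))
      (hX.injective _ (GrMod.kerι_injective _)) p (fun n a => by
        refine hX.exists_of_tensorHom_eq_zero _ n _ ?_
        have e := GrMod.tensorHom_add_right (𝟙 X) (f := GrMod.subHom f g) (g := g) (w := f)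
          (fun n x => by simp) n (p.app n a)
        have e' := GrMod.hom_congr hp n a
        rw [GrMod.comp_app, GrMod.comp_app] at e'
        rw [e'] at e
        exact right_eq_add.1 e)
    refine ⟨GrMod.ker (GrMod.subHom f g), (D.map p').app q z, GrMod.kerι _, ?_, ?_⟩
    · rw [← hz]
      exact map_comp_app D p' _ q z
    · exact GrMod.hom_ext fun n x => sub_eq_zero.1 x.2
  · intro q
    obtain ⟨I, _, _, A, e, he⟩ := hD.exists_isProRep q
    -- A map `A i → X ⊗ M` uses only finitely many elements of `M` for each element of `A i`. It
    -- therefore lands in `X ⊗ M'`, where `M'` is generated by elements indexed by `A i × ℕ`. Up to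
    -- isomorphism `M'` is a quotient of one of a small set of free modules.
    refine ⟨Σ (i : I) (δ : (Σ n, (A.obj i).carrier n) × ULift.{u} ℕ → ℤ), (GrMod.free k δ).Sub,
      fun c => GrMod.quot _ c.2.2, fun M x => ?_⟩
    obtain ⟨i, g, hg⟩ := he.surj (M := X.tensor M) x
    choose L hL using fun p : Σ n, (A.obj i).carrier n =>
      GrMod.exists_list_support X M p.1 (g.app p.1 p.2)
    let m : (Σ n, (A.obj i).carrier n) × ULift.{u} ℕ → Σ j, M.carrier j :=
      -- The finite lists are padded to sequences by the zero element of degree zero.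
      fun p => (L p.1).getD p.2.down ⟨0, 0⟩
    let fr := GrMod.freeLift (k := k) (M := M) (δ := fun p => (m p).1) fun p => (m p).2
    obtain ⟨g', hg'⟩ := GrMod.exists_lift (GrMod.tensorHom (𝟙 X) (GrMod.coimι fr))
      (hX.injective _ (GrMod.coimι_injective _)) g (fun n a => by
        refine hL ⟨n, a⟩ _ _ fun p hp => ?_
        obtain ⟨r, hr, rfl⟩ := List.getElem_of_mem hp
        obtain ⟨y, hy⟩ := GrMod.exists_freeLift_eq (k := k) (M := M)
          (δ := fun p => (m p).1) (fun p => (m p).2) (⟨n, a⟩, ⟨r⟩)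
        have hm : m (⟨n, a⟩, ⟨r⟩) = (L ⟨n, a⟩)[r] := List.getD_eq_getElem _ _ hr
        rw [← hm]
        exact ⟨(GrMod.quotπ _).app _ y, hy⟩)
    refine ⟨⟨i, _, GrMod.kerSub fr⟩, (D.map g').app q (e i), GrMod.coimι fr, ?_⟩
    refine (map_comp_app D g' _ q (e i)).trans ?_
    exact (congrArg (fun t => GrMod.Hom.app (D.map t) q (e i)) hg').trans hg

lemma IsFormal.tensorRight {D : GrMod k ⥤ GrMod l} (hD : IsFormal D) {X : GrMod k} (hX : X.Flat) :
    IsFormal (GrMod.tensorRight X ⋙ D) :=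
  (hD.tensorLeft hX).of_iso (Functor.isoWhiskerRight (GrMod.tensorLeftIso X) D)

end flatness

/-! ### The tensor product of graded commutative algebras. -/

section algTensor

variable {k : GrRing.{u}}

namespace GrAlg

open GrMod

variable (R S : GrAlg k)

/-- The map `t ↦ (r ⊗ s) t` on a tensor product of algebras. -/
def mulTmul {p q n i j : ℤ} (h : p + q = n) (h' : i + j = p) (r : R.carrier i) (s : S.carrier j) :
    (R.toMod.tensor S.toMod).carrier q →+ (R.toMod.tensor S.toMod).carrier n :=
  liftAdd (fun {i' j'} h'' r' s' => (j * i').negOnePow •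
      tmul (X := R.toMod) (Y := S.toMod) (show i + i' + (j + j') = n by omega)
        (R.mul rfl r r') (S.mul rfl s s'))
    (fun h'' x x' y => by rw [R.mul_add, add_tmul, _root_.smul_add])
    (fun h'' x y y' => by rw [S.mul_add, tmul_add, _root_.smul_add])
    (fun {i' d j' i'' j''} h₁ h₂ h₃ h₄ x a y => by
      subst h₁ h₃
      have e₁ := R.mulBil.rsmul_right (ij := i + i') (n := i + (i' + d)) rfl (by omega) rfl rfl r x a
      have e₂ := S.mulBil.smul_right (ij := j + j') (n := j + (d + j')) rfl rfl rfl (by omega) a s y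
      simp only [GrAlg.mulBil] at e₁ e₂
      rw [← e₁, e₂, rsmul_tmul (j' := j + (d + j')) _ _ (by omega) (by omega), tmul_sign, smul_smul,
        ← Int.negOnePow_add]
      congr 2
      ring)

lemma mulTmul_tmul {p q n i j i' j' ii jj : ℤ} (h : p + q = n) (h' : i + j = p) (h'' : i' + j' = q)
    (h₁ : i + i' = ii) (h₂ : j + j' = jj) (h₃ : ii + jj = n) (r : R.carrier i) (s : S.carrier j)
    (r' : R.carrier i') (s' : S.carrier j') :
    mulTmul R S h h' r s (tmul (X := R.toMod) (Y := S.toMod) h'' r' s') =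
      (j * i').negOnePow •
        tmul (X := R.toMod) (Y := S.toMod) h₃ (R.mul h₁ r r') (S.mul h₂ s s') := by
  subst h₁ h₂
  exact liftAdd_tmul _ _ _ _ _ _ _

/-- The multiplication of a tensor product of algebras. -/
def tensorMul {p q n : ℤ} (h : p + q = n) : (R.toMod.tensor S.toMod).carrier p →+
    (R.toMod.tensor S.toMod).carrier q →+ (R.toMod.tensor S.toMod).carrier n :=
  liftAdd (fun {i j} h' r s => mulTmul R S h h' r s)
    (fun {i j} h' x x' y => liftAdd_ext fun {i' j'} h'' r s => by
      rw [AddMonoidHom.add_apply, mulTmul_tmul R S h h' h'' rfl rfl (by omega),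
        mulTmul_tmul R S h h' h'' rfl rfl (by omega), mulTmul_tmul R S h h' h'' rfl rfl (by omega),
        R.add_mul, add_tmul, _root_.smul_add])
    (fun {i j} h' x y y' => liftAdd_ext fun {i' j'} h'' r s => by
      rw [AddMonoidHom.add_apply, mulTmul_tmul R S h h' h'' rfl rfl (by omega),
        mulTmul_tmul R S h h' h'' rfl rfl (by omega), mulTmul_tmul R S h h' h'' rfl rfl (by omega),
        S.add_mul, tmul_add, _root_.smul_add])
    (fun {i d j i₁ j₁} h₁ h₂ h₃ h₄ x a y => liftAdd_ext fun {i' j'} h'' r s => by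
      subst h₁ h₃
      rw [mulTmul_tmul R S h _ h'' (ii := i + (d + i')) (by omega) rfl (by omega),
        mulTmul_tmul R S h _ h'' rfl (jj := d + (j + j')) (by omega) (by omega)]
      have e₁ := R.mulBil.rsmul_left (i := i) (n := i + (d + i')) rfl (by omega) rfl rfl x a r
      have e₂ := S.mulBil.smul_left (n := d + (j + j')) rfl (by omega) rfl rfl a y s
      -- Writing `a r` as `± r a` lets the scalar leave the first factor on its right, where the
      -- balancing relation can move it into the second factor.
      have e₃ : R.mul (show d + i' = d + i' from rfl) (R.alg d a) r =
          (d * i').negOnePow • R.toMod.rsmul (add_comm i' d) r a := by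
        rw [GrMod.rsmul, negOnePow_mul_self_smul]
      have e₄ := R.mulBil.rsmul_right (ij := i + i') (n := i + (d + i')) rfl (by omega)
        (add_comm i' d) rfl x r a
      have e₅ := R.mulBil.sign_right (n := i + (d + i')) rfl x (R.toMod.rsmul (add_comm i' d) r a)
        (d * i').negOnePow
      simp only [GrAlg.mulBil] at e₁ e₂ e₄ e₅
      rw [e₁, e₂, e₃, e₅, ← e₄, sign_tmul,
        rsmul_tmul (j' := d + (j + j')) _ _ rfl (by omega), smul_smul, ← Int.negOnePow_add]
      congr 2
      ring)

lemma tensorMul_tmul {p q n i j i' j' ii jj : ℤ} (h : p + q = n) (h' : i + j = p)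
    (h'' : i' + j' = q) (h₁ : i + i' = ii) (h₂ : j + j' = jj) (h₃ : ii + jj = n) (r : R.carrier i)
    (s : S.carrier j) (r' : R.carrier i') (s' : S.carrier j') :
    tensorMul R S h (tmul (X := R.toMod) (Y := S.toMod) h' r s)
        (tmul (X := R.toMod) (Y := S.toMod) h'' r' s') = (j * i').negOnePow •
        tmul (X := R.toMod) (Y := S.toMod) h₃ (R.mul h₁ r r') (S.mul h₂ s s') := by
  refine Eq.trans ?_ (mulTmul_tmul R S h h' h'' h₁ h₂ h₃ r s r' s')
  exact DFunLike.congr_fun (liftAdd_tmul _ _ _ _ _ _ _) _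

lemma mul_one (R : GrAlg k) {n : ℤ} (h : n + 0 = n) (a : R.carrier n) : R.mul h a R.one = a := by
  rw [R.mul_comm h (zero_add n), R.one_mul, MulZeroClass.mul_zero, Int.negOnePow_zero, _root_.one_smul]

/-- The tensor product of algebras. -/
def tensor : GrAlg k where
  carrier n := (R.toMod.tensor S.toMod).carrier n
  one := tmul (X := R.toMod) (Y := S.toMod) (add_zero 0) R.one S.one
  mul h a b := tensorMul R S h a b
  mul_add h a b c := map_add _ _ _
  add_mul h a b c := by rw [map_add]; rfl
  one_mul {n} h t := by
    induction t using tensor_induction with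
    | tmul h' r s =>
      rw [tensorMul_tmul R S h _ _ (zero_add _) (zero_add _) h', R.one_mul, S.one_mul,
        MulZeroClass.zero_mul, Int.negOnePow_zero, _root_.one_smul]
    | add t t' ht ht' => rw [map_add, ht, ht']
  mul_assoc {i j m ij jm n} h₁ h₂ h₃ h₄ a b c := by
    induction a using tensor_induction with
    | @tmul i₁ i₂ hi x x' =>
      induction b using tensor_induction with
      | @tmul j₁ j₂ hj y y' =>
        induction c using tensor_induction with
        | @tmul m₁ m₂ hm z z' =>
          rw [tensorMul_tmul R S h₁ hi hj rfl rfl (by omega), map_zsmul_unit,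
            AddMonoidHom.coe_smul, Pi.smul_apply,
            tensorMul_tmul R S h₂ _ hm (ii := i₁ + (j₁ + m₁)) (jj := i₂ + (j₂ + m₂))
              (by omega) (by omega) (by omega),
            tensorMul_tmul R S h₃ hj hm rfl rfl (by omega), map_zsmul_unit,
            tensorMul_tmul R S h₄ hi _ rfl rfl (by omega),
            R.mul_assoc rfl (by omega) rfl rfl, S.mul_assoc rfl (by omega) rfl rfl, smul_smul,
            smul_smul, ← Int.negOnePow_add, ← Int.negOnePow_add]
          congr 2
          ring
        | add t t' ht ht' => rw [map_add, map_add, map_add, ht, ht']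
      | add t t' ht ht' =>
        rw [map_add, map_add, map_add, AddMonoidHom.add_apply, AddMonoidHom.add_apply, map_add, ht, ht']
    | add t t' ht ht' =>
      simp only [map_add, AddMonoidHom.add_apply]
      rw [ht, ht']
  mul_comm {i j n} h h' a b := by
    induction a using tensor_induction with
    | @tmul i₁ i₂ hi x x' =>
      induction b using tensor_induction with
      | @tmul j₁ j₂ hj y y' =>
        rw [tensorMul_tmul R S h hi hj rfl rfl (by omega),
          tensorMul_tmul R S h' hj hi (add_comm _ _) (add_comm _ _) (by omega),
          R.mul_comm rfl (add_comm _ _) x y, S.mul_comm rfl (add_comm _ _) x' y',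
          sign_tmul, tmul_sign, smul_smul, smul_smul, smul_smul, ← Int.negOnePow_add,
          ← Int.negOnePow_add, ← Int.negOnePow_add]
        congr 1
        rw [Int.negOnePow_eq_iff]
        exact ⟨-(i₁ * j₂), by rw [← hi, ← hj]; ring⟩
      | add t t' ht ht' =>
        rw [map_add, map_add, AddMonoidHom.add_apply, ht, ht', _root_.smul_add]
    | add t t' ht ht' =>
      rw [map_add, map_add, AddMonoidHom.add_apply, ht, ht', _root_.smul_add]
  alg n := AddMonoidHom.mk' (fun a => tmul (X := R.toMod) (Y := S.toMod) (add_zero n)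
    (R.alg n a) S.one) (fun a b => by rw [map_add, add_tmul])
  alg_one := by
    change tmul _ _ _ = _
    rw [R.alg_one]
  alg_mul {i j n} h a b := by
    change tmul _ _ _ = tensorMul R S h (tmul _ _ _) (tmul _ _ _)
    rw [tensorMul_tmul R S h _ _ h (add_zero 0) (add_zero n), MulZeroClass.zero_mul,
      Int.negOnePow_zero, _root_.one_smul, R.alg_mul h, S.one_mul]

end GrAlg

end algTensor

/-! ### Maps out of tensor products of algebras and out of square-zero extensions. -/

section algTensorMaps

variable {k : GrRing.{u}}

namespace GrAlg

variable {R S C : GrAlg k}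

/-- The element `r ⊗ s` of a tensor product of algebras. -/
def tm {i j n : ℤ} (h : i + j = n) (r : R.carrier i) (s : S.carrier j) : (R.tensor S).carrier n :=
  GrMod.tmul (X := R.toMod) (Y := S.toMod) h r s

lemma add_tm {i j n : ℤ} (h : i + j = n) (r r' : R.carrier i) (s : S.carrier j) :
    tm h (r + r') s = tm h r s + tm h r' s :=
  GrMod.add_tmul (X := R.toMod) (Y := S.toMod) h r r' s

lemma tm_add {i j n : ℤ} (h : i + j = n) (r : R.carrier i) (s s' : S.carrier j) :
    tm h r (s + s') = tm h r s + tm h r s' :=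
  GrMod.tmul_add (X := R.toMod) (Y := S.toMod) h r s s'

@[simp] lemma tm_zero {i j n : ℤ} (h : i + j = n) (r : R.carrier i) :
    tm h r (0 : S.carrier j) = 0 :=
  GrMod.tmul_zero (X := R.toMod) (Y := S.toMod) h r

@[elab_as_elim]
lemma tm_induction {n : ℤ} {p : (R.tensor S).carrier n → Prop} (t : (R.tensor S).carrier n)
    (tm : ∀ {i j : ℤ} (h : i + j = n) (r : R.carrier i) (s : S.carrier j), p (tm h r s))
    (add : ∀ t t', p t → p t' → p (t + t')) : p t :=
  GrMod.tensor_induction (X := R.toMod) (Y := S.toMod) t tm add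

lemma tm_mul_tm {p q n i j i' j' ii jj : ℤ} (h : p + q = n) (h' : i + j = p) (h'' : i' + j' = q)
    (h₁ : i + i' = ii) (h₂ : j + j' = jj) (h₃ : ii + jj = n) (r : R.carrier i) (s : S.carrier j)
    (r' : R.carrier i') (s' : S.carrier j') :
    (R.tensor S).mul h (tm h' r s) (tm h'' r' s') =
      (j * i').negOnePow • tm h₃ (R.mul h₁ r r') (S.mul h₂ s s') :=
  tensorMul_tmul R S h h' h'' h₁ h₂ h₃ r s r' s'

lemma alg_tensor (n : ℤ) (a : k.carrier n) :
    (R.tensor S).alg n a = tm (add_zero n) (R.alg n a) S.one := rfl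

lemma tm_alg {n : ℤ} (a : k.carrier n) :
    tm (zero_add n) R.one (S.alg n a) = tm (add_zero n) (R.alg n a) S.one := by
  have := GrMod.rsmul_tmul (X := R.toMod) (Y := S.toMod) (zero_add n) (add_zero n) (add_zero n)
    (zero_add n) R.one a S.one
  simp only [GrMod.rsmul, MulZeroClass.mul_zero, Int.negOnePow_zero, _root_.one_smul,
    GrAlg.mul_one] at this
  exact this.symm

/-- The inclusion `R → R ⊗ S`. -/
def inL (R S : GrAlg k) : R ⟶ R.tensor S :=
  GrAlg.Hom.mk (B := R.tensor S)
    (fun n => AddMonoidHom.mk' (fun r => tm (add_zero n) r S.one) (fun r r' => add_tm _ r r' _))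
    rfl
    (fun {i j n} h a b => by
      simp only [AddMonoidHom.mk'_apply]
      rw [tm_mul_tm h _ _ h (add_zero 0) (add_zero n), MulZeroClass.zero_mul, Int.negOnePow_zero,
        _root_.one_smul, S.one_mul])
    (fun n a => rfl)

/-- The inclusion `S → R ⊗ S`. -/
def inR (R S : GrAlg k) : S ⟶ R.tensor S :=
  GrAlg.Hom.mk (B := R.tensor S)
    (fun n => AddMonoidHom.mk' (fun s => tm (zero_add n) R.one s) (fun r r' => tm_add _ _ r r'))
    rfl
    (fun {i j n} h a b => by
      simp only [AddMonoidHom.mk'_apply]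
      rw [tm_mul_tm h _ _ (add_zero 0) h (zero_add n), MulZeroClass.mul_zero, Int.negOnePow_zero,
        _root_.one_smul, R.one_mul])
    (fun n a => tm_alg a)

lemma inL_app {n : ℤ} (r : R.carrier n) : (inL R S).app n r = tm (add_zero n) r S.one := rfl

lemma inR_app {n : ℤ} (s : S.carrier n) : (inR R S).app n s = tm (zero_add n) R.one s := rfl

lemma inL_mul_inR {i j n : ℤ} (h : i + j = n) (r : R.carrier i) (s : S.carrier j) :
    (R.tensor S).mul h ((inL R S).app i r) ((inR R S).app j s) = tm h r s := by
  rw [inL_app, inR_app, tm_mul_tm h _ _ (add_zero i) (zero_add j) h, MulZeroClass.mul_zero,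
    Int.negOnePow_zero, _root_.one_smul, S.one_mul, R.mul_one]

/-- The linear map underlying an algebra map. -/
abbrev lin (f : R ⟶ S) : R.toMod ⟶ S.toMod := (GrAlg.forget k).map f

/-- The universal bilinear map `R × S → R ⊗ S`. -/
def tmBil (R S : GrAlg k) : BilinMap R.toMod S.toMod (R.tensor S).toMod :=
  (R.tensor S).mulBil.pre (lin (inL R S)) (lin (inR R S))

lemma tmBil_app {i j n : ℤ} (h : i + j = n) (r : R.carrier i) (s : S.carrier j) :
    (tmBil R S).app h r s = tm h r s :=
  inL_mul_inR h r s

/-- The module underlying the tensor product of algebras is the tensor product of modules. -/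
def toTensor (R S : GrAlg k) : (R.tensor S).toMod ⟶ R.toMod.tensor S.toMod :=
  GrMod.Hom.mk (M := (R.tensor S).toMod) (fun n => AddMonoidHom.id _)
    (fun {i j n} h a t => by
      change (R.tensor S).mul h ((R.tensor S).alg i a) t = (R.toMod.tensor S.toMod).smul h a t
      induction t using tm_induction with
      | @tm i' j' h' r s =>
        refine Eq.trans ?_
          (GrMod.smul_tmul (X := R.toMod) (Y := S.toMod) h a h' rfl (by omega) r s).symm
        rw [alg_tensor, tm_mul_tm h _ h' (ii := i + i') rfl (zero_add j') (by omega),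
          MulZeroClass.zero_mul, Int.negOnePow_zero, _root_.one_smul, S.one_mul]
        rfl
      | add t t' ht ht' =>
        rw [(R.tensor S).mul_add, ht, ht']
        exact ((R.toMod.tensor S.toMod).smul_add h a t t').symm)

/-- The linear map out of a tensor product of algebras given by a bilinear map. -/
def desc {Z : GrMod k} (f : BilinMap R.toMod S.toMod Z) : (R.tensor S).toMod ⟶ Z :=
  toTensor R S ≫ GrMod.tensorLift f

lemma desc_tm {Z : GrMod k} (f : BilinMap R.toMod S.toMod Z) {i j n : ℤ} (h : i + j = n)
    (r : R.carrier i) (s : S.carrier j) : (desc f).app n (tm h r s) = f.app h r s :=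
  GrMod.tensorLift_tmul f h r s

lemma tensor_linHom_ext {Z : GrMod k} {f g : (R.tensor S).toMod ⟶ Z}
    (h : ∀ {i j n : ℤ} (h : i + j = n) (r : R.carrier i) (s : S.carrier j),
      f.app n (tm h r s) = g.app n (tm h r s)) : f = g := by
  refine GrMod.hom_ext fun n t => ?_
  induction t using tm_induction with
  | tm h' r s => exact h h' r s
  | add t t' ht ht' => rw [map_add, map_add, ht, ht']

/-- The algebra map `R ⊗ S → C` given by algebra maps `R → C` and `S → C`. -/
def lift (α : R ⟶ C) (β : S ⟶ C) : R.tensor S ⟶ C :=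
  GrAlg.Hom.mk (A := R.tensor S) (desc (C.mulBil.pre (lin α) (lin β))).app
    (by
      refine (desc_tm _ _ _ _).trans ?_
      change C.mul _ (α.app 0 R.one) (β.app 0 S.one) = _
      rw [α.map_one, β.map_one, C.one_mul])
    (fun {i j n} h a b => by
      induction a using tm_induction with
      | @tm i₁ i₂ hi x x' =>
        induction b using tm_induction with
        | @tm j₁ j₂ hj y y' =>
          rw [tm_mul_tm h hi hj rfl rfl (by omega), map_zsmul_unit, desc_tm, desc_tm, desc_tm]
          change _ • C.mul _ (α.app _ (R.mul _ x y)) (β.app _ (S.mul _ x' y')) =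
            C.mul _ (C.mul _ (α.app _ x) (β.app _ x')) (C.mul _ (α.app _ y) (β.app _ y'))
          -- The factors are regrouped so that `β x'` passes `α y`; the sign that this costs is the
          -- one in the multiplication of the tensor product.
          rw [α.map_mul, β.map_mul,
            C.mul_assoc (j := i₂) (m := j) (jm := i₂ + j) hi h rfl (by omega),
            ← C.mul_assoc (ij := i₂ + j₁) (m := j₂) rfl (by omega) hj rfl,
            C.mul_comm rfl (add_comm j₁ i₂) (β.app _ x') (α.app _ y), C.sign_mul, C.mul_sign,
            C.mul_assoc (i := j₁) (j := i₂) (jm := i₂ + j₂) (add_comm j₁ i₂) _ rfl (by omega),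
            C.mul_assoc (i := i₁) (j := j₁) (m := i₂ + j₂) (jm := i₂ + j) rfl _ (by omega) (by omega)]
        | add t t' ht ht' =>
          rw [(R.tensor S).mul_add, map_add, ht, ht', map_add, C.mul_add]
      | add t t' ht ht' =>
        rw [(R.tensor S).add_mul, map_add, ht, ht', map_add, C.add_mul])
    (fun n a => by
      refine (desc_tm _ _ _ _).trans ?_
      change C.mul _ (α.app n (R.alg n a)) (β.app 0 S.one) = _
      rw [α.map_alg, β.map_one, C.mul_one])

lemma lift_tm (α : R ⟶ C) (β : S ⟶ C) {i j n : ℤ} (h : i + j = n) (r : R.carrier i)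
    (s : S.carrier j) : (lift α β).app n (tm h r s) = C.mul h (α.app i r) (β.app j s) :=
  desc_tm _ h r s

@[simp] lemma inL_lift (α : R ⟶ C) (β : S ⟶ C) : inL R S ≫ lift α β = α :=
  GrAlg.hom_ext fun n r => by rw [comp_app, inL_app, lift_tm, β.map_one, C.mul_one]

@[simp] lemma inR_lift (α : R ⟶ C) (β : S ⟶ C) : inR R S ≫ lift α β = β :=
  GrAlg.hom_ext fun n s => by rw [comp_app, inR_app, lift_tm, α.map_one, C.one_mul]

/-- The unit map of an algebra. -/
def unit (A : GrAlg k) : GrAlg.base k ⟶ A :=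
  GrAlg.Hom.mk (A := GrAlg.base k) A.alg A.alg_one A.alg_mul (fun _ _ => rfl)

/-- The algebra map `k ⊕ Z → C` given by a linear map `Z → C` whose image squares to zero. -/
def sqZeroLift {Z : GrMod k} (ι : Z ⟶ C.toMod)
    (h : ∀ {i j n : ℤ} (h : i + j = n) (z : Z.carrier i) (z' : Z.carrier j),
      C.mul h (ι.app i z) (ι.app j z') = 0) : GrAlg.sqZero Z ⟶ C :=
  GrAlg.Hom.mk (A := GrAlg.sqZero Z)
    (fun n => (C.alg n).coprod (ι.app n))
    (by
      change C.alg 0 k.one + ι.app 0 0 = _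
      rw [map_zero, add_zero, C.alg_one])
    (fun {i j n} hij a b => by
      have e₁ : ι.app n (Z.rsmul hij a.2 b.1) = C.mul hij (ι.app i a.2) (C.alg j b.1) := by
        rw [GrMod.rsmul, map_zsmul_unit, ι.map_smul, C.mul_comm hij (by omega), mul_comm j i]
      have e₂ : ι.app n (Z.smul hij a.1 b.2) = C.mul hij (C.alg i a.1) (ι.app j b.2) :=
        ι.map_smul hij a.1 b.2
      change C.alg n (k.mul hij a.1 b.1) +
        ι.app n (Z.smul hij a.1 b.2 + Z.rsmul hij a.2 b.1 + 0) =
        C.mul hij (C.alg i a.1 + ι.app i a.2) (C.alg j b.1 + ι.app j b.2)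
      rw [add_zero, map_add, C.alg_mul hij, e₁, e₂, C.mul_add, C.add_mul, C.add_mul, h hij, add_zero]
      abel)
    (fun n a => by
      change C.alg n a + ι.app n 0 = _
      rw [map_zero, add_zero])

end GrAlg

end algTensorMaps

/-! ### Square-zero extensions as pullbacks; formality of the indecomposables. -/

section indecomposables

variable {k l : GrRing.{u}}

namespace GrAlg

/-- The inclusion `M → k ⊕ M`. -/
def sqZeroIn (M : GrMod k) : M ⟶ (GrAlg.sqZero M).toMod :=
  GrMod.Hom.mk (N := (GrAlg.sqZero M).toMod) (fun n => AddMonoidHom.inr (k.carrier n) (M.carrier n))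
    (fun {i j n} h a x => by
      refine Prod.ext (GrRing.mul_zero k h a).symm ?_
      change M.smul h a x = M.smul h a x + M.rsmul h 0 0 + 0
      simp)

lemma sqZeroIn_mul {M : GrMod k} {i j n : ℤ} (h : i + j = n) (x : M.carrier i) (y : M.carrier j) :
    (GrAlg.sqZero M).mul h ((sqZeroIn M).app i x) ((sqZeroIn M).app j y) = 0 := by
  refine Prod.ext (GrRing.mul_zero k h 0) ?_
  change M.smul h 0 y + M.rsmul h x 0 + 0 = 0
  simp

lemma sqZero_eq {M : GrMod k} {n : ℤ} (a : (GrAlg.sqZero M).carrier n) :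
    a = (GrAlg.sqZero M).alg n a.1 + (sqZeroIn M).app n a.2 :=
  Prod.ext (add_zero _).symm (zero_add _).symm

lemma sqZero_hom_ext {M : GrMod k} {A : GrAlg k} {f g : GrAlg.sqZero M ⟶ A}
    (h : ∀ n x, f.app n ((sqZeroIn M).app n x) = g.app n ((sqZeroIn M).app n x)) : f = g :=
  GrAlg.hom_ext fun n a => by
    rw [sqZero_eq a, map_add, map_add, h, f.map_alg, g.map_alg]

@[simp] lemma sqZeroLift_in {Z : GrMod k} {C : GrAlg k} (ι : Z ⟶ C.toMod) (h) (n : ℤ)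
    (z : Z.carrier n) : (sqZeroLift (C := C) ι h).app n ((sqZeroIn Z).app n z) = ι.app n z := by
  change C.alg n 0 + ι.app n z = _
  rw [map_zero, zero_add]

@[simp] lemma sqZeroMap_in {M N : GrMod k} (f : M ⟶ N) (n : ℤ) (x : M.carrier n) :
    (sqZeroMap f).app n ((sqZeroIn M).app n x) = (sqZeroIn N).app n (f.app n x) := rfl

@[simp] lemma sqZeroAug_in {M : GrMod k} (n : ℤ) (x : M.carrier n) :
    (sqZeroAug M).app n ((sqZeroIn M).app n x) = 0 := rfl

/-- Algebra maps to `k ⊕ Z` are determined by maps to `C` and `k` if `Z → C` is injective. -/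
lemma exists_sqZero_lift {Z : GrMod k} {C P : GrAlg k} (γ : GrAlg.sqZero Z ⟶ C)
    (hγ : ∀ n x y, γ.app n ((sqZeroIn Z).app n x) = γ.app n ((sqZeroIn Z).app n y) → x = y)
    (g : P ⟶ C) (g' : P ⟶ GrAlg.base k)
    (h : ∀ n a, ∃ z, γ.app n ((sqZeroIn Z).app n z) = g.app n a - C.alg n (g'.app n a)) :
    ∃ q : P ⟶ GrAlg.sqZero Z, q ≫ γ = g ∧ q ≫ sqZeroAug Z = g' := by
  choose z hz using h
  -- An element of `k ⊕ Z` is determined by its scalar part and its image in `C`. Hence all axioms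
  -- for the lift `q` can be checked in `k` and in `C`.
  have hu : ∀ n (a b : (GrAlg.sqZero Z).carrier n), a.1 = b.1 → γ.app n a = γ.app n b → a = b := by
    intro n a b h₁ h₂
    rw [sqZero_eq a, sqZero_eq b, map_add, map_add, γ.map_alg, γ.map_alg, h₁] at h₂
    exact Prod.ext h₁ (hγ n _ _ (add_left_cancel h₂))
  let q (n : ℤ) (a : P.carrier n) : (GrAlg.sqZero Z).carrier n := (g'.app n a, z n a)
  have hq : ∀ n a, γ.app n (q n a) = g.app n a := fun n a => by
    rw [sqZero_eq (q n a), map_add, γ.map_alg, hz]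
    exact add_sub_cancel _ _
  refine ⟨GrAlg.Hom.mk (fun n => AddMonoidHom.mk' (q n) fun a b => ?_) ?_ ?_ ?_, ?_, ?_⟩
  · exact hu n _ _ (map_add _ _ _) (by rw [hq, map_add, map_add, hq, hq])
  · exact hu 0 _ _ g'.map_one (by
      rw [AddMonoidHom.mk'_apply, hq, g.map_one]; exact γ.map_one.symm)
  · intro i j n hij a b
    exact hu n _ _ (g'.map_mul hij a b) (by
      rw [AddMonoidHom.mk'_apply, hq, g.map_mul hij, γ.map_mul hij]
      exact (congrArg₂ (C.mul hij) (hq i a) (hq j b)).symm)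
  · intro n a
    exact hu n _ _ (g'.map_alg n a) (by
      rw [AddMonoidHom.mk'_apply, hq, g.map_alg, γ.map_alg])
  · exact GrAlg.hom_ext fun n a => hq n a
  · exact GrAlg.hom_ext fun n a => rfl

end GrAlg

open GrAlg

lemma map_unit_zero (H : GrAlg k ⥤ GrMod l) {M : GrMod k} {n : ℤ}
    (x : ((indec H).obj M).carrier n) (R : GrAlg k) :
    (H.map (sqZeroAug M ≫ unit R)).app n x.1 = 0 := by
  rw [← map_comp_app, show (H.map (sqZeroAug M)).app n x.1 = 0 from x.2, map_zero]

/-- An element of `𝒬(H)(Z)` is determined by its image under an algebra map that is injective on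
`Z`. -/
lemma IsFormal.indec_injective {H : GrAlg k ⥤ GrMod l} (hH : IsFormal H) {Z : GrMod k} {C : GrAlg k}
    (γ : GrAlg.sqZero Z ⟶ C)
    (hγ : ∀ n x y, γ.app n ((sqZeroIn Z).app n x) = γ.app n ((sqZeroIn Z).app n y) → x = y)
    {n : ℤ} {q q' : ((indec H).obj Z).carrier n}
    (h : (H.map γ).app n q.1 = (H.map γ).app n q'.1) : q = q' := by
  refine Subtype.ext (hH.joint_injective γ (sqZeroAug Z) (fun g g' h₁ h₂ => ?_) h
    (q.2.trans q'.2.symm))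
  refine GrAlg.hom_ext fun n b => ?_
  have e₁ := congrArg (fun t => GrAlg.Hom.app t n b) h₁
  have e₂ : (g.app n b).1 = (g'.app n b).1 := congrArg (fun t => GrAlg.Hom.app t n b) h₂
  simp only [comp_app] at e₁
  rw [sqZero_eq (g.app n b), sqZero_eq (g'.app n b), map_add, map_add, γ.map_alg, γ.map_alg,
    e₂] at e₁
  exact Prod.ext e₂ (hγ n _ _ (add_left_cancel e₁))

/-- If `Z` is the kernel of `ε : C → R`, an element of `H(C)` that vanishes in `H(R)` comes from
`𝒬(H)(Z)`. -/
lemma IsFormal.exists_indec {H : GrAlg k ⥤ GrMod l} (hH : IsFormal H) {Z : GrMod k} {C R : GrAlg k}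
    (γ : GrAlg.sqZero Z ⟶ C)
    (hγ : ∀ n x y, γ.app n ((sqZeroIn Z).app n x) = γ.app n ((sqZeroIn Z).app n y) → x = y)
    (ε : C ⟶ R)
    (hε : ∀ n c, ε.app n c = 0 → ∃ z, γ.app n ((sqZeroIn Z).app n z) = c) {n : ℤ}
    (t : (H.obj C).carrier n) (ht : (H.map ε).app n t = 0) :
    ∃ q : ((indec H).obj Z).carrier n, (H.map γ).app n q.1 = t := by
  -- The pullback of `C → R ← k` is `k ⊕ Z`. Presenting `t ∈ H(C)` and `0 ∈ H(k)` by one algebra,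
  -- and equalizing over `R`, produces a map into this pullback. Its component in `k` carries the
  -- element to `0`, which is membership in `𝒬(H)(Z)`.
  obtain ⟨A, z, g, g', rfl, h'⟩ := hH.common t (0 : (H.obj (GrAlg.base k)).carrier n)
  obtain ⟨P, z', p, rfl, e⟩ := hH.equalize (g ≫ ε) (g' ≫ unit R) z (by
    rw [← map_comp_app, ht, ← map_comp_app, h', map_zero])
  obtain ⟨q, hq, hq'⟩ := exists_sqZero_lift γ hγ (p ≫ g) (p ≫ g') (fun n a => by
    refine hε n _ ?_
    have e' := congrArg (fun t => GrAlg.Hom.app t n a) e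
    simp only [comp_app] at e' ⊢
    rw [map_sub, e', ε.map_alg]
    exact sub_self _)
  refine ⟨⟨(H.map q).app n z', ?_⟩, ?_⟩
  · rw [AddMonoidHom.mem_ker, map_comp_app, hq', ← map_comp_app, h']
  · change (H.map γ).app n ((H.map q).app n z') = _
    rw [map_comp_app, map_comp_app, hq]

/-- The indecomposables of a formal module scheme are a formal bimodule. -/
lemma IsFormal.formal_indec {H : GrAlg k ⥤ GrMod l} (hH : IsFormal H) : IsFormal (indec H) := by
  have : Nonempty (GrMod k) := ⟨(GrAlg.base k).toMod⟩
  have hinj : ∀ {M N : GrMod k} (f : M ⟶ N), (∀ n, Function.Injective (f.app n)) → ∀ n x y,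
      (sqZeroMap f).app n ((sqZeroIn M).app n x) = (sqZeroMap f).app n ((sqZeroIn M).app n y) →
      x = y := fun f hf n x y h => hf n (congrArg Prod.snd h)
  refine isFormal_of_lifts ?_ ?_ ?_
  · intro q M N x y
    have hz : ∀ {A B C : GrMod k} (f : A ⟶ B) (g : B ⟶ C), (∀ n x, (f ≫ g).app n x = 0) →
        ∀ x : ((indec H).obj A).carrier q, ((indec H).map g).app q
          (((indec H).map f).app q x) = 0 := fun {A B C} f g h x => by
      rw [map_comp_app]
      refine Subtype.ext ?_
      refine Eq.trans ?_ (map_unit_zero H x (GrAlg.sqZero C))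
      refine congrArg (fun t => GrMod.Hom.app (H.map t) q x.1) ?_
      refine sqZero_hom_ext fun n a => ?_
      rw [sqZeroMap_in, h, comp_app, sqZeroAug_in, map_zero, map_zero]
    have hi : ∀ {A B : GrMod k} (f : A ⟶ B) (g : B ⟶ A), f ≫ g = 𝟙 A →
        ∀ x : ((indec H).obj A).carrier q, ((indec H).map g).app q
          (((indec H).map f).app q x) = x := fun {A B} f g h x => by
      rw [map_comp_app, h]
      exact map_id_app _ _ q x
    refine ⟨M.prod N, ((indec H).map (GrMod.inl M N)).app q x +
      ((indec H).map (GrMod.inr M N)).app q y, GrMod.fst M N, GrMod.snd M N, ?_, ?_⟩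
    · rw [map_add, hi _ _ rfl, hz _ _ (fun _ _ => rfl), add_zero]
    · rw [map_add, hi _ _ rfl, hz _ _ (fun _ _ => rfl), zero_add]
  · intro q M N f g x hx
    -- The equalizer of the two maps of square-zero extensions is `k ⊕ ker (f - g)`, so `p` factors
    -- through it.
    obtain ⟨P, z, p, hz, hp⟩ := hH.equalize (sqZeroMap f) (sqZeroMap g) x.1
      (congrArg Subtype.val hx)
    obtain ⟨p', hp₁, hp₂⟩ := exists_sqZero_lift (sqZeroMap (GrMod.kerι (GrMod.subHom f g)))
      (hinj _ (GrMod.kerι_injective _)) p (p ≫ sqZeroAug M) (fun n a => by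
        have e := congrArg Prod.snd (congrArg (fun t => GrAlg.Hom.app t n a) hp)
        exact ⟨⟨(p.app n a).2, sub_eq_zero.2 e⟩, Prod.ext (sub_self _).symm (sub_zero _).symm⟩)
    refine ⟨GrMod.ker (GrMod.subHom f g), ⟨(H.map p').app q z, ?_⟩, GrMod.kerι _, ?_, ?_⟩
    · rw [AddMonoidHom.mem_ker, map_comp_app, hp₂, ← map_comp_app, hz]
      exact x.2
    · refine Subtype.ext (Eq.trans ?_ hz)
      change (H.map _).app q ((H.map p').app q z) = _
      rw [map_comp_app, hp₁]
    · exact GrMod.hom_ext fun n x => sub_eq_zero.1 x.2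
  · intro q
    obtain ⟨I, _, _, A, e, he⟩ := hH.exists_isProRep q
    -- An algebra map `A i → k ⊕ M` factors through `k ⊕ M'`, where `M'` is the image of its
    -- component `A i → M`, a quotient of the module underlying `A i`.
    refine ⟨Σ (i : I), (A.obj i).toMod.Sub, fun c => GrMod.quot _ c.2, fun M x => ?_⟩
    obtain ⟨i, g, hg⟩ := he.surj (M := GrAlg.sqZero M) x.1
    change (H.map g).app q (e i) = x.1 at hg
    let v : (A.obj i).toMod ⟶ M := lin g ≫ sqZeroSnd M
    obtain ⟨g', hg₁, hg₂⟩ := exists_sqZero_lift (sqZeroMap (GrMod.coimι v))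
      (hinj _ (GrMod.coimι_injective _)) g (g ≫ sqZeroAug M) (fun n a =>
        ⟨(GrMod.quotπ _).app n a, Prod.ext (sub_self _).symm (sub_zero _).symm⟩)
    refine ⟨⟨i, GrMod.kerSub v⟩, ⟨(H.map g').app q (e i), ?_⟩, GrMod.coimι v, ?_⟩
    · rw [AddMonoidHom.mem_ker, map_comp_app, hg₂, ← map_comp_app, hg]
      exact x.2
    · refine Subtype.ext (Eq.trans ?_ hg)
      change (H.map _).app q ((H.map g').app q (e i)) = _
      rw [map_comp_app, hg₁]

end indecomposables

/-! ### Pairings whose arguments may be algebras or modules. -/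

section mixedPairings

variable {k l : GrRing.{u}}

/-- A family of `l`-bilinear maps `B(X) × C(Y) → D(Z)`, indexed by the `k`-bilinear maps
`V(X) × U(Y) → Z` and natural in these. -/
structure MPair {I J : Type (u + 1)} [Category.{u} I] [Category.{u} J] (V : I ⥤ GrMod k)
    (U : J ⥤ GrMod k) (B : I ⥤ GrMod l) (C : J ⥤ GrMod l) (D : GrMod k ⥤ GrMod l) where
  bil : ∀ {X : I} {Y : J} {Z : GrMod k}, BilinMap (V.obj X) (U.obj Y) Z →
    BilinMap (B.obj X) (C.obj Y) (D.obj Z)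
  natural : ∀ {X X' : I} {Y Y' : J} {Z Z' : GrMod k} (f : BilinMap (V.obj X) (U.obj Y) Z)
    (f' : BilinMap (V.obj X') (U.obj Y') Z') (u : X ⟶ X') (v : Y ⟶ Y') (w : Z ⟶ Z'),
    f.post w = f'.pre (V.map u) (U.map v) →
    ∀ {i j n : ℤ} (h : i + j = n) (x : (B.obj X).carrier i) (y : (C.obj Y).carrier j),
      (D.map w).app n ((bil f).app h x y) =
        (bil f').app h ((B.map u).app i x) ((C.map v).app j y)

namespace MPair

variable {I J : Type (u + 1)} [Category.{u} I] [Category.{u} J] {V : I ⥤ GrMod k}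
  {U : J ⥤ GrMod k} {B : I ⥤ GrMod l} {C : J ⥤ GrMod l} {D D' : GrMod k ⥤ GrMod l}

lemma map_bil (p : MPair V U B C D) {X : I} {Y : J} {Z Z' : GrMod k}
    (f : BilinMap (V.obj X) (U.obj Y) Z) (w : Z ⟶ Z') {i j n : ℤ} (h : i + j = n)
    (x : (B.obj X).carrier i) (y : (C.obj Y).carrier j) :
    (D.map w).app n ((p.bil f).app h x y) = (p.bil (f.post w)).app h x y := by
  have := p.natural f (f.post w) (𝟙 X) (𝟙 Y) w (by rw [V.map_id, U.map_id]; rfl) h x y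
  rwa [B.map_id, C.map_id] at this

lemma bil_pre (p : MPair V U B C D) {X X' : I} {Y Y' : J} {Z : GrMod k}
    (f : BilinMap (V.obj X') (U.obj Y') Z) (u : X ⟶ X') (v : Y ⟶ Y') {i j n : ℤ} (h : i + j = n)
    (x : (B.obj X).carrier i) (y : (C.obj Y).carrier j) :
    (p.bil (f.pre (V.map u) (U.map v))).app h x y =
      (p.bil f).app h ((B.map u).app i x) ((C.map v).app j y) := by
  have := p.natural (f.pre (V.map u) (U.map v)) f u v (𝟙 Z) rfl h x y
  rwa [D.map_id] at this

/-- The symmetric pairing, with the Koszul sign. -/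
def flip (p : MPair V U B C D) : MPair U V C B D where
  bil f := (p.bil f.flip).flip
  natural {X X' Y Y' Z Z'} f f' u v w e {i j n} h x y := by
    have e' : f.flip.post w = f'.flip.pre (V.map v) (U.map u) := by
      rw [← BilinMap.flip_post, e, BilinMap.flip_pre]
    rw [BilinMap.flip_app _ _ ((add_comm j i).trans h), map_zsmul_unit, p.natural _ _ v u w e']
    rfl

lemma flip_bil (p : MPair V U B C D) {X : I} {Y : J} {Z : GrMod k}
    (f : BilinMap (U.obj Y) (V.obj X) Z) : p.flip.bil f = (p.bil f.flip).flip := rfl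

lemma flip_flip_bil (p : MPair V U B C D) {X : I} {Y : J} {Z : GrMod k}
    (f : BilinMap (V.obj X) (U.obj Y) Z) : p.flip.flip.bil f = p.bil f := by
  rw [flip_bil, flip_bil, BilinMap.flip_flip, BilinMap.flip_flip]

end MPair

/-- A pairing of bimodules as a family of bilinear maps. -/
def Pairing.toMPair {B C D : GrMod k ⥤ GrMod l} (p : Pairing B C D) :
    MPair (𝟭 (GrMod k)) (𝟭 (GrMod k)) B C D where
  bil f := p.bil f
  natural f f' u v w e _ _ _ h x y :=
    congrArg (fun t => BilinMap.app t h x y) (p.natural f f' u v w e)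

/-- The pairing of bimodules given by a family of bilinear maps. -/
def MPair.toPairing {B C D : GrMod k ⥤ GrMod l}
    (p : MPair (𝟭 (GrMod k)) (𝟭 (GrMod k)) B C D) : Pairing B C D where
  bil f := p.bil f
  natural f f' u v w e := by
    ext i j n h x y
    exact p.natural f f' u v w e h x y

/-- The symmetric pairing, with the Koszul sign. -/
def Pairing.flip {B C D : GrMod k ⥤ GrMod l} (p : Pairing B C D) : Pairing C B D :=
  p.toMPair.flip.toPairing

lemma Pairing.ext_app {B C D : GrMod k ⥤ GrMod l} {p q : Pairing B C D}
    (e : ∀ {X Y Z : GrMod k} (f : BilinMap X Y Z) {i j n : ℤ} (h : i + j = n)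
      (x : (B.obj X).carrier i) (y : (C.obj Y).carrier j),
      (p.bil f).app h x y = (q.bil f).app h x y) : p = q := by
  ext X Y Z f i j n h x y
  exact e f h x y

/-- The symmetric bilinear map, with the Koszul sign. -/
def SchBilin.flip {F G H : GrAlg k ⥤ GrMod l} (b : SchBilin F G H) : SchBilin G F H where
  bil R := (b.bil R).flip
  natural {R S} g {i j n} h x y := by
    rw [BilinMap.flip_app _ _ ((add_comm j i).trans h), map_zsmul_unit, b.natural]
    rfl

end mixedPairings

/-! ### The pairing `F(R) × 𝒬(G)(Y) → 𝒬(H)(R ⊗ Y)`. -/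

section mixedIndec

variable {k l : GrRing.{u}} {F G H : GrAlg k ⥤ GrMod l}

open GrAlg

/-- The map `R ⊗ Y → R ⊗ (k ⊕ Y)`. -/
def tensorIn (R : GrAlg k) (Y : GrMod k) : R.toMod.tensor Y ⟶ (R.tensor (sqZero Y)).toMod :=
  GrMod.tensorLift ((tmBil R (sqZero Y)).pre (𝟙 R.toMod) (sqZeroIn Y))

lemma tensorIn_tmul (R : GrAlg k) (Y : GrMod k) {i j n : ℤ} (h : i + j = n) (r : R.carrier i)
    (y : Y.carrier j) : (tensorIn R Y).app n (GrMod.tmul (X := R.toMod) h r y) =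
      tm h r ((sqZeroIn Y).app j y) :=
  (GrMod.tensorLift_tmul _ _ _ _).trans (tmBil_app h r _)

lemma tensorIn_mul (R : GrAlg k) (Y : GrMod k) {i j n : ℤ} (h : i + j = n)
    (z : (R.toMod.tensor Y).carrier i) (z' : (R.toMod.tensor Y).carrier j) :
    (R.tensor (sqZero Y)).mul h ((tensorIn R Y).app i z) ((tensorIn R Y).app j z') = 0 := by
  induction z using GrMod.tensor_induction with
  | tmul h₁ r y =>
    induction z' using GrMod.tensor_induction with
    | tmul h₂ r' y' =>
      rw [tensorIn_tmul, tensorIn_tmul, tm_mul_tm h h₁ h₂ rfl rfl (by omega), sqZeroIn_mul,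
        tm_zero, smul_zero]
    | add t t' ht ht' => rw [map_add, GrRing.mul_add, ht, ht', add_zero]
  | add t t' ht ht' => rw [map_add, GrRing.add_mul, ht, ht', add_zero]

/-- The map `k ⊕ R ⊗ Y → R ⊗ (k ⊕ Y)`. -/
def sqZeroTensor (R : GrAlg k) (Y : GrMod k) :
    sqZero (R.toMod.tensor Y) ⟶ R.tensor (sqZero Y) :=
  sqZeroLift (tensorIn R Y) (tensorIn_mul R Y)

lemma sqZeroTensor_in (R : GrAlg k) (Y : GrMod k) (n : ℤ) (z : (R.toMod.tensor Y).carrier n) :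
    (sqZeroTensor R Y).app n ((sqZeroIn _).app n z) = (tensorIn R Y).app n z :=
  sqZeroLift_in _ _ _ _

/-- The projection `R ⊗ (k ⊕ Y) → R ⊗ Y`. -/
def tensorSnd (R : GrAlg k) (Y : GrMod k) : (R.tensor (sqZero Y)).toMod ⟶ R.toMod.tensor Y :=
  desc ((GrMod.tmulBil R.toMod Y).pre (𝟙 R.toMod) (sqZeroSnd Y))

lemma tensorIn_tensorSnd (R : GrAlg k) (Y : GrMod k) (n : ℤ) (z : (R.toMod.tensor Y).carrier n) :
    (tensorSnd R Y).app n ((tensorIn R Y).app n z) = z := by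
  induction z using GrMod.tensor_induction with
  | tmul h r y =>
    rw [tensorIn_tmul]
    exact desc_tm _ h r _
  | add t t' ht ht' => rw [map_add, map_add, ht, ht']

lemma sqZeroTensor_injective (R : GrAlg k) (Y : GrMod k) (n : ℤ)
    (x y : (R.toMod.tensor Y).carrier n)
    (h : (sqZeroTensor R Y).app n ((sqZeroIn _).app n x) =
      (sqZeroTensor R Y).app n ((sqZeroIn _).app n y)) : x = y := by
  rw [sqZeroTensor_in, sqZeroTensor_in] at h
  rw [← tensorIn_tensorSnd R Y n x, h, tensorIn_tensorSnd]

/-- The augmentation `R ⊗ (k ⊕ Y) → R`. -/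
def tensorAug (R : GrAlg k) (Y : GrMod k) : R.tensor (sqZero Y) ⟶ R :=
  lift (𝟙 R) (sqZeroAug Y ≫ unit R)

/-- On a pure tensor, the scalar part of the second factor moves across to `R`. The resulting
splitting identifies the kernel of `tensorAug` with `R ⊗ Y`. -/
lemma tensor_sqZero_eq (R : GrAlg k) (Y : GrMod k) (n : ℤ) (c : (R.tensor (sqZero Y)).carrier n) :
    c = (inL R (sqZero Y)).app n ((tensorAug R Y).app n c) +
      (tensorIn R Y).app n ((tensorSnd R Y).app n c) := by
  induction c using tm_induction with
  | @tm i j h r y =>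
    rw [show (tensorSnd R Y).app n (tm h r y) = GrMod.tmul (X := R.toMod) h r y.2 from desc_tm _ h r y,
      tensorIn_tmul, tensorAug, lift_tm, inL_app]
    have e : tm (S := sqZero Y) h r ((sqZero Y).alg j y.1) =
        tm (add_zero n) (R.mul h r (R.alg j y.1)) (sqZero Y).one := by
      have := GrMod.rsmul_tmul (X := R.toMod) (Y := (sqZero Y).toMod) h (add_zero n) (add_zero j) h
        r y.1 (sqZero Y).one
      have e₁ : R.toMod.rsmul h r y.1 = R.mul h r (R.alg j y.1) := by
        rw [R.mul_comm h ((add_comm j i).trans h), _root_.mul_comm i j]; rfl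
      have e₂ : (sqZero Y).toMod.smul (add_zero j) y.1 (sqZero Y).one = (sqZero Y).alg j y.1 :=
        GrAlg.mul_one (sqZero Y) _ _
      rw [e₁, e₂] at this
      exact this.symm
    calc tm h r y = tm h r ((sqZero Y).alg j y.1 + (sqZeroIn Y).app j y.2) := by rw [← sqZero_eq]
      _ = _ := by rw [tm_add, e]; rfl
  | add t t' ht ht' =>
    rw [map_add, map_add, map_add, map_add, add_add_add_comm, ← ht, ← ht']

/-- Under the augmentation to `R` the element `y` becomes zero, and by bilinearity so does the
product. It therefore comes from the kernel `R ⊗ Y`. -/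
lemma exists_hpUniv (hH : IsFormal H) (b : SchBilin F G H) {R : GrAlg k} {Y : GrMod k} {i j n : ℤ}
    (h : i + j = n) (x : (F.obj R).carrier i) (y : ((indec G).obj Y).carrier j) :
    ∃ q : ((indec H).obj (R.toMod.tensor Y)).carrier n, (H.map (sqZeroTensor R Y)).app n q.1 =
      (b.bil _).app h ((F.map (inL R (sqZero Y))).app i x)
        ((G.map (inR R (sqZero Y))).app j y.1) := by
  refine hH.exists_indec _ (sqZeroTensor_injective R Y) (tensorAug R Y) (fun n c hc => ?_) _ ?_
  · refine ⟨(tensorSnd R Y).app n c, ?_⟩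
    have := tensor_sqZero_eq R Y n c
    rw [hc, map_zero, zero_add] at this
    rw [sqZeroTensor_in]
    exact this.symm
  · rw [b.natural, map_comp_app, map_comp_app, tensorAug, inR_lift, map_unit_zero,
      BilinMap.zero_right]

/-- The element of `𝒬(H)(R ⊗ Y)` given by `x ∈ F(R)` and `y ∈ 𝒬(G)(Y)`. -/
noncomputable def hpUniv (hH : IsFormal H) (b : SchBilin F G H) {R : GrAlg k} {Y : GrMod k}
    {i j n : ℤ} (h : i + j = n) (x : (F.obj R).carrier i) (y : ((indec G).obj Y).carrier j) :
    ((indec H).obj (R.toMod.tensor Y)).carrier n :=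
  (exists_hpUniv hH b h x y).choose

lemma hpUniv_spec (hH : IsFormal H) (b : SchBilin F G H) {R : GrAlg k} {Y : GrMod k} {i j n : ℤ}
    (h : i + j = n) (x : (F.obj R).carrier i) (y : ((indec G).obj Y).carrier j) :
    (H.map (sqZeroTensor R Y)).app n (hpUniv hH b h x y).1 =
      (b.bil _).app h ((F.map (inL R (sqZero Y))).app i x)
        ((G.map (inR R (sqZero Y))).app j y.1) :=
  (exists_hpUniv hH b h x y).choose_spec

/-- The condition on `γ` says that it factors through `R ⊗ (k ⊕ Y)` via `lift α β`. So the
characterization over the universal algebra can be used over any algebra `C`. -/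
lemma hpUniv_map (hH : IsFormal H) (b : SchBilin F G H) {R C : GrAlg k} {Y : GrMod k}
    (α : R ⟶ C) (β : sqZero Y ⟶ C) (γ : sqZero (R.toMod.tensor Y) ⟶ C)
    (hγ : ∀ {i j n : ℤ} (h : i + j = n) (r : R.carrier i) (y : Y.carrier j),
      γ.app n ((sqZeroIn _).app n (GrMod.tmul (X := R.toMod) h r y)) =
        C.mul h (α.app i r) (β.app j ((sqZeroIn Y).app j y)))
    {i j n : ℤ} (h : i + j = n) (x : (F.obj R).carrier i) (y : ((indec G).obj Y).carrier j) :
    (H.map γ).app n (hpUniv hH b h x y).1 =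
      (b.bil C).app h ((F.map α).app i x) ((G.map β).app j y.1) := by
  have e : γ = sqZeroTensor R Y ≫ lift α β := by
    refine sqZero_hom_ext fun n z => ?_
    induction z using GrMod.tensor_induction with
    | tmul h r y =>
      rw [hγ, comp_app, sqZeroTensor_in, tensorIn_tmul, lift_tm]
    | add t t' ht ht' => rw [map_add, map_add, map_add, ht, ht']
  rw [e, ← map_comp_app, hpUniv_spec, b.natural, map_comp_app, map_comp_app, inL_lift, inR_lift]

lemma hpUniv_tensorHom (hH : IsFormal H) (b : SchBilin F G H) {R R' : GrAlg k} {Y Y' : GrMod k}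
    (u : R ⟶ R') (v : Y ⟶ Y') {i j n : ℤ} (h : i + j = n) (x : (F.obj R).carrier i)
    (y : ((indec G).obj Y).carrier j) :
    ((indec H).map (GrMod.tensorHom (lin u) v)).app n (hpUniv hH b h x y) =
      hpUniv hH b h ((F.map u).app i x) (((indec G).map v).app j y) := by
  refine hH.indec_injective _ (sqZeroTensor_injective R' Y') ?_
  rw [hpUniv_spec]
  refine (map_comp_app H _ _ n _).trans ((hpUniv_map hH b (u ≫ inL _ _) (sqZeroMap v ≫ inR _ _) _
    (fun {i j n} h r y => ?_) h x y).trans ?_)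
  · rw [comp_app, sqZeroMap_in, sqZeroTensor_in, comp_app, comp_app, sqZeroMap_in, inL_mul_inR,
      ← tensorIn_tmul]
    exact congrArg ((tensorIn R' Y').app n) (GrMod.tensorHom_tmul _ _ _ _ _)
  · rw [← map_comp_app, ← map_comp_app]
    rfl

/-- The bilinear map `F(R) × 𝒬(G)(Y) → 𝒬(H)(R ⊗ Y)` given by a bilinear map `F × G → H`. -/
noncomputable def hpBil (hH : IsFormal H) (b : SchBilin F G H) (R : GrAlg k) (Y : GrMod k) :
    BilinMap (F.obj R) ((indec G).obj Y) ((indec H).obj (R.toMod.tensor Y)) where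
  app h x y := hpUniv hH b h x y
  add_left h x x' y := by
    refine hH.indec_injective _ (sqZeroTensor_injective R Y) ?_
    refine (hpUniv_spec hH b h _ y).trans (Eq.trans ?_ (map_add _ _ _).symm)
    rw [hpUniv_spec, hpUniv_spec, map_add, BilinMap.add_left]
  add_right h x y y' := by
    refine hH.indec_injective _ (sqZeroTensor_injective R Y) ?_
    refine (hpUniv_spec hH b h x _).trans (Eq.trans ?_ (map_add _ _ _).symm)
    rw [hpUniv_spec, hpUniv_spec, ← BilinMap.add_right, ← map_add]
    rfl
  smul_left h₁ h₂ h₃ h₄ a x y := by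
    refine hH.indec_injective _ (sqZeroTensor_injective R Y) ?_
    refine (hpUniv_spec hH b h₂ _ y).trans (Eq.trans ?_ (GrMod.Hom.map_smul _ _ _ _).symm)
    rw [hpUniv_spec, GrMod.Hom.map_smul, BilinMap.smul_left _ h₁ h₂ h₃ h₄]
  smul_right h₁ h₂ h₃ h₄ a x y := by
    refine hH.indec_injective _ (sqZeroTensor_injective R Y) ?_
    refine (hpUniv_spec hH b h₂ x _).trans (Eq.trans ?_ (map_zsmul_unit _ _ _).symm)
    refine Eq.trans ?_ (congrArg _ (GrMod.Hom.map_smul _ h₄ _ _).symm)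
    rw [hpUniv_spec, ← BilinMap.smul_right _ h₁ h₂, ← GrMod.Hom.map_smul]
    rfl

/-- The family of maps `F(R) × 𝒬(G)(Y) → 𝒬(H)(Z)` given by a bilinear map `F × G → H`. -/
noncomputable def indecPair (hH : IsFormal H) (b : SchBilin F G H) :
    MPair (GrAlg.forget k) (𝟭 (GrMod k)) F (indec G) (indec H) where
  bil {R Y _} f := (hpBil hH b R Y).post ((indec H).map (GrMod.tensorLift (X := R.toMod) f))
  natural {R R' Y Y' Z Z'} f f' u v w e {i j n} h x y := by
    refine (map_comp_app (indec H) _ w n _).trans (Eq.trans ?_ ((map_comp_app (indec H) _ _ n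
      _).symm.trans (congrArg (((indec H).map (GrMod.tensorLift (X := R'.toMod) (Y := Y') f')).app n)
        (hpUniv_tensorHom hH b u v h x y))))
    refine congrArg (fun t => GrMod.Hom.app ((indec H).map t) n (hpUniv hH b h x y))
      (GrMod.tensor_hom_ext (X := R.toMod) (Y := Y) fun {i j n} h r y => ?_)
    rw [GrMod.comp_app, GrMod.comp_app, GrMod.tensorHom_tmul]
    refine (congrArg (w.app n) (GrMod.tensorLift_tmul (X := R.toMod) (Y := Y) f h r y)).trans ?_
    exact (congrArg (fun t => BilinMap.app t h r y) e).trans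
      (GrMod.tensorLift_tmul f' h _ _).symm

/-- The characterization of `indecPair`. -/
lemma indecPair_map (hH : IsFormal H) (b : SchBilin F G H) {R C : GrAlg k} {Y Z : GrMod k}
    (f : BilinMap R.toMod Y Z) (α : R ⟶ C) (β : sqZero Y ⟶ C) (γ : sqZero Z ⟶ C)
    (hγ : ∀ {i j n : ℤ} (h : i + j = n) (r : R.carrier i) (y : Y.carrier j),
      γ.app n ((sqZeroIn Z).app n (f.app h r y)) =
        C.mul h (α.app i r) (β.app j ((sqZeroIn Y).app j y)))
    {i j n : ℤ} (h : i + j = n) (x : (F.obj R).carrier i) (y : ((indec G).obj Y).carrier j) :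
    (H.map γ).app n (((indecPair hH b).bil f).app h x y).1 =
      (b.bil C).app h ((F.map α).app i x) ((G.map β).app j y.1) := by
  refine (map_comp_app H _ _ n _).trans (hpUniv_map hH b α β _ (fun {i j n} h r y => ?_) h x y)
  rw [← hγ h r y, comp_app, sqZeroMap_in, GrMod.tensorLift_tmul]

/-- `indecPair` is natural in the bilinear map. -/
lemma indecPair_post {H' : GrAlg k ⥤ GrMod l} (hH : IsFormal H) (hH' : IsFormal H')
    (b : SchBilin F G H) (σ : H ⟶ H') {R : GrAlg k} {Y Z : GrMod k} (f : BilinMap R.toMod Y Z)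
    {i j n : ℤ} (h : i + j = n) (x : (F.obj R).carrier i) (y : ((indec G).obj Y).carrier j) :
    ((indecMap σ).app Z).app n (((indecPair hH b).bil f).app h x y) =
      ((indecPair hH' (b.post σ)).bil f).app h x y := by
  refine (nat_app (indecMap σ) (GrMod.tensorLift f) n _).trans (congrArg _ ?_)
  refine hH'.indec_injective _ (sqZeroTensor_injective R Y) ?_
  refine Eq.trans ?_ (hpUniv_spec hH' (b.post σ) h x y).symm
  refine (nat_app σ (sqZeroTensor R Y) n _).symm.trans ?_
  exact congrArg ((σ.app _).app n) (hpUniv_spec hH b h x y)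

end mixedIndec

/-! ### The lax structure: existence, uniqueness and symmetry. -/

section lax

variable {k l : GrRing.{u}} {F G H : GrAlg k ⥤ GrMod l}

open GrAlg

/-- The inclusion `𝒬(F)(X) → F(k ⊕ X)`. -/
def indecIncl (F : GrAlg k ⥤ GrMod l) (X : GrMod k) : (indec F).obj X ⟶ F.obj (sqZero X) :=
  GrMod.Hom.mk (M := (indec F).obj X)
    (fun n => ((F.map (sqZeroAug X)).app n).ker.subtype) (fun _ _ _ => rfl)

/-- The pairing `𝒬(F) × 𝒬(G) → 𝒬(H)` given by a bilinear map `F × G → H`. -/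
noncomputable def laxPairing (hH : IsFormal H) (b : SchBilin F G H) :
    Pairing (indec F) (indec G) (indec H) where
  bil {X Y Z} f := ((indecPair hH b).bil (X := sqZero X) (Y := Y)
    (f.pre (sqZeroSnd X) (𝟙 Y))).pre (indecIncl F X) (𝟙 _)
  natural {X Y Z X' Y' Z'} f f' u v w e := by
    ext i j n h x y
    refine (indecPair hH b).natural _ _ (sqZeroMap u) v w ?_ h x.1 y
    exact congrArg (fun t => BilinMap.pre t (sqZeroSnd X) (𝟙 Y)) e

/-- The bilinear map with components `f` and `g`. -/
def BilinMap.pair {X Y Z W : GrMod k} (f : BilinMap X Y Z) (g : BilinMap X Y W) :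
    BilinMap X Y (Z.prod W) where
  app h x y := (f.app h x y, g.app h x y)
  add_left h x x' y := Prod.ext (f.add_left h x x' y) (g.add_left h x x' y)
  add_right h x y y' := Prod.ext (f.add_right h x y y') (g.add_right h x y y')
  smul_left h₁ h₂ h₃ h₄ a x y :=
    Prod.ext (f.smul_left h₁ h₂ h₃ h₄ a x y) (g.smul_left h₁ h₂ h₃ h₄ a x y)
  smul_right h₁ h₂ h₃ h₄ a x y :=
    Prod.ext (f.smul_right h₁ h₂ h₃ h₄ a x y) (g.smul_right h₁ h₂ h₃ h₄ a x y)

/-- `indecPair_map` does not apply to the projection `k ⊕ X → X` directly, since in `C` the scalar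
part of `k ⊕ X` acts on `Y` as well. The remedy is to pair into `Y ⊕ Z`, where the component in `Y`
records this scalar action, and then to see that this component vanishes. Condition `h₀` makes the
image of `Y ⊕ Z` in `C` square to zero. -/
lemma laxPairing_map (hH : IsFormal H) (b : SchBilin F G H) {X Y Z : GrMod k} {C : GrAlg k}
    (f : BilinMap X Y Z) (α : sqZero X ⟶ C) (β : sqZero Y ⟶ C) (γ : sqZero Z ⟶ C)
    (hγ : ∀ {i j n : ℤ} (h : i + j = n) (x : X.carrier i) (y : Y.carrier j),
      γ.app n ((sqZeroIn Z).app n (f.app h x y)) =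
        C.mul h (α.app i ((sqZeroIn X).app i x)) (β.app j ((sqZeroIn Y).app j y)))
    (h₀ : ∀ {i j n : ℤ} (h : i + j = n) (y : Y.carrier i) (z : Z.carrier j),
      C.mul h (β.app i ((sqZeroIn Y).app i y)) (γ.app j ((sqZeroIn Z).app j z)) = 0)
    {i j n : ℤ} (h : i + j = n) (x : ((indec F).obj X).carrier i)
    (y : ((indec G).obj Y).carrier j) :
    (H.map γ).app n (((laxPairing hH b).bil f).app h x y).1 =
      (b.bil C).app h ((F.map α).app i x.1) ((G.map β).app j y.1) := by
  have hsq : ∀ {M : GrMod k} (δ : sqZero M ⟶ C) {i j n : ℤ} (h : i + j = n) (x : M.carrier i)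
      (y : M.carrier j), C.mul h (δ.app i ((sqZeroIn M).app i x))
        (δ.app j ((sqZeroIn M).app j y)) = 0 := fun δ _ _ _ h x y => by
    rw [← δ.map_mul, sqZeroIn_mul, map_zero]
  let δ : Y.prod Z ⟶ C.toMod := GrMod.copair (sqZeroIn Y ≫ lin β) (sqZeroIn Z ≫ lin γ)
  have hδ : ∀ n (v : (Y.prod Z).carrier n), δ.app n v =
      β.app n ((sqZeroIn Y).app n v.1) + γ.app n ((sqZeroIn Z).app n v.2) := fun _ _ => rfl
  let γ' : sqZero (Y.prod Z) ⟶ C := sqZeroLift δ (fun {i j n} h v w => by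
    rw [hδ, hδ, C.add_mul, C.mul_add, C.mul_add, hsq, hsq, h₀,
      C.mul_comm h ((add_comm j i).trans h), h₀, smul_zero, add_zero, add_zero])
  have hγ' : ∀ n v, γ'.app n ((sqZeroIn _).app n v) = δ.app n v := sqZeroLift_in δ _
  let g₁ : BilinMap (sqZero X).toMod Y Y := Y.smulBil.pre (lin (sqZeroAug X)) (𝟙 Y)
  let g₂ : BilinMap (sqZero X).toMod Y Z := f.pre (sqZeroSnd X) (𝟙 Y)
  have key := indecPair_map hH b (g₁.pair g₂) α β γ' (fun {i j n} h r y => by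
    rw [hγ', hδ]
    change β.app n ((sqZeroIn Y).app n (Y.smul h r.1 y)) +
      γ.app n ((sqZeroIn Z).app n (f.app h r.2 y)) = _
    have er : α.app i r = C.alg i r.1 + α.app i ((sqZeroIn X).app i r.2) := by
      rw [← α.map_alg i r.1, ← map_add, ← sqZero_eq]
    rw [hγ, er, C.add_mul]
    exact congrArg (· + _) ((sqZeroIn Y ≫ lin β).map_smul h r.1 y)) h x.1 y
  rw [← key]
  set q := ((indecPair hH b).bil (X := sqZero X) (Y := Y) (g₁.pair g₂)).app h x.1 y with hq
  have e := hH.formal_indec.map_hom_add (GrMod.fst Y Z ≫ GrMod.inl Y Z)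
    (GrMod.snd Y Z ≫ GrMod.inr Y Z) (𝟙 _) (fun n v => by
      exact Prod.ext (add_zero v.1).symm (zero_add v.2).symm) q
  rw [map_id_app, ← map_comp_app, ← map_comp_app] at e
  -- The component in `Y` is obtained by pairing with the augmentation of `x`, which is zero.
  have e₁ : ((indec H).map (GrMod.fst Y Z)).app n q = 0 := by
    refine ((indecPair hH b).map_bil _ _ h x.1 y).trans ?_
    refine ((indecPair hH b).bil_pre (X' := base k) (Y' := Y) Y.smulBil (sqZeroAug X) (𝟙 Y)
      h x.1 y).trans ?_
    rw [show (F.map (sqZeroAug X)).app i x.1 = 0 from x.2, BilinMap.zero_left]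
  have e₂ : ((indec H).map (GrMod.snd Y Z)).app n q = ((laxPairing hH b).bil f).app h x y :=
    (indecPair hH b).map_bil _ _ h x.1 y
  rw [e₁, e₂, map_zero, zero_add] at e
  refine Eq.symm ((congrArg (fun t => (H.map γ').app n t.1) e).trans ?_)
  refine (map_comp_app H (sqZeroMap (GrMod.inr Y Z)) γ' n _).trans ?_
  refine congrArg (fun t => GrMod.Hom.app (H.map t) n
    (((laxPairing hH b).bil f).app h x y).1) (sqZero_hom_ext fun n z => ?_)
  rw [comp_app, sqZeroMap_in, hγ', hδ]
  change β.app n ((sqZeroIn Y).app n 0) + _ = _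
  rw [map_zero, map_zero, zero_add]
  rfl

lemma BilinMap.inclProd_injective {X Y Z : GrMod k} (f : BilinMap X Y Z) (n : ℤ)
    (x y : Z.carrier n) (h : f.inclProd.app n ((sqZeroIn Z).app n x) =
      f.inclProd.app n ((sqZeroIn Z).app n y)) : x = y :=
  congrArg (fun t => t.2.2.2) h

lemma BilinMap.inclProd_app {X Y Z : GrMod k} (f : BilinMap X Y Z) {i j n : ℤ} (h : i + j = n)
    (x : X.carrier i) (y : Y.carrier j) :
    f.inclProd.app n ((sqZeroIn Z).app n (f.app h x y)) =
      f.algebra.mul h (f.inclLeft.app i ((sqZeroIn X).app i x))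
        (f.inclRight.app j ((sqZeroIn Y).app j y)) := by
  refine Prod.ext (k.mul_zero h 0).symm ?_
  change (0, 0, f.app h x y) = (X.sum3 Y Z).smul h 0 (0, y, 0) + (X.sum3 Y Z).rsmul h (x, 0, 0) 0 +
    (0, 0, f.app h x y + (i * j).negOnePow • f.app _ 0 0)
  simp

lemma BilinMap.inclRight_mul_inclProd {X Y Z : GrMod k} (f : BilinMap X Y Z) {i j n : ℤ}
    (h : i + j = n) (y : Y.carrier i) (z : Z.carrier j) :
    f.algebra.mul h (f.inclRight.app i ((sqZeroIn Y).app i y))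
      (f.inclProd.app j ((sqZeroIn Z).app j z)) = 0 := by
  refine Prod.ext (k.mul_zero h 0) ?_
  change (X.sum3 Y Z).smul h 0 (0, 0, z) + (X.sum3 Y Z).rsmul h (0, y, 0) 0 +
    (0, 0, f.app h 0 0 + (i * j).negOnePow • f.app _ 0 y) = 0
  simp [Prod.zero_eq_mk]

lemma BilinMap.inclLeft_mul_inclProd {X Y Z : GrMod k} (f : BilinMap X Y Z) {i j n : ℤ}
    (h : i + j = n) (x : X.carrier i) (z : Z.carrier j) :
    f.algebra.mul h (f.inclLeft.app i ((sqZeroIn X).app i x))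
      (f.inclProd.app j ((sqZeroIn Z).app j z)) = 0 := by
  refine Prod.ext (k.mul_zero h 0) ?_
  change (X.sum3 Y Z).smul h 0 (0, 0, z) + (X.sum3 Y Z).rsmul h (x, 0, 0) 0 +
    (0, 0, f.app h x 0 + (i * j).negOnePow • f.app _ 0 0) = 0
  simp [Prod.zero_eq_mk]

lemma isLax_laxPairing (T : SchTensor F G) : IsLax T (laxPairing T.formal T.bilin) :=
  fun f _ _ _ h x y => laxPairing_map T.formal T.bilin f f.inclLeft f.inclRight f.inclProd
    f.inclProd_app f.inclRight_mul_inclProd h x y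

/-- The condition fixes the image in `k ⊕ X ⊕ Y ⊕ Z`, and elements of `𝒬` are determined there
because the map from `Z` is injective. -/
lemma IsLax.eq_laxPairing {T : SchTensor F G} {p : Pairing (indec F) (indec G) (indec T.obj)}
    (hp : IsLax T p) : p = laxPairing T.formal T.bilin :=
  Pairing.ext_app fun f _ _ _ h x y => T.formal.indec_injective f.inclProd f.inclProd_injective
    ((hp f h x y).trans (isLax_laxPairing T f h x y).symm)

/-- The construction treats its two arguments differently, one through an algebra and the other
through a module. The characterization in `f.algebra` is symmetric up to the Koszul sign, so both
sides are compared there. -/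
lemma laxPairing_flip (hH : IsFormal H) (b : SchBilin F G H) {X Y Z : GrMod k} (f : BilinMap X Y Z)
    {i j n : ℤ} (h : i + j = n) (h' : j + i = n) (x : ((indec F).obj X).carrier i)
    (y : ((indec G).obj Y).carrier j) :
    ((laxPairing hH b).bil f).app h x y =
      (i * j).negOnePow • ((laxPairing hH b.flip).bil f.flip).app h' y x := by
  refine hH.indec_injective f.inclProd f.inclProd_injective ?_
  rw [laxPairing_map hH b f f.inclLeft f.inclRight f.inclProd f.inclProd_app
    f.inclRight_mul_inclProd h x y]
  refine Eq.trans ?_ (map_zsmul_unit _ _ _).symm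
  refine Eq.trans ?_ (congrArg _ (laxPairing_map hH b.flip f.flip f.inclRight f.inclLeft f.inclProd
    (fun {i j n} h y x => ?_) f.inclLeft_mul_inclProd h' y x).symm)
  · change _ = (i * j).negOnePow • (j * i).negOnePow • (b.bil _).app h _ _
    rw [mul_comm j i, negOnePow_mul_self_smul]
  · rw [BilinMap.flip_app _ h ((add_comm j i).trans h), map_zsmul_unit, map_zsmul_unit,
      f.inclProd_app, f.algebra.mul_comm h ((add_comm j i).trans h)]

end lax

/-! ### Natural maps of nonzero degree out of the primitives. -/

section degree

variable {k l : GrRing.{u}}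

/-- The shift `M[e]`, with `M[e]_n = M_{n+e}`; the action is twisted by the sign `(-1)^{c|a|}`. -/
def GrMod.shift (l : GrRing.{u}) (e c : ℤ) : GrMod l ⥤ GrMod l where
  obj M :=
    { carrier := fun n => M.carrier (n + e)
      smul := fun {i j n} h a x => (i * c).negOnePow • M.smul (show i + (j + e) = n + e by omega) a x
      smul_add := fun h a x y => by rw [M.smul_add, _root_.smul_add]
      add_smul := fun h a b x => by rw [M.add_smul, _root_.smul_add]
      one_smul := fun h x => by
        rw [MulZeroClass.zero_mul, Int.negOnePow_zero, _root_.one_smul, M.one_smul]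
      mul_smul := fun {i j m ij jm n} h₁ h₂ h₃ h₄ a b x => by
        subst h₁
        rw [M.mul_smul rfl (by omega) (show j + (m + e) = jm + e by omega) (by omega), M.smul_sign,
          smul_smul, ← Int.negOnePow_add, _root_.add_mul] }
  map {M N} f := GrMod.Hom.mk (fun n => f.app (n + e)) (fun {i j n} h a x => by
    rw [map_zsmul_unit, f.map_smul])

lemma IsFormal.shift {C : Type (u + 1)} [Category.{u} C] {D : C ⥤ GrMod l} (hD : IsFormal D)
    (e c : ℤ) : IsFormal (D ⋙ GrMod.shift l e c) := fun q => hD (q + e)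

/-- A natural transformation of degree `e` that is `l`-linear up to the sign `(-1)^{c|a|}`. -/
structure DegNat {C : Type (u + 1)} [Category.{u} C] (B D : C ⥤ GrMod l) (e c : ℤ) where
  app : ∀ (X : C) (i : ℤ), (B.obj X).carrier i →+ (D.obj X).carrier (i + e)
  map_smul : ∀ (X : C) {d i n : ℤ} (h : d + i = n) (h' : d + (i + e) = n + e) (a : l.carrier d)
    (x : (B.obj X).carrier i),
    app X n ((B.obj X).smul h a x) = (d * c).negOnePow • (D.obj X).smul h' a (app X i x)
  natural : ∀ {X Y : C} (f : X ⟶ Y) (i : ℤ) (x : (B.obj X).carrier i),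
    (D.map f).app (i + e) (app X i x) = app Y i ((B.map f).app i x)

namespace DegNat

variable {C : Type (u + 1)} [Category.{u} C] {B D D' : C ⥤ GrMod l} {e c : ℤ}

/-- The corresponding natural transformation to the shift. -/
def toHom (s : DegNat B D e c) : B ⟶ D ⋙ GrMod.shift l e c where
  app X := GrMod.Hom.mk (N := (D ⋙ GrMod.shift l e c).obj X) (s.app X)
    (fun {d i n} h a x => s.map_smul X h (by omega) a x)
  naturality X Y f := GrMod.hom_ext fun n x => (s.natural f n x).symm

/-- The family that corresponds to a natural transformation to the shift. -/
def ofHom (σ : B ⟶ D ⋙ GrMod.shift l e c) : DegNat B D e c where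
  app X i := (σ.app X).app i
  map_smul X _ _ _ h _ a x := (σ.app X).map_smul h a x
  natural f i x := (nat_app σ f i x).symm

end DegNat

variable {G : GrAlg k ⥤ GrMod l} {D : GrMod k ⥤ GrMod l} {e c : ℤ}

/-- The universal property of `𝒫(G)` is about linear maps of degree zero. A family of degree `e`,
linear up to sign, is such a map into the shift of `D` with twisted action, and this shift is again
formal. -/
lemma Primitives.degNat_ext (P : Primitives G) (hD : IsFormal D) (s t : DegNat P.obj D e c)
    (h : ∀ (R : GrAlg k) (i : ℤ) (x : (G.obj R).carrier i),
      s.app R.toMod i ((P.unit.app R).app i x) = t.app R.toMod i ((P.unit.app R).app i x))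
    (X : GrMod k) (i : ℤ) (x : (P.obj.obj X).carrier i) : s.app X i x = t.app X i x := by
  have := (P.universal _ (hD.shift e c)
    (P.unit ≫ Functor.whiskerLeft (GrAlg.forget k) s.toHom)).unique rfl (y₁ := s.toHom)
    (y₂ := t.toHom) (by
      ext R
      exact GrMod.hom_ext fun n x => (h R n x).symm)
  exact congrArg (fun σ => GrMod.Hom.app (NatTrans.app σ X) i x) this

lemma Primitives.exists_degNat (P : Primitives G) (hD : IsFormal D)
    (s : DegNat G (GrAlg.forget k ⋙ D) e c) :
    ∃ t : DegNat P.obj D e c, ∀ (R : GrAlg k) (i : ℤ) (x : (G.obj R).carrier i),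
      t.app R.toMod i ((P.unit.app R).app i x) = s.app R i x := by
  obtain ⟨σ, hσ, -⟩ := P.universal _ (hD.shift e c) s.toHom
  refine ⟨DegNat.ofHom σ, fun R i x => ?_⟩
  exact congrArg (fun σ => GrMod.Hom.app (NatTrans.app σ R) i x) hσ

end degree

/-! ### Elements that come from flat modules. -/

section covers

variable {k l : GrRing.{u}} {J : Type (u + 1)} [Category.{u} J]

/-- A morphism whose underlying linear map factors through a flat module. -/
structure FlatMap (U : J ⥤ GrMod k) (S' S : J) where
  hom : S' ⟶ S
  mid : GrMod k
  flat : mid.Flat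
  fst : U.obj S' ⟶ mid
  snd : mid ⟶ U.obj S
  fac : U.map hom = fst ≫ snd

/-- Composition with a morphism. -/
def FlatMap.comp {U : J ⥤ GrMod k} {S' S S'' : J} (m : FlatMap U S' S) (v : S ⟶ S'') :
    FlatMap U S' S'' where
  hom := m.hom ≫ v
  mid := m.mid
  flat := m.flat
  fst := m.fst
  snd := m.snd ≫ U.map v
  fac := by rw [U.map_comp, m.fac, Category.assoc]

/-- Two elements of `K(S)`, of the same degree, come from elements of some `K(S')` along a map
that factors through a flat module. -/
def FlatCovered (U : J ⥤ GrMod k) (K : J ⥤ GrMod l) : Prop :=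
  ∀ {S : J} {j : ℤ} (y y' : (K.obj S).carrier j), ∃ (S' : J) (m : FlatMap U S' S)
    (t t' : (K.obj S').carrier j), (K.map m.hom).app j t = y ∧ (K.map m.hom).app j t' = y'

lemma FlatCovered.cover {U : J ⥤ GrMod k} {K : J ⥤ GrMod l} (h : FlatCovered U K) {S : J} {j : ℤ}
    (y : (K.obj S).carrier j) : ∃ (S' : J) (m : FlatMap U S' S) (t : (K.obj S').carrier j),
      (K.map m.hom).app j t = y := by
  obtain ⟨S', m, t, -, ht, -⟩ := h y y
  exact ⟨S', m, t, ht⟩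

variable {U : J ⥤ GrMod k} {K : J ⥤ GrMod l} {G : GrAlg k ⥤ GrMod l} {D : GrMod k ⥤ GrMod l}

/-- The restriction of a pairing along the universal map `G → 𝒫(G)`, in the left argument. -/
def MPair.restr (P : Primitives G) (p : MPair (𝟭 (GrMod k)) U P.obj K D) :
    MPair (GrAlg.forget k) U G K D where
  bil {R S Z} f := (p.bil (X := R.toMod) f).pre (P.unit.app R) (𝟙 _)
  natural {R R' S S' Z Z'} f f' u v w e i j n h x y := by
    refine (p.natural (X := R.toMod) (X' := R'.toMod) f f' (GrAlg.lin u) v w e h _ _).trans ?_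
    exact congrArg (fun t => (p.bil (X := R'.toMod) f').app h t _) (nat_app P.unit u i x).symm

/-- For fixed `y`, a pairing with `y` is natural in the other argument. -/
def MPair.degNat {I : Type (u + 1)} [Category.{u} I] {V : I ⥤ GrMod k} {B : I ⥤ GrMod l}
    (p : MPair V U B K D) {S : J} {j : ℤ} (y : (K.obj S).carrier j) {Y : GrMod k}
    (g : U.obj S ⟶ Y) : DegNat B (V ⋙ GrMod.tensorRight Y ⋙ D) j 0 where
  app X i := AddMonoidHom.mk'
    (fun x => (p.bil ((GrMod.tmulBil (V.obj X) Y).pre (𝟙 _) g)).app rfl x y)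
    (fun x x' => BilinMap.add_left _ _ _ _ _)
  map_smul X d i n h h' a x := by
    rw [mul_zero, Int.negOnePow_zero, one_smul]
    exact BilinMap.smul_left _ h rfl rfl h' a x y
  natural {X X'} f i x := by
    have e := p.natural ((GrMod.tmulBil (V.obj X) Y).pre (𝟙 _) g)
      ((GrMod.tmulBil (V.obj X') Y).pre (𝟙 _) g) f (𝟙 S) (GrMod.tensorHom (V.map f) (𝟙 Y)) (by
        ext i j n h x y
        refine (GrMod.tensorHom_tmul _ _ _ _ _).trans ?_
        rw [U.map_id]; rfl) rfl x y
    rw [map_id_app] at e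
    exact e

lemma BilinMap.pre_comp_eq {X Y Y' Z : GrMod k} (f : BilinMap X Y Z) (a : Y' ⟶ Y) {M : GrMod k}
    (g : Y' ⟶ M) (h : M ⟶ Y) (e : a = g ≫ h) :
    f.pre (𝟙 X) a = ((GrMod.tmulBil X M).pre (𝟙 X) g).post
      (GrMod.tensorLift (f.pre (𝟙 X) h)) := by
  subst e
  ext i j n hn x y
  exact (GrMod.tensorLift_tmul (f.pre (𝟙 X) h) hn x (g.app j y)).symm

/-- Naturality moves a product with an element coming from `S'` to `V(X) ⊗ m.mid`. There the second
factor is flat, so that `D (- ⊗ m.mid)` is formal when `D` is. -/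
lemma MPair.bil_cover {I : Type (u + 1)} [Category.{u} I] {V : I ⥤ GrMod k} {B : I ⥤ GrMod l}
    (p : MPair V U B K D) {X : I} {S S' : J} {Z : GrMod k}
    (f : BilinMap (V.obj X) (U.obj S) Z) (m : FlatMap U S' S) {i j n : ℤ} (h : i + j = n)
    (x : (B.obj X).carrier i) (y : (K.obj S').carrier j) :
    (p.bil f).app h x ((K.map m.hom).app j y) =
      (D.map (GrMod.tensorLift (f.pre (𝟙 _) m.snd))).app n
        ((p.bil ((GrMod.tmulBil (V.obj X) m.mid).pre (𝟙 _) m.fst)).app h x y) := by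
  have e := p.bil_pre f (𝟙 X) m.hom h x y
  rw [map_id_app] at e
  rw [p.map_bil, ← BilinMap.pre_comp_eq f (U.map m.hom) m.fst m.snd m.fac, ← e, V.map_id]

/-- Once `y` is lifted along a flat cover, both products are natural families from `𝒫(G)` to the
formal bimodule `D (- ⊗ m.mid)`, so agreement on the image of `G` suffices. -/
lemma MPair.ext_of_restr (P : Primitives G) (hD : IsFormal D) (hK : FlatCovered U K)
    (p q : MPair (𝟭 (GrMod k)) U P.obj K D)
    (h : ∀ {R : GrAlg k} {S : J} {Z : GrMod k} (f : BilinMap R.toMod (U.obj S) Z) {i j n : ℤ}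
      (h : i + j = n) (x : (G.obj R).carrier i) (y : (K.obj S).carrier j),
      ((p.restr P).bil f).app h x y = ((q.restr P).bil f).app h x y)
    {X : GrMod k} {S : J} {Z : GrMod k} (f : BilinMap X (U.obj S) Z) {i j n : ℤ}
    (hn : i + j = n) (x : (P.obj.obj X).carrier i) (y : (K.obj S).carrier j) :
    (p.bil (X := X) f).app hn x y = (q.bil (X := X) f).app hn x y := by
  obtain ⟨S', m, t, rfl⟩ := hK.cover y
  subst hn
  rw [p.bil_cover (X := X), q.bil_cover (X := X)]
  refine congrArg _ ?_
  exact P.degNat_ext (hD.tensorRight m.flat) (p.degNat t m.fst) (q.degNat t m.fst)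
    (fun R i x => h _ rfl x t) X i x

end covers

/-! ### Extending a pairing along the universal map `G → 𝒫(G)`. -/

section extension

variable {k l : GrRing.{u}} {J : Type (u + 1)} [Category.{u} J]

/-- Transport along an equality of degrees. -/
def GrMod.castDeg (M : GrMod l) {m n : ℤ} (h : m = n) : M.carrier m →+ M.carrier n :=
  h ▸ AddMonoidHom.id _

lemma GrMod.castDeg_smul (M : GrMod l) {d i m n : ℤ} (h : m = n) (h' : d + i = m) (h'' : d + i = n)
    (a : l.carrier d) (x : M.carrier i) : M.castDeg h (M.smul h' a x) = M.smul h'' a x := by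
  subst h; rfl

lemma GrMod.smul_castDeg (M : GrMod l) {d i m n : ℤ} (h : i = m) (h' : d + m = n) (h'' : d + i = n)
    (a : l.carrier d) (x : M.carrier i) : M.smul h' a (M.castDeg h x) = M.smul h'' a x := by
  subst h; rfl

/-- The map of degree zero between tensor products given by a linear map. -/
def DegNat.postTensor {B : GrMod k ⥤ GrMod l} {D : GrMod k ⥤ GrMod l} {Y Y' : GrMod k} {e c : ℤ}
    (s : DegNat B (GrMod.tensorRight Y ⋙ D) e c) (v : Y ⟶ Y') :
    DegNat B (GrMod.tensorRight Y' ⋙ D) e c where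
  app X i := ((D.map (GrMod.tensorHom (𝟙 X) v)).app (i + e)).comp (s.app X i)
  map_smul X d i n h h' a x := by
    refine (congrArg _ (s.map_smul X h h' a x)).trans ?_
    refine (map_zsmul_unit _ _ _).trans (congrArg _ (GrMod.Hom.map_smul _ _ _ _))
  natural {X X'} f i x := by
    refine Eq.trans ?_ (congrArg ((D.map (GrMod.tensorHom (𝟙 X') v)).app (i + e)) (s.natural f i x))
    refine (map_comp_app D _ _ _ _).trans (Eq.trans ?_ (map_comp_app D _ _ _ _).symm)
    refine congrArg (fun t => GrMod.Hom.app (D.map t) (i + e) (s.app X i x))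
      (GrMod.tensor_hom_ext fun h x y => ?_)
    change (GrMod.tensorHom f (𝟙 Y')).app _ ((GrMod.tensorHom (𝟙 X) v).app _ (GrMod.tmul h x y)) =
      (GrMod.tensorHom (𝟙 X') v).app _ ((GrMod.tensorHom f (𝟙 Y)).app _ (GrMod.tmul h x y))
    simp only [GrMod.tensorHom_tmul, GrMod.id_app]

variable {U : J ⥤ GrMod k} {K : J ⥤ GrMod l} {G : GrAlg k ⥤ GrMod l} {D : GrMod k ⥤ GrMod l}

/-- The sum of two families. -/
def DegNat.add {C : Type (u + 1)} [Category.{u} C] {B D : C ⥤ GrMod l} {e c : ℤ}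
    (s t : DegNat B D e c) : DegNat B D e c where
  app X i := s.app X i + t.app X i
  map_smul X _ _ _ h h' a x := by
    rw [AddMonoidHom.add_apply, AddMonoidHom.add_apply, s.map_smul X h h', t.map_smul X h h',
      ← smul_add, ← GrMod.smul_add]
  natural f i x := by
    rw [AddMonoidHom.add_apply, AddMonoidHom.add_apply, map_add, s.natural, t.natural]

/-- The product of a family with a scalar. -/
def DegNat.scal {C : Type (u + 1)} [Category.{u} C] {B D : C ⥤ GrMod l} {e : ℤ}
    (s : DegNat B D e 0) {d e' : ℤ} (h : d + e = e') (a : l.carrier d) : DegNat B D e' 0 where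
  app X i := AddMonoidHom.mk' (fun x => (d * i).negOnePow •
      (D.obj X).smul (show d + (i + e) = i + e' by omega) a (s.app X i x))
    (fun x y => by rw [map_add, GrMod.smul_add, smul_add])
  map_smul X d' i n h₁ h₂ b x := by
    subst h₁
    rw [mul_zero, Int.negOnePow_zero, one_smul, AddMonoidHom.mk'_apply, AddMonoidHom.mk'_apply,
      s.map_smul X rfl (by omega), mul_zero, Int.negOnePow_zero, one_smul,
      GrMod.smul_comm _ _ _ (show d + (i + e) = i + e' by omega) h₂, GrMod.smul_sign, smul_smul,
      ← Int.negOnePow_add]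
    congr 1
    rw [Int.negOnePow_eq_iff]
    exact ⟨d * d', by ring⟩
  natural f i x := by
    rw [AddMonoidHom.mk'_apply, AddMonoidHom.mk'_apply, map_zsmul_unit, GrMod.Hom.map_smul,
      s.natural]

section tau

variable (P : Primitives G) (hD : IsFormal D) (θ : MPair (GrAlg.forget k) U G K D)

/-- The extension to `𝒫(G)` of the pairing with a fixed element. -/
noncomputable def extFlat {S : J} {j : ℤ} (y : (K.obj S).carrier j) {Y : GrMod k} (hY : Y.Flat)
    (g : U.obj S ⟶ Y) : DegNat P.obj (GrMod.tensorRight Y ⋙ D) j 0 :=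
  (P.exists_degNat (hD.tensorRight hY) (θ.degNat y g)).choose

lemma extFlat_unit {S : J} {j : ℤ} (y : (K.obj S).carrier j) {Y : GrMod k} (hY : Y.Flat)
    (g : U.obj S ⟶ Y) (R : GrAlg k) (i : ℤ) (x : (G.obj R).carrier i) :
    (extFlat P hD θ y hY g).app R.toMod i ((P.unit.app R).app i x) =
      (θ.bil ((GrMod.tmulBil R.toMod Y).pre (𝟙 _) g)).app rfl x y :=
  (P.exists_degNat (hD.tensorRight hY) (θ.degNat y g)).choose_spec R i x

/-- Both sides are natural families on `𝒫(G)` with the same values on the image of `G`. Uniqueness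
in the universal property identifies them; the same argument gives additivity and linearity in `y`.
-/
lemma extFlat_map {S S' : J} {j : ℤ} (y : (K.obj S').carrier j) {Y Y' : GrMod k} (hY : Y.Flat)
    (hY' : Y'.Flat) (g : U.obj S ⟶ Y) (g' : U.obj S' ⟶ Y') (b : S' ⟶ S) (v : Y' ⟶ Y)
    (e : U.map b ≫ g = g' ≫ v) (X : GrMod k) (i : ℤ) (x : (P.obj.obj X).carrier i) :
    (D.map (GrMod.tensorHom (𝟙 X) v)).app (i + j) ((extFlat P hD θ y hY' g').app X i x) =
      (extFlat P hD θ ((K.map b).app j y) hY g).app X i x := by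
  refine P.degNat_ext (hD.tensorRight hY) ((extFlat P hD θ y hY' g').postTensor v)
    (extFlat P hD θ ((K.map b).app j y) hY g) (fun R i x => ?_) X i x
  refine (congrArg _ (extFlat_unit P hD θ y hY' g' R i x)).trans ?_
  rw [extFlat_unit]
  refine (θ.natural _ ((GrMod.tmulBil R.toMod Y).pre (𝟙 _) g) (𝟙 R) b _ ?_ rfl x y).trans ?_
  · ext i' j' n h r s
    refine (GrMod.tensorHom_tmul _ _ _ _ _).trans ?_
    have := congrArg (fun t => GrMod.Hom.app t j' s) e
    exact congrArg (GrMod.tmul (X := R.toMod) h r) this.symm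
  · rw [map_id_app]

lemma extFlat_add {S : J} {j : ℤ} (y y' : (K.obj S).carrier j) {Y : GrMod k} (hY : Y.Flat)
    (g : U.obj S ⟶ Y) (X : GrMod k) (i : ℤ) (x : (P.obj.obj X).carrier i) :
    (extFlat P hD θ (y + y') hY g).app X i x = (extFlat P hD θ y hY g).app X i x +
      (extFlat P hD θ y' hY g).app X i x := by
  refine P.degNat_ext (hD.tensorRight hY) (extFlat P hD θ (y + y') hY g)
    ((extFlat P hD θ y hY g).add (extFlat P hD θ y' hY g)) (fun R i x => ?_) X i x
  refine (extFlat_unit P hD θ _ hY g R i x).trans (Eq.trans ?_ (congrArg₂ (· + ·)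
    (extFlat_unit P hD θ y hY g R i x) (extFlat_unit P hD θ y' hY g R i x)).symm)
  exact BilinMap.add_right _ _ _ _ _

lemma extFlat_smul {S : J} {d j j' : ℤ} (h : d + j = j') (a : l.carrier d) (y : (K.obj S).carrier j)
    {Y : GrMod k} (hY : Y.Flat) (g : U.obj S ⟶ Y) (X : GrMod k) (i : ℤ)
    (h' : d + (i + j) = i + j') (x : (P.obj.obj X).carrier i) :
    (extFlat P hD θ ((K.obj S).smul h a y) hY g).app X i x = (d * i).negOnePow •
      (D.obj _).smul h' a ((extFlat P hD θ y hY g).app X i x) := by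
  refine P.degNat_ext (hD.tensorRight hY) (extFlat P hD θ ((K.obj S).smul h a y) hY g)
    ((extFlat P hD θ y hY g).scal h a) (fun R i x => ?_) X i x
  refine (extFlat_unit P hD θ _ hY g R i x).trans (Eq.trans ?_ (congrArg
    (fun t => (d * i).negOnePow • (D.obj _).smul (show d + (i + j) = i + j' by omega) a t)
    (extFlat_unit P hD θ y hY g R i x)).symm)
  exact BilinMap.smul_right _ _ _ _ _ _ _ _

/-- The value of the extension on an element that is covered by a flat module. -/
noncomputable def extCover {X Z : GrMod k} {S S' : J} (f : BilinMap X (U.obj S) Z)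
    (m : FlatMap U S' S) {i j : ℤ} (x : (P.obj.obj X).carrier i) (t : (K.obj S').carrier j) :
    (D.obj Z).carrier (i + j) :=
  (D.map (GrMod.tensorLift (f.pre (𝟙 X) m.snd))).app (i + j)
    ((extFlat P hD θ t m.flat m.fst).app X i x)

/-- The maps `b` and `v` say that `m₂` factors through `m₁`, also on the flat modules in the middle;
compatibility is then naturality of `extFlat` in the flat module. -/
lemma extCover_refine {X Z : GrMod k} {S S₁ S₂ : J} (f : BilinMap X (U.obj S) Z)
    (m₁ : FlatMap U S₁ S) (m₂ : FlatMap U S₂ S) (b : S₂ ⟶ S₁) (v : m₂.mid ⟶ m₁.mid)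
    (e : U.map b ≫ m₁.fst = m₂.fst ≫ v) (e' : v ≫ m₁.snd = m₂.snd) {i j : ℤ}
    (x : (P.obj.obj X).carrier i) (t : (K.obj S₂).carrier j) :
    extCover P hD θ f m₁ x ((K.map b).app j t) = extCover P hD θ f m₂ x t := by
  rw [extCover, ← extFlat_map P hD θ t m₁.flat m₂.flat m₁.fst m₂.fst b v e, extCover]
  refine (map_comp_app D _ _ _ _).trans ?_
  refine congrArg (fun w => GrMod.Hom.app (D.map w) (i + j)
    ((extFlat P hD θ t m₂.flat m₂.fst).app X i x)) (GrMod.tensor_hom_ext fun h x y => ?_)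
  rw [← e', GrMod.comp_app, GrMod.tensorHom_tmul]
  refine (GrMod.tensorLift_tmul _ _ _ _).trans (GrMod.tensorLift_tmul _ _ _ _).symm

/-- Formality of `K` provides one element that maps to both `t₁` and `t₂`, chosen so that the two
resulting maps to `S` coincide. A flat cover of that element refines both given covers. -/
lemma extCover_eq (hKf : IsFormal K) (hK : FlatCovered U K) {X Z : GrMod k} {S S₁ S₂ : J}
    (f : BilinMap X (U.obj S) Z) (m₁ : FlatMap U S₁ S) (m₂ : FlatMap U S₂ S) {i j : ℤ}
    (x : (P.obj.obj X).carrier i) (t₁ : (K.obj S₁).carrier j) (t₂ : (K.obj S₂).carrier j)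
    (h : (K.map m₁.hom).app j t₁ = (K.map m₂.hom).app j t₂) :
    extCover P hD θ f m₁ x t₁ = extCover P hD θ f m₂ x t₂ := by
  obtain ⟨S₃, z, b₁, b₂, rfl, rfl⟩ := hKf.common t₁ t₂
  obtain ⟨S₄, z, p, rfl, e⟩ := hKf.equalize (b₁ ≫ m₁.hom) (b₂ ≫ m₂.hom) z (by
    rw [← map_comp_app, ← map_comp_app, h])
  obtain ⟨S₅, m, t, rfl⟩ := hK.cover z
  rw [map_comp_app, map_comp_app, map_comp_app, map_comp_app]
  -- By `e` the underlying map to `S` is also the one through `m₂`, so this single cover is compared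
  -- with `m₁` via `b₁` and with `m₂` via `b₂`.
  let n₁ : FlatMap U S₅ S := m.comp (p ≫ b₁ ≫ m₁.hom)
  have e₁ := extCover_refine P hD θ f m₁ n₁ (m.hom ≫ p ≫ b₁)
    (m.snd ≫ U.map (p ≫ b₁) ≫ m₁.fst) (by
      rw [U.map_comp, m.fac]
      simp [n₁, FlatMap.comp]) (by
      simp only [n₁, FlatMap.comp, U.map_comp, m₁.fac, Category.assoc]) x t
  have e₂ := extCover_refine P hD θ f m₂ n₁ (m.hom ≫ p ≫ b₂)
    (m.snd ≫ U.map (p ≫ b₂) ≫ m₂.fst) (by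
      rw [U.map_comp, m.fac]
      simp [n₁, FlatMap.comp]) (by
      simp only [n₁, FlatMap.comp, e]
      simp only [U.map_comp, m₂.fac, Category.assoc]) x t
  exact e₁.trans e₂.symm

lemma extCover_add_left {X Z : GrMod k} {S S' : J} (f : BilinMap X (U.obj S) Z)
    (m : FlatMap U S' S) {i j : ℤ} (x x' : (P.obj.obj X).carrier i) (t : (K.obj S').carrier j) :
    extCover P hD θ f m (x + x') t = extCover P hD θ f m x t + extCover P hD θ f m x' t :=
  (congrArg _ (map_add ((extFlat P hD θ t m.flat m.fst).app X i) x x')).trans (map_add _ _ _)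

lemma extCover_add_right {X Z : GrMod k} {S S' : J} (f : BilinMap X (U.obj S) Z)
    (m : FlatMap U S' S) {i j : ℤ} (x : (P.obj.obj X).carrier i) (t t' : (K.obj S').carrier j) :
    extCover P hD θ f m x (t + t') = extCover P hD θ f m x t + extCover P hD θ f m x t' :=
  (congrArg _ (extFlat_add P hD θ t t' m.flat m.fst X i x)).trans (map_add _ _ _)

lemma extCover_smul_left {X Z : GrMod k} {S S' : J} (f : BilinMap X (U.obj S) Z)
    (m : FlatMap U S' S) {d i j n : ℤ} (h : d + i = n) (h' : d + (i + j) = n + j) (a : l.carrier d)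
    (x : (P.obj.obj X).carrier i) (t : (K.obj S').carrier j) :
    extCover P hD θ f m ((P.obj.obj X).smul h a x) t =
      (D.obj Z).smul h' a (extCover P hD θ f m x t) := by
  refine (congrArg _ ((extFlat P hD θ t m.flat m.fst).map_smul X h h' a x)).trans ?_
  rw [mul_zero, Int.negOnePow_zero, one_smul]
  exact GrMod.Hom.map_smul _ h' _ _

lemma extCover_smul_right {X Z : GrMod k} {S S' : J} (f : BilinMap X (U.obj S) Z)
    (m : FlatMap U S' S) {d i j n : ℤ} (h : d + j = n) (h' : d + (i + j) = i + n) (a : l.carrier d)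
    (x : (P.obj.obj X).carrier i) (t : (K.obj S').carrier j) :
    extCover P hD θ f m x ((K.obj S').smul h a t) =
      (d * i).negOnePow • (D.obj Z).smul h' a (extCover P hD θ f m x t) := by
  refine (congrArg _ (extFlat_smul P hD θ h a t m.flat m.fst X i h' x)).trans ?_
  exact (map_zsmul_unit _ _ _).trans (congrArg _ (GrMod.Hom.map_smul _ h' _ _))

lemma extCover_map {X X' Z Z' : GrMod k} {S S' S₂ : J} (f : BilinMap X (U.obj S) Z)
    (f' : BilinMap X' (U.obj S₂) Z') (u : X ⟶ X') (v : S ⟶ S₂) (w : Z ⟶ Z')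
    (e : f.post w = f'.pre u (U.map v)) (m : FlatMap U S' S) {i j : ℤ}
    (x : (P.obj.obj X).carrier i) (t : (K.obj S').carrier j) :
    (D.map w).app (i + j) (extCover P hD θ f m x t) =
      extCover P hD θ f' (m.comp v) ((P.obj.map u).app i x) t := by
  refine Eq.trans ?_ (congrArg (GrMod.Hom.app _ (i + j))
    ((extFlat P hD θ t m.flat m.fst).natural u i x))
  refine (map_comp_app D _ _ _ _).trans (Eq.trans ?_ (map_comp_app D _ _ _ _).symm)
  refine congrArg (fun w => GrMod.Hom.app (D.map w) (i + j)
    ((extFlat P hD θ t m.flat m.fst).app X i x)) (GrMod.tensor_hom_ext fun {p q n} h x y => ?_)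
  have e' := congrArg (fun b => BilinMap.app b h x (m.snd.app q y)) e
  refine (congrArg (w.app n) (GrMod.tensorLift_tmul (f.pre (𝟙 X) m.snd) h x y)).trans (e'.trans ?_)
  refine Eq.symm ((congrArg ((GrMod.tensorLift (f'.pre (𝟙 X') (m.comp v).snd)).app n)
    (GrMod.tensorHom_tmul u (𝟙 m.mid) h x y)).trans ?_)
  exact GrMod.tensorLift_tmul (f'.pre (𝟙 X') (m.comp v).snd) h _ _

lemma extCover_unit {R : GrAlg k} {Z : GrMod k} {S S' : J} (f : BilinMap R.toMod (U.obj S) Z)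
    (m : FlatMap U S' S) {i j : ℤ} (x : (G.obj R).carrier i) (t : (K.obj S').carrier j) :
    extCover P hD θ f m ((P.unit.app R).app i x) t =
      (θ.bil f).app rfl x ((K.map m.hom).app j t) := by
  refine Eq.trans ?_ (θ.bil_cover f m rfl x t).symm
  exact congrArg _ (extFlat_unit P hD θ t m.flat m.fst R i x)

variable (hKf : IsFormal K) (hK : FlatCovered U K)

/-- The value of the extension. -/
noncomputable def extVal {X Z : GrMod k} {S : J} (f : BilinMap X (U.obj S) Z) {i j : ℤ}
    (x : (P.obj.obj X).carrier i) (y : (K.obj S).carrier j) : (D.obj Z).carrier (i + j) :=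
  extCover P hD θ f (hK.cover y).choose_spec.choose x (hK.cover y).choose_spec.choose_spec.choose

lemma extVal_eq (hKf : IsFormal K) {X Z : GrMod k} {S S' : J} (f : BilinMap X (U.obj S) Z)
    (m : FlatMap U S' S) {i j : ℤ} (x : (P.obj.obj X).carrier i) (t : (K.obj S').carrier j) :
    extVal P hD θ hK f x ((K.map m.hom).app j t) = extCover P hD θ f m x t :=
  extCover_eq P hD θ hKf hK f _ m x _ t
    (hK.cover ((K.map m.hom).app j t)).choose_spec.choose_spec.choose_spec

/-- The bilinear maps of the extension. -/
noncomputable def extBil {X Z : GrMod k} {S : J} (f : BilinMap X (U.obj S) Z) :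
    BilinMap (P.obj.obj X) (K.obj S) (D.obj Z) where
  app h x y := (D.obj Z).castDeg h (extVal P hD θ hK f x y)
  add_left h x x' y := by
    rw [← map_add]
    exact congrArg _ (extCover_add_left P hD θ f _ x x' _)
  add_right h x y y' := by
    rw [← map_add]
    refine congrArg _ ?_
    -- Additivity in `y` needs one flat cover for both elements, which is why `FlatCovered` speaks
    -- of pairs.
    obtain ⟨S', m, t, t', rfl, rfl⟩ := hK y y'
    rw [← map_add, extVal_eq P hD θ hK hKf, extVal_eq P hD θ hK hKf, extVal_eq P hD θ hK hKf,
      extCover_add_right]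
  smul_left {d i j di ij n} h₁ h₂ h₃ h₄ a x y := by
    rw [GrMod.smul_castDeg _ _ _ (show d + (i + j) = n by omega)]
    refine (congrArg _ (extCover_smul_left P hD θ f _ h₁ (by omega) a x _)).trans ?_
    exact GrMod.castDeg_smul _ _ _ _ _ _
  smul_right {d i j dj ij n} h₁ h₂ h₃ h₄ a x y := by
    obtain ⟨S', m, t, rfl⟩ := hK.cover y
    rw [GrMod.smul_castDeg _ _ _ (show d + (i + j) = n by omega), ← GrMod.Hom.map_smul,
      extVal_eq P hD θ hK hKf, extVal_eq P hD θ hK hKf,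
      extCover_smul_right P hD θ f m h₁ (show d + (i + j) = i + dj by omega), map_zsmul_unit,
      GrMod.castDeg_smul]

/-- The extension of a family of bilinear maps along the universal map `G → 𝒫(G)`. -/
noncomputable def MPair.extend : MPair (𝟭 (GrMod k)) U P.obj K D where
  bil {X S Z} f := extBil P hD θ hKf hK (X := X) f
  natural {X X' S S₂ Z Z'} f f' u v w e i j n h x y := by
    subst h
    obtain ⟨S', m, t, rfl⟩ := hK.cover y
    refine (congrArg _ (extVal_eq P hD θ hK hKf f m x t)).trans ?_
    refine (extCover_map P hD θ f f' u v w e m x t).trans ?_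
    refine (extVal_eq P hD θ hK hKf f' (m.comp v) _ t).symm.trans ?_
    exact congrArg (extVal P hD θ hK f' _) (map_comp_app K m.hom v _ t).symm

/-- On a flat cover the extension was chosen to agree with `θ` on the image of `G`, and naturality
of `θ` removes the cover. -/
lemma MPair.extend_unit {R : GrAlg k} {Z : GrMod k} {S : J} (f : BilinMap R.toMod (U.obj S) Z)
    {i j n : ℤ} (h : i + j = n) (x : (G.obj R).carrier i) (y : (K.obj S).carrier j) :
    ((θ.extend P hD hKf hK).bil (X := R.toMod) f).app h ((P.unit.app R).app i x) y =
      (θ.bil f).app h x y := by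
  subst h
  obtain ⟨S', m, t, rfl⟩ := hK.cover y
  exact (extVal_eq P hD θ hK hKf f m _ t).trans (extCover_unit P hD θ f m x t)

end tau

end extension

/-! ### Pro-flatness provides flat covers. -/

section proFlat

variable {k l : GrRing.{u}}

/-- Each element comes from a flat module of the pro-system; the direct sum of two of these carries
both elements. -/
lemma IsProFlatBimod.flatCovered {B : GrMod k ⥤ GrMod l} (h : IsProFlatBimod B) :
    FlatCovered (𝟭 (GrMod k)) B := by
  intro S j y y'
  obtain ⟨I, _, _, A, ⟨J, _, _, A', hA', ⟨σ⟩⟩, ⟨τ⟩⟩ := h j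
  have hr := (isProRep_proHom A').of_iso (σ.symm ≪≫ τ)
  obtain ⟨i, g, x, hg⟩ : ∃ (i : J) (g : A'.obj i ⟶ S) (x : (B.obj (A'.obj i)).carrier j),
      (B.map g).app j x = y := (hr.surj (M := S) y).imp fun i ⟨g, hg⟩ => ⟨g, _, hg⟩
  obtain ⟨i', g', x', hg'⟩ : ∃ (i : J) (g : A'.obj i ⟶ S) (x : (B.obj (A'.obj i)).carrier j),
      (B.map g).app j x = y' := (hr.surj (M := S) y').imp fun i ⟨g, hg⟩ => ⟨g, _, hg⟩
  have e₁ : GrMod.inl (A'.obj i) (A'.obj i') ≫ GrMod.copair g g' = g :=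
    GrMod.hom_ext fun n x => (congrArg (g.app n x + ·) (map_zero (g'.app n))).trans (add_zero _)
  have e₂ : GrMod.inr (A'.obj i) (A'.obj i') ≫ GrMod.copair g g' = g' :=
    GrMod.hom_ext fun n x => (congrArg (· + g'.app n x) (map_zero (g.app n))).trans (zero_add _)
  let m : FlatMap (𝟭 (GrMod k)) ((A'.obj i).prod (A'.obj i')) S :=
    ⟨GrMod.copair g g', (A'.obj i).prod (A'.obj i'), (hA' i).prod (hA' i'), 𝟙 _,
      GrMod.copair g g', (Category.id_comp _).symm⟩
  refine ⟨_, m, (B.map (GrMod.inl _ _)).app j x, (B.map (GrMod.inr _ _)).app j x',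
    Eq.trans ?_ hg, Eq.trans ?_ hg'⟩
  · rw [map_comp_app, show GrMod.inl _ _ ≫ m.hom = g from e₁]
  · rw [map_comp_app, show GrMod.inr _ _ ≫ m.hom = g' from e₂]

/-- The map `S₁ ⊗ S₂ → S` factors through a flat module if `S₁ → S` and `S₂ → S` do. -/
def FlatMap.tensor {S₁ S₂ S : GrAlg k} (m₁ : FlatMap (GrAlg.forget k) S₁ S)
    (m₂ : FlatMap (GrAlg.forget k) S₂ S) : FlatMap (GrAlg.forget k) (S₁.tensor S₂) S where
  hom := GrAlg.lift m₁.hom m₂.hom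
  mid := m₁.mid.tensor m₂.mid
  flat := m₁.flat.tensor m₂.flat
  fst := GrAlg.desc ((GrMod.tmulBil m₁.mid m₂.mid).pre m₁.fst m₂.fst)
  snd := GrMod.tensorLift (S.mulBil.pre m₁.snd m₂.snd)
  fac := GrAlg.tensor_linHom_ext fun {i j n} h r s => by
    have e₁ : m₁.hom.app i r = m₁.snd.app i (m₁.fst.app i r) :=
      congrArg (fun t => GrMod.Hom.app t i r) m₁.fac
    have e₂ : m₂.hom.app j s = m₂.snd.app j (m₂.fst.app j s) :=
      congrArg (fun t => GrMod.Hom.app t j s) m₂.fac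
    refine (GrAlg.lift_tm m₁.hom m₂.hom h r s).trans ?_
    rw [e₁, e₂]
    refine Eq.symm ((congrArg ((GrMod.tensorLift (S.mulBil.pre m₁.snd m₂.snd)).app n)
      (GrAlg.desc_tm ((GrMod.tmulBil m₁.mid m₂.mid).pre m₁.fst m₂.fst) h r s)).trans ?_)
    exact GrMod.tensorLift_tmul _ h _ _

/-- The pro-isomorphism exists only between pro-modules, so the representing algebras themselves
need not be flat. Composing it with its inverse shows that some transition map of algebras factors,
as a linear map, through a flat module. Two elements are treated by tensoring the two algebras,
hence also the two flat modules. -/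
lemma IsProFlatSch.flatCovered {F : GrAlg k ⥤ GrMod l} (h : IsProFlatSch F) :
    FlatCovered (GrAlg.forget k) F := by
  have key : ∀ {S : GrAlg k} {j : ℤ} (y : (F.obj S).carrier j), ∃ (S' : GrAlg k)
      (m : FlatMap (GrAlg.forget k) S' S) (t : (F.obj S').carrier j),
      (F.map m.hom).app j t = y := by
    intro S j y
    obtain ⟨I, _, _, A, ⟨J, _, _, B, hB, ⟨σ⟩⟩, ⟨τ⟩⟩ := h j
    have hA := (isProRep_proHom A).of_iso τ
    have hA' := isProRep_proHom (A ⋙ GrAlg.forget k)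
    have hB' := (isProRep_proHom B).of_iso σ.symm
    obtain ⟨i, g, hg⟩ := hA.surj (M := S) y
    obtain ⟨b, p, hp⟩ := hB'.surj (proHomElt (A ⋙ GrAlg.forget k) i)
    obtain ⟨i', q, hq⟩ := hA'.surj (σ.symm.hom.app (B.obj b) (proHomElt B b))
    -- `p : B b → A i` and `q : A i' → B b` represent the pro-isomorphism and its inverse at the
    -- index `i`. So `q ≫ p` and the transition map agree after a further transition.
    have e := hA'.eq ((A ⋙ GrAlg.forget k).map (IsCofiltered.minToLeft i i'))
      ((A ⋙ GrAlg.forget k).map (IsCofiltered.minToRight i i') ≫ q ≫ p) (by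
        rw [hA'.map_elt, Functor.map_comp, ConcreteCategory.comp_apply, hA'.map_elt,
          Functor.map_comp, ConcreteCategory.comp_apply, hq, hp])
    obtain ⟨i'', t, ht⟩ := e
    let s : i'' ⟶ i := t ≫ IsCofiltered.minToLeft i i'
    let s' : i'' ⟶ i' := t ≫ IsCofiltered.minToRight i i'
    let m : FlatMap (GrAlg.forget k) (A.obj i'') (A.obj i) :=
      ⟨A.map s, B.obj b, hB b, (A ⋙ GrAlg.forget k).map s' ≫ q, p, by
        refine ((A ⋙ GrAlg.forget k).map_comp t _).trans (ht.trans ?_)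
        rw [(A ⋙ GrAlg.forget k).map_comp]
        simp only [Category.assoc]⟩
    refine ⟨A.obj i'', m.comp g, τ.hom.app _ (proHomElt A i''), Eq.trans ?_ hg⟩
    exact (map_comp_app F (A.map s) g j _).symm.trans (congrArg ((F.map g).app j) (hA.map_elt s))
  intro S j y y'
  obtain ⟨S₁, m₁, t₁, rfl⟩ := key y
  obtain ⟨S₂, m₂, t₂, rfl⟩ := key y'
  refine ⟨_, m₁.tensor m₂, (F.map (GrAlg.inL S₁ S₂)).app j t₁, (F.map (GrAlg.inR S₁ S₂)).app j t₂,
    ?_, ?_⟩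
  · rw [map_comp_app]
    exact congrArg (fun t => GrMod.Hom.app (F.map t) j t₁) (GrAlg.inL_lift _ _)
  · rw [map_comp_app]
    exact congrArg (fun t => GrMod.Hom.app (F.map t) j t₂) (GrAlg.inR_lift _ _)

end proFlat

/-! ### The pairings `𝒫 × 𝒬` and `𝒬 × 𝒫`, and gluing over the pushout. -/

section factorization

variable {k l : GrRing.{u}}

lemma BimodTensor.map_spec {B C B' C' : GrMod k ⥤ GrMod l} (T : BimodTensor B C)
    (T' : BimodTensor B' C') (σ : B ⟶ B') (τ : C ⟶ C') :
    T.pairing.post (T.map T' σ τ) = T'.pairing.pre σ τ :=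
  (T.universal T'.obj T'.formal (T'.pairing.pre σ τ)).choose_spec.1

lemma Pairing.post_post {B C D D' D'' : GrMod k ⥤ GrMod l} (p : Pairing B C D) (σ : D ⟶ D')
    (τ : D' ⟶ D'') : (p.post σ).post τ = p.post (σ ≫ τ) := rfl

lemma Pairing.pre_post {B C D B' C' D' : GrMod k ⥤ GrMod l} (p : Pairing B C D) (σ : B' ⟶ B)
    (τ : C' ⟶ C) (ρ : D ⟶ D') : (p.pre σ τ).post ρ = (p.post ρ).pre σ τ := rfl

/-- Pairings on `Q × P'` and `P × Q'` that agree on `Q × Q'` define a map on the pushout. -/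
lemma FormalPushout.exists_of_pairings {Q P Q' P' D : GrMod k ⥤ GrMod l} (c : Q ⟶ P) (c' : Q' ⟶ P')
    (QQ : BimodTensor Q Q') (QP : BimodTensor Q P') (PQ : BimodTensor P Q')
    (E : FormalPushout (QQ.map QP (𝟙 Q) c') (QQ.map PQ c (𝟙 Q'))) (hD : IsFormal D)
    (a : Pairing Q P' D) (b : Pairing P Q' D) (φ : Pairing Q Q' D) (ha : a.pre (𝟙 Q) c' = φ)
    (hb : b.pre c (𝟙 Q') = φ) :
    ∃ σ : E.obj ⟶ D, QP.pairing.post (E.inl ≫ σ) = a ∧ PQ.pairing.post (E.inr ≫ σ) = b ∧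
      QQ.pairing.post (QQ.map QP (𝟙 Q) c' ≫ E.inl ≫ σ) = φ := by
  obtain ⟨α, hα, -⟩ := QP.universal D hD a
  obtain ⟨β, hβ, -⟩ := PQ.universal D hD b
  have e₁ : QQ.pairing.post (QQ.map QP (𝟙 Q) c' ≫ α) = φ := by
    rw [← Pairing.post_post, BimodTensor.map_spec, Pairing.pre_post, hα, ha]
  have e₂ : QQ.pairing.post (QQ.map PQ c (𝟙 Q') ≫ β) = φ := by
    rw [← Pairing.post_post, BimodTensor.map_spec, Pairing.pre_post, hβ, hb]
  -- Both composites out of `𝒬 ⊗ 𝒬'` represent the pairing `φ`, so they are equal.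
  obtain ⟨σ, ⟨h₁, h₂⟩, -⟩ := E.universal D hD α β ((QQ.universal D hD φ).unique e₁ e₂)
  exact ⟨σ, by rw [h₁, hα], by rw [h₂, hβ], by rw [h₁, e₁]⟩

variable {F G H : GrAlg k ⥤ GrMod l}

/-- The pairing `𝒫(F) × 𝒬(G) → 𝒬(H)` given by a bilinear map `F × G → H`. -/
noncomputable def primIndec (P : Primitives F) (hH : IsFormal H) (hG : IsFormal G)
    (hQ : FlatCovered (𝟭 (GrMod k)) (indec G)) (b : SchBilin F G H) :
    Pairing P.obj (indec G) (indec H) :=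
  ((indecPair hH b).extend P hH.formal_indec hG.formal_indec hQ).toPairing

lemma primIndec_unit (P : Primitives F) (hH : IsFormal H) (hG : IsFormal G)
    (hQ : FlatCovered (𝟭 (GrMod k)) (indec G)) (b : SchBilin F G H) {R : GrAlg k} {Y Z : GrMod k}
    (f : BilinMap R.toMod Y Z) {i j n : ℤ} (h : i + j = n) (x : (F.obj R).carrier i)
    (y : ((indec G).obj Y).carrier j) :
    ((primIndec P hH hG hQ b).bil f).app h ((P.unit.app R).app i x) y =
      ((indecPair hH b).bil f).app h x y :=
  (indecPair hH b).extend_unit P hH.formal_indec hG.formal_indec hQ f h x y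

/-- `c_F` is `η` followed by the projection `k ⊕ X → X`, and the lax structure is built from
`indecPair` with the same projection; naturality of the extension identifies the two. -/
lemma primIndec_pre (P : Primitives F) (hH : IsFormal H) (hG : IsFormal G)
    (hQ : FlatCovered (𝟭 (GrMod k)) (indec G)) (b : SchBilin F G H) :
    (primIndec P hH hG hQ b).pre P.fromIndec (𝟙 _) = laxPairing hH b :=
  Pairing.ext_app fun {X Y Z} f {i j n} h x y => by
    refine Eq.trans ?_ (primIndec_unit P hH hG hQ b
      (f.pre (GrAlg.sqZeroSnd X) (𝟙 Y)) h x.1 y)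
    refine Eq.trans ?_ ((primIndec P hH hG hQ b).toMPair.bil_pre (X' := X) (Y' := Y) f
      (GrAlg.sqZeroSnd X) (𝟙 Y) h ((P.unit.app (GrAlg.sqZero X)).app i x.1) y).symm
    exact congrArg (((primIndec P hH hG hQ b).bil f).app h _) (map_id_app (indec G) _ _ y).symm

/-- The previous statement for the swapped bilinear map, together with the symmetry of the lax
structure. -/
lemma primIndec_flip_pre (P : Primitives G) (hH : IsFormal H) (hF : IsFormal F)
    (hQ : FlatCovered (𝟭 (GrMod k)) (indec F)) (b : SchBilin F G H) :
    (primIndec P hH hF hQ b.flip).flip.pre (𝟙 _) P.fromIndec = laxPairing hH b :=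
  Pairing.ext_app fun {X Y Z} f {i j n} h x y => by
    rw [laxPairing_flip hH b f h ((add_comm j i).trans h), ← primIndec_pre P hH hF hQ b.flip]
    rfl

end factorization

/-! ### Associativity of pairings, compared in triple tensor products. -/

section associativity

variable {k l : GrRing.{u}}

/-- Associativity `(x y) w = x (y w)` for four bilinear maps. -/
def BilinMap.Assoc {X Y W XY YW Z : GrMod k} (f : BilinMap X Y XY) (g : BilinMap XY W Z)
    (f' : BilinMap Y W YW) (g' : BilinMap X YW Z) : Prop :=
  ∀ {i j m ij jm n : ℤ} (h₁ : i + j = ij) (h₂ : ij + m = n) (h₃ : j + m = jm) (h₄ : i + jm = n)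
    (x : X.carrier i) (y : Y.carrier j) (w : W.carrier m),
    g.app h₂ (f.app h₁ x y) w = g'.app h₄ x (f'.app h₃ y w)

/-- Reversing the order of three factors exchanges the two bracketings and costs the same Koszul
sign in both. -/
lemma BilinMap.Assoc.flip {X Y W XY YW Z : GrMod k} {f : BilinMap X Y XY} {g : BilinMap XY W Z}
    {f' : BilinMap Y W YW} {g' : BilinMap X YW Z} (h : f.Assoc g f' g') :
    f'.flip.Assoc g'.flip f.flip g.flip := by
  intro i j m ij jm n h₁ h₂ h₃ h₄ x y w
  subst h₁ h₃
  rw [BilinMap.flip_app _ h₂ (show m + (i + j) = n by omega),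
    BilinMap.flip_app f' rfl (add_comm j i), BilinMap.flip_app _ h₄ (show j + m + i = n by omega),
    BilinMap.flip_app f rfl (add_comm m j), BilinMap.sign_right, BilinMap.sign_left,
    smul_smul, smul_smul, ← Int.negOnePow_add, ← Int.negOnePow_add]
  have := h (add_comm m j) (show j + m + i = n by omega) (add_comm j i)
    (show m + (i + j) = n by omega) w y x
  rw [this]
  congr 2
  ring

lemma assoc_tmulBil (X Y W : GrMod k) : (GrMod.tmulBil X Y).Assoc (GrMod.tmulBil (X.tensor Y) W)
    (GrMod.tmulBil Y W) (GrMod.assocBil X Y W) :=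
  fun h₁ h₂ h₃ h₄ x y w => (GrMod.assocBil_tmul h₁ h₂ h₃ h₄ x y w).symm

lemma BilinMap.Assoc.pre {X Y W XY YW Z X' Y' W' : GrMod k} {f : BilinMap X Y XY}
    {g : BilinMap XY W Z} {f' : BilinMap Y W YW} {g' : BilinMap X YW Z} (h : f.Assoc g f' g')
    (a : X' ⟶ X) (b : Y' ⟶ Y) (c : W' ⟶ W) :
    (f.pre a b).Assoc (g.pre (𝟙 _) c) (f'.pre b c) (g'.pre a (𝟙 _)) :=
  fun h₁ h₂ h₃ h₄ _ _ _ => h h₁ h₂ h₃ h₄ _ _ _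

variable {I J L : Type (u + 1)} [Category.{u} I] [Category.{u} J] [Category.{u} L]
  {V : I ⥤ GrMod k} {U : J ⥤ GrMod k} {W : L ⥤ GrMod k} {A : I ⥤ GrMod l} {B : J ⥤ GrMod l}
  {C : L ⥤ GrMod l} {AB BC D : GrMod k ⥤ GrMod l}

/-- Associativity for four families of bilinear maps. -/
def MPair.Assoc (p : MPair V U A B AB) (q : MPair (𝟭 (GrMod k)) W AB C D) (p' : MPair U W B C BC)
    (q' : MPair V (𝟭 (GrMod k)) A BC D) : Prop :=
  ∀ ⦃X : I⦄ ⦃Y : J⦄ ⦃T : L⦄ ⦃XY YT Z : GrMod k⦄ (f : BilinMap (V.obj X) (U.obj Y) XY)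
    (g : BilinMap XY (W.obj T) Z) (f' : BilinMap (U.obj Y) (W.obj T) YT)
    (g' : BilinMap (V.obj X) YT Z), f.Assoc g f' g' →
    (p.bil f).Assoc (q.bil (X := XY) g) (p'.bil f') (q'.bil (Y := YT) g')

lemma MPair.Assoc.flip {p : MPair V U A B AB} {q : MPair (𝟭 (GrMod k)) W AB C D}
    {p' : MPair U W B C BC} {q' : MPair V (𝟭 (GrMod k)) A BC D} (h : p.Assoc q p' q') :
    p'.flip.Assoc q'.flip p.flip q.flip :=
  fun _ _ _ _ _ _ f g f' g' e =>
    BilinMap.Assoc.flip (h f'.flip g'.flip f.flip g.flip (BilinMap.Assoc.flip e))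

lemma MPair.Assoc.of_flip {p : MPair V U A B AB} {q : MPair (𝟭 (GrMod k)) W AB C D}
    {p' : MPair U W B C BC} {q' : MPair V (𝟭 (GrMod k)) A BC D}
    (h : p'.flip.Assoc q'.flip p.flip q.flip) : p.Assoc q p' q' := by
  intro X Y T XY YT Z f g f' g' e
  have : (p.flip.flip.bil f).Assoc (q.flip.flip.bil (X := XY) g) (p'.flip.flip.bil f')
      (q'.flip.flip.bil (Y := YT) g') := MPair.Assoc.flip h f g f' g' e
  rwa [flip_flip_bil, flip_flip_bil, flip_flip_bil, flip_flip_bil] at this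

section triple

variable (p : MPair V U A B AB) (q : MPair (𝟭 (GrMod k)) W AB C D) (p' : MPair U W B C BC)
  (q' : MPair V (𝟭 (GrMod k)) A BC D) {X X' : I} {Y Y' : J} {T T' : L}
  {M N Q M' N' Q' : GrMod k}

/-- The product `(a b) c`, in a triple tensor product. -/
def triLeft (x : V.obj X ⟶ M) (y : U.obj Y ⟶ N) (z : W.obj T ⟶ Q) {i j m ij n : ℤ}
    (h₁ : i + j = ij) (h₂ : ij + m = n) (a : (A.obj X).carrier i) (b : (B.obj Y).carrier j)
    (c : (C.obj T).carrier m) : (D.obj ((M.tensor N).tensor Q)).carrier n :=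
  (q.bil (X := M.tensor N) ((GrMod.tmulBil (M.tensor N) Q).pre (𝟙 _) z)).app h₂
    ((p.bil ((GrMod.tmulBil M N).pre x y)).app h₁ a b) c

/-- The product `a (b c)`, in a triple tensor product. -/
def triRight (x : V.obj X ⟶ M) (y : U.obj Y ⟶ N) (z : W.obj T ⟶ Q) {i j m jm n : ℤ}
    (h₃ : j + m = jm) (h₄ : i + jm = n) (a : (A.obj X).carrier i) (b : (B.obj Y).carrier j)
    (c : (C.obj T).carrier m) : (D.obj ((M.tensor N).tensor Q)).carrier n :=
  (q'.bil (Y := N.tensor Q) ((GrMod.assocBil M N Q).pre x (𝟙 _))).app h₄ a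
    ((p'.bil ((GrMod.tmulBil N Q).pre y z)).app h₃ b c)

/-- A bracketed product is the image of one in `D((M ⊗ N) ⊗ Q)`, for any modules through which the
three arguments factor. Together with `triRight_lift` this places both bracketings in the same
group, with flat `M`, `N` or `Q` when needed. -/
lemma triLeft_lift {XY Z : GrMod k} (f : BilinMap (V.obj X') (U.obj Y') XY)
    (g : BilinMap XY (W.obj T') Z) (α : X ⟶ X') (β : Y ⟶ Y') (γ : T ⟶ T') {x : V.obj X ⟶ M}
    {y : U.obj Y ⟶ N} {z : W.obj T ⟶ Q} (x' : M ⟶ V.obj X') (y' : N ⟶ U.obj Y') (z' : Q ⟶ W.obj T')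
    (hx : V.map α = x ≫ x') (hy : U.map β = y ≫ y') (hz : W.map γ = z ≫ z') {i j m ij n : ℤ}
    (h₁ : i + j = ij) (h₂ : ij + m = n) (a : (A.obj X).carrier i) (b : (B.obj Y).carrier j)
    (c : (C.obj T).carrier m) :
    (D.map (GrMod.tensorLift (g.pre (GrMod.tensorLift (f.pre x' y')) z'))).app n
        (triLeft p q x y z h₁ h₂ a b c) =
      (q.bil (X := XY) g).app h₂ ((p.bil f).app h₁ ((A.map α).app i a) ((B.map β).app j b))
        ((C.map γ).app m c) := by
  have e₁ := p.natural ((GrMod.tmulBil M N).pre x y) f α β (GrMod.tensorLift (f.pre x' y')) (by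
    ext i j n h r s
    rw [hx, hy]
    exact GrMod.tensorLift_tmul _ h _ _) h₁ a b
  rw [← e₁]
  refine q.natural (X := M.tensor N) (X' := XY) _ g (GrMod.tensorLift (f.pre x' y')) γ _ ?_ h₂ _ c
  ext i j n h r s
  rw [hz]
  exact GrMod.tensorLift_tmul _ h _ _

lemma triRight_lift {XY YT Z : GrMod k} (f : BilinMap (V.obj X') (U.obj Y') XY)
    (g : BilinMap XY (W.obj T') Z) (f' : BilinMap (U.obj Y') (W.obj T') YT)
    (g' : BilinMap (V.obj X') YT Z) (hf : f.Assoc g f' g') (α : X ⟶ X') (β : Y ⟶ Y') (γ : T ⟶ T')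
    {x : V.obj X ⟶ M} {y : U.obj Y ⟶ N} {z : W.obj T ⟶ Q} (x' : M ⟶ V.obj X') (y' : N ⟶ U.obj Y')
    (z' : Q ⟶ W.obj T') (hx : V.map α = x ≫ x') (hy : U.map β = y ≫ y') (hz : W.map γ = z ≫ z')
    {i j m jm n : ℤ} (h₃ : j + m = jm) (h₄ : i + jm = n) (a : (A.obj X).carrier i)
    (b : (B.obj Y).carrier j) (c : (C.obj T).carrier m) :
    (D.map (GrMod.tensorLift (g.pre (GrMod.tensorLift (f.pre x' y')) z'))).app n
        (triRight p' q' x y z h₃ h₄ a b c) =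
      (q'.bil (Y := YT) g').app h₄ ((A.map α).app i a)
        ((p'.bil f').app h₃ ((B.map β).app j b) ((C.map γ).app m c)) := by
  have e₁ := p'.natural ((GrMod.tmulBil N Q).pre y z) f' β γ (GrMod.tensorLift (f'.pre y' z')) (by
    ext i j n h r s
    rw [hy, hz]
    exact GrMod.tensorLift_tmul _ h _ _) h₃ b c
  rw [← e₁]
  refine q'.natural (Y := N.tensor Q) (Y' := YT) _ g' α (GrMod.tensorLift (f'.pre y' z')) _ ?_ h₄ a _
  ext i j n h r s
  rw [hx]
  change (GrMod.tensorLift _).app n ((GrMod.assocBil M N Q).app h (x.app i r) s) =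
    g'.app h (x'.app i (x.app i r)) ((GrMod.tensorLift (f'.pre y' z')).app j s)
  -- Associativity of the given bilinear maps is what makes the map used for the left bracketing
  -- work for the right one too; it is checked on pure tensors.
  induction s using GrMod.tensor_induction with
  | @tmul j₁ j₂ hj s t =>
    rw [GrMod.assocBil_tmul rfl (show i + j₁ + j₂ = n by omega), GrMod.tensorLift_tmul,
      GrMod.tensorLift_tmul]
    refine (congrArg (fun v => g.app _ v (z'.app j₂ t))
      (GrMod.tensorLift_tmul (f.pre x' y') rfl _ s)).trans ?_
    exact hf rfl _ hj h _ _ _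
  | add t t' ht ht' => rw [BilinMap.add_right, map_add, map_add, ht, ht', BilinMap.add_right]

end triple

end associativity

/-! ### Reducing associativity to the image of the universal map, one argument at a time. -/

section associativityReduction

variable {k l : GrRing.{u}}

variable {I J L : Type (u + 1)} [Category.{u} I] [Category.{u} J] [Category.{u} L]
  {V : I ⥤ GrMod k} {U : J ⥤ GrMod k} {W : L ⥤ GrMod k} {A : I ⥤ GrMod l} {B : J ⥤ GrMod l}
  {C : L ⥤ GrMod l} {AB BC D : GrMod k ⥤ GrMod l}

section triple

variable (p : MPair V U A B AB) (q : MPair (𝟭 (GrMod k)) W AB C D) (p' : MPair U W B C BC)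
  (q' : MPair V (𝟭 (GrMod k)) A BC D) {X X' : I} {Y Y' : J} {T T' : L}
  {M N Q M' N' Q' : GrMod k}

lemma triLeft_map (α : X ⟶ X') (β : Y ⟶ Y') (γ : T ⟶ T') {x : V.obj X ⟶ M} {y : U.obj Y ⟶ N}
    {z : W.obj T ⟶ Q} {x' : V.obj X' ⟶ M'} {y' : U.obj Y' ⟶ N'} {z' : W.obj T' ⟶ Q'} (u : M ⟶ M')
    (v : N ⟶ N') (w : Q ⟶ Q') (hx : V.map α ≫ x' = x ≫ u) (hy : U.map β ≫ y' = y ≫ v)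
    (hz : W.map γ ≫ z' = z ≫ w) {i j m ij n : ℤ} (h₁ : i + j = ij) (h₂ : ij + m = n)
    (a : (A.obj X).carrier i) (b : (B.obj Y).carrier j) (c : (C.obj T).carrier m) :
    (D.map (GrMod.tensorHom (GrMod.tensorHom u v) w)).app n (triLeft p q x y z h₁ h₂ a b c) =
      triLeft p q x' y' z' h₁ h₂ ((A.map α).app i a) ((B.map β).app j b) ((C.map γ).app m c) := by
  have hx' := fun i r => congrArg (fun t => GrMod.Hom.app t i r) hx
  have hy' := fun i r => congrArg (fun t => GrMod.Hom.app t i r) hy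
  have hz' := fun i r => congrArg (fun t => GrMod.Hom.app t i r) hz
  have e₁ := p.natural ((GrMod.tmulBil M N).pre x y) ((GrMod.tmulBil M' N').pre x' y') α β
    (GrMod.tensorHom u v) (by
      ext i j n h r s
      refine (GrMod.tensorHom_tmul u v h _ _).trans ?_
      exact (congrArg₂ (GrMod.tmul h) (hx' i r) (hy' j s)).symm) h₁ a b
  rw [triLeft, triLeft, ← e₁]
  refine q.natural (X := M.tensor N) (X' := M'.tensor N') _ _ (GrMod.tensorHom u v) γ _ ?_ h₂ _ c
  ext i j n h r s
  refine (GrMod.tensorHom_tmul _ w h _ _).trans ?_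
  exact (congrArg (GrMod.tmul h _) (hz' j s)).symm

lemma triRight_map (α : X ⟶ X') (β : Y ⟶ Y') (γ : T ⟶ T') {x : V.obj X ⟶ M} {y : U.obj Y ⟶ N}
    {z : W.obj T ⟶ Q} {x' : V.obj X' ⟶ M'} {y' : U.obj Y' ⟶ N'} {z' : W.obj T' ⟶ Q'} (u : M ⟶ M')
    (v : N ⟶ N') (w : Q ⟶ Q') (hx : V.map α ≫ x' = x ≫ u) (hy : U.map β ≫ y' = y ≫ v)
    (hz : W.map γ ≫ z' = z ≫ w) {i j m jm n : ℤ} (h₃ : j + m = jm) (h₄ : i + jm = n)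
    (a : (A.obj X).carrier i) (b : (B.obj Y).carrier j) (c : (C.obj T).carrier m) :
    (D.map (GrMod.tensorHom (GrMod.tensorHom u v) w)).app n (triRight p' q' x y z h₃ h₄ a b c) =
      triRight p' q' x' y' z' h₃ h₄ ((A.map α).app i a) ((B.map β).app j b)
        ((C.map γ).app m c) := by
  have hx' := fun i r => congrArg (fun t => GrMod.Hom.app t i r) hx
  have hy' := fun i r => congrArg (fun t => GrMod.Hom.app t i r) hy
  have hz' := fun i r => congrArg (fun t => GrMod.Hom.app t i r) hz
  have e₁ := p'.natural ((GrMod.tmulBil N Q).pre y z) ((GrMod.tmulBil N' Q').pre y' z') β γ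
    (GrMod.tensorHom v w) (by
      ext i j n h r s
      refine (GrMod.tensorHom_tmul v w h _ _).trans ?_
      exact (congrArg₂ (GrMod.tmul h) (hy' i r) (hz' j s)).symm) h₃ b c
  rw [triRight, triRight, ← e₁]
  refine q'.natural (Y := N.tensor Q) (Y' := N'.tensor Q') _ _ α (GrMod.tensorHom v w) _ ?_ h₄ a _
  ext i j n h r s
  change (GrMod.tensorHom (GrMod.tensorHom u v) w).app n ((GrMod.assocBil M N Q).app h
    (x.app i r) s) = (GrMod.assocBil M' N' Q').app h (x'.app i ((V.map α).app i r))
      ((GrMod.tensorHom v w).app j s)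
  rw [show x'.app i ((V.map α).app i r) = u.app i (x.app i r) from hx' i r]
  induction s using GrMod.tensor_induction with
  | @tmul j₁ j₂ hj s t =>
    rw [GrMod.assocBil_tmul rfl (show i + j₁ + j₂ = n by omega), GrMod.tensorHom_tmul,
      GrMod.tensorHom_tmul, GrMod.tensorHom_tmul,
      GrMod.assocBil_tmul rfl (show i + j₁ + j₂ = n by omega)]
  | add t t' ht ht' => rw [BilinMap.add_right, map_add, map_add, ht, ht', BilinMap.add_right]

end triple

section left

variable {G : GrAlg k ⥤ GrMod l} (P : Primitives G) (p : MPair (𝟭 (GrMod k)) U P.obj B AB)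
  (q : MPair (𝟭 (GrMod k)) W AB C D) (p' : MPair U W B C BC)
  (q' : MPair (𝟭 (GrMod k)) (𝟭 (GrMod k)) P.obj BC D) {Y : J} {T : L} {N Q : GrMod k}

/-- The product `(a b) c`, as a function of `a`. -/
def triLeftFst (y : U.obj Y ⟶ N) (z : W.obj T ⟶ Q) {j m : ℤ} (b : (B.obj Y).carrier j)
    (c : (C.obj T).carrier m) :
    DegNat P.obj (GrMod.tensorRight N ⋙ GrMod.tensorRight Q ⋙ D) (j + m) 0 where
  app X i := AddMonoidHom.mk'
    (fun a => triLeft p q (X := X) (𝟙 X) y z rfl (add_assoc i j m) a b c) (fun a a' => by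
      rw [triLeft, BilinMap.add_left, BilinMap.add_left]; rfl)
  map_smul X d i n h h' a x := by
    rw [mul_zero, Int.negOnePow_zero, one_smul]
    refine (congrArg (fun t => BilinMap.app _ _ t c)
      (BilinMap.smul_left _ h rfl rfl (by omega) a x b)).trans ?_
    exact BilinMap.smul_left _ _ _ _ h' a _ c
  natural {X X'} f i a := by
    refine (triLeft_map p q (X := X) (X' := X') f (𝟙 Y) (𝟙 T) (x' := 𝟙 X') (y' := y) (z' := z) f
      (𝟙 N) (𝟙 Q) rfl (by rw [U.map_id]; rfl) (by rw [W.map_id]; rfl) rfl _ a b c).trans ?_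
    rw [map_id_app, map_id_app]
    rfl

/-- The product `a (b c)`, as a function of `a`. -/
def triRightFst (y : U.obj Y ⟶ N) (z : W.obj T ⟶ Q) {j m : ℤ} (b : (B.obj Y).carrier j)
    (c : (C.obj T).carrier m) :
    DegNat P.obj (GrMod.tensorRight N ⋙ GrMod.tensorRight Q ⋙ D) (j + m) 0 where
  app X i := AddMonoidHom.mk'
    (fun a => triRight p' q' (X := X) (𝟙 X) y z rfl rfl a b c) (fun a a' =>
      BilinMap.add_left _ _ _ _ _)
  map_smul X d i n h h' a x := by
    rw [mul_zero, Int.negOnePow_zero, one_smul]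
    exact BilinMap.smul_left _ _ _ _ h' a _ _
  natural {X X'} f i a := by
    refine (triRight_map p' q' (X := X) (X' := X') f (𝟙 Y) (𝟙 T) (x' := 𝟙 X') (y' := y) (z' := z) f
      (𝟙 N) (𝟙 Q) rfl (by rw [U.map_id]; rfl) (by rw [W.map_id]; rfl) rfl _ a b c).trans ?_
    rw [map_id_app, map_id_app]
    rfl

variable {P p q p' q'}

/-- Associativity may be checked on the image of `G → 𝒫(G)` in the first argument. -/
lemma MPair.Assoc.of_restr_fst (hD : IsFormal D) (hB : FlatCovered U B) (hC : FlatCovered W C)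
    (h : (p.restr P).Assoc q p' (q'.restr P)) : p.Assoc q p' q' := by
  intro X Y T XY YT Z f g f' g' e i j m ij jm n h₁ h₂ h₃ h₄ a b c
  obtain ⟨Y', β, b, rfl⟩ := hB.cover b
  obtain ⟨T', γ, c, rfl⟩ := hC.cover c
  have e₁ := triLeft_lift p q (X := X) (X' := X) f g (𝟙 X) β.hom γ.hom (x := 𝟙 X) (𝟙 X) β.snd
    γ.snd rfl β.fac γ.fac h₁ h₂ a b c
  have e₂ := triRight_lift p' q' (X := X) (X' := X) f g f' g' e (𝟙 X) β.hom γ.hom (x := 𝟙 X) (𝟙 X)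
    β.snd γ.snd rfl β.fac γ.fac h₃ h₄ a b c
  rw [map_id_app] at e₁ e₂
  refine e₁.symm.trans (Eq.trans (congrArg _ ?_) e₂)
  subst h₁ h₃ h₄
  -- With `b` and `c` held over flat modules, both bracketings are natural in `a` with values in a
  -- formal bimodule.
  refine P.degNat_ext ((hD.tensorRight γ.flat).tensorRight β.flat)
    (triLeftFst P p q β.fst γ.fst b c) (triRightFst P p' q' β.fst γ.fst b c) (fun R i x => ?_) X i a
  exact h _ _ _ _ (BilinMap.Assoc.pre (assoc_tmulBil R.toMod β.mid γ.mid) (𝟙 _) β.fst γ.fst) rfl _ rfl rfl x b c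

end left

section middle

variable {G : GrAlg k ⥤ GrMod l} (P : Primitives G) (p : MPair V (𝟭 (GrMod k)) A P.obj AB)
  (q : MPair (𝟭 (GrMod k)) W AB C D) (p' : MPair (𝟭 (GrMod k)) W P.obj C BC)
  (q' : MPair V (𝟭 (GrMod k)) A BC D) {X : I} {T : L} {M Q : GrMod k}

/-- The restriction of a pairing along the universal map `G → 𝒫(G)`, in the right argument. -/
def MPair.restrRight (p : MPair V (𝟭 (GrMod k)) A P.obj D) :
    MPair V (GrAlg.forget k) A G D where
  bil {X R Z} f := (p.bil (Y := R.toMod) f).pre (𝟙 _) (P.unit.app R)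
  natural {X X' R R' Z Z'} f f' u v w e i j n h x y := by
    refine (p.natural (Y := R.toMod) (Y' := R'.toMod) f f' u (GrAlg.lin v) w e h _ _).trans ?_
    exact congrArg ((p.bil (Y := R'.toMod) f').app h _) (nat_app P.unit v j y).symm

/-- The product `(a b) c`, as a function of `b`. -/
def triLeftSnd (x : V.obj X ⟶ M) (z : W.obj T ⟶ Q) {i m : ℤ} (a : (A.obj X).carrier i)
    (c : (C.obj T).carrier m) :
    DegNat P.obj (GrMod.tensorLeft M ⋙ GrMod.tensorRight Q ⋙ D) (i + m) i where
  app Y j := AddMonoidHom.mk'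
    (fun b => triLeft p q (Y := Y) x (𝟙 Y) z rfl (show i + j + m = j + (i + m) by omega) a b c)
    (fun b b' => by
      rw [triLeft, BilinMap.add_right, BilinMap.add_left]; rfl)
  map_smul Y d j n h h' r b := by
    -- The scalar `r` has to pass the fixed element `a` of degree `i`, which is the reason for the
    -- sign twist `i`.
    refine (congrArg (fun t => BilinMap.app _ _ t c)
      (BilinMap.smul_right _ h rfl rfl (show d + (i + j) = i + n by omega) r a b)).trans ?_
    refine (BilinMap.sign_left _ _ _ _ _).trans (congrArg _ ?_)
    exact BilinMap.smul_left _ _ _ _ h' r _ c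
  natural {Y Y'} f j b := by
    refine (triLeft_map p q (Y := Y) (Y' := Y') (𝟙 X) f (𝟙 T) (x' := x) (y' := 𝟙 Y') (z' := z) (𝟙 M)
      f (𝟙 Q) (by rw [V.map_id]; rfl) rfl (by rw [W.map_id]; rfl) rfl _ a b c).trans ?_
    rw [map_id_app, map_id_app]
    rfl

/-- The product `a (b c)`, as a function of `b`. -/
def triRightSnd (x : V.obj X ⟶ M) (z : W.obj T ⟶ Q) {i m : ℤ} (a : (A.obj X).carrier i)
    (c : (C.obj T).carrier m) :
    DegNat P.obj (GrMod.tensorLeft M ⋙ GrMod.tensorRight Q ⋙ D) (i + m) i where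
  app Y j := AddMonoidHom.mk'
    (fun b => triRight p' q' (Y := Y) x (𝟙 Y) z rfl (show i + (j + m) = j + (i + m) by omega) a b c)
    (fun b b' => by
      rw [triRight, BilinMap.add_left, BilinMap.add_right]; rfl)
  map_smul Y d j n h h' r b := by
    refine (congrArg (BilinMap.app _ _ a)
      (BilinMap.smul_left _ h rfl rfl (show d + (j + m) = n + m by omega) r b c)).trans ?_
    exact BilinMap.smul_right _ _ _ _ h' r a _
  natural {Y Y'} f j b := by
    refine (triRight_map p' q' (Y := Y) (Y' := Y') (𝟙 X) f (𝟙 T) (x' := x) (y' := 𝟙 Y') (z' := z)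
      (𝟙 M) f (𝟙 Q) (by rw [V.map_id]; rfl) rfl (by rw [W.map_id]; rfl) rfl _ a b c).trans ?_
    rw [map_id_app, map_id_app]
    rfl

variable {P p q p' q'}

/-- Associativity may be checked on the image of `G → 𝒫(G)` in the second argument. -/
lemma MPair.Assoc.of_restr_snd (hD : IsFormal D) (hA : FlatCovered V A) (hC : FlatCovered W C)
    (h : (p.restrRight P).Assoc q (p'.restr P) q') : p.Assoc q p' q' := by
  intro X Y T XY YT Z f g f' g' e i j m ij jm n h₁ h₂ h₃ h₄ a b c
  obtain ⟨X', α, a, rfl⟩ := hA.cover a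
  obtain ⟨T', γ, c, rfl⟩ := hC.cover c
  have e₁ := triLeft_lift p q (Y := Y) (Y' := Y) f g α.hom (𝟙 Y) γ.hom (y := 𝟙 Y) α.snd (𝟙 Y)
    γ.snd α.fac rfl γ.fac h₁ h₂ a b c
  have e₂ := triRight_lift p' q' (Y := Y) (Y' := Y) f g f' g' e α.hom (𝟙 Y) γ.hom (y := 𝟙 Y) α.snd
    (𝟙 Y) γ.snd α.fac rfl γ.fac h₃ h₄ a b c
  rw [map_id_app] at e₁ e₂
  refine e₁.symm.trans (Eq.trans (congrArg _ ?_) e₂)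
  obtain rfl : n = j + (i + m) := by omega
  subst h₁ h₃
  refine P.degNat_ext ((hD.tensorRight γ.flat).tensorLeft α.flat)
    (triLeftSnd P p q α.fst γ.fst a c) (triRightSnd P p' q' α.fst γ.fst a c) (fun R j x => ?_) Y j b
  exact h _ _ _ _ (BilinMap.Assoc.pre (assoc_tmulBil α.mid R.toMod γ.mid) α.fst (𝟙 _) γ.fst) rfl
    (by omega) rfl (by omega) a x c

end middle

/-- Associativity may be checked on the image of `G → 𝒫(G)` in the third argument. -/
lemma MPair.Assoc.of_restr_trd {G : GrAlg k ⥤ GrMod l} {P : Primitives G} {p : MPair V U A B AB}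
    {q : MPair (𝟭 (GrMod k)) (𝟭 (GrMod k)) AB P.obj D} {p' : MPair U (𝟭 (GrMod k)) B P.obj BC}
    {q' : MPair V (𝟭 (GrMod k)) A BC D} (hD : IsFormal D) (hA : FlatCovered V A)
    (hB : FlatCovered U B) (h : p.Assoc (q.restrRight P) (p'.restrRight P) q') :
    p.Assoc q p' q' :=
  -- Reversing the order turns the third argument into the first.
  MPair.Assoc.of_flip (MPair.Assoc.of_restr_fst hD hB hA (MPair.Assoc.flip h))

end associativityReduction

/-! ### The multiplication of the primitives. -/

section primAlgebra

variable {k l : GrRing.{u}}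

open GrAlg

/-- Pairings out of `𝒫(G) × 𝒫(G')` are determined by the image of `G × G'`. -/
lemma Pairing.ext_of_unit {G G' : GrAlg k ⥤ GrMod l} {D : GrMod k ⥤ GrMod l} (P : Primitives G)
    (P' : Primitives G') (hD : IsFormal D) (hG : FlatCovered (GrAlg.forget k) G)
    (hP' : FlatCovered (𝟭 (GrMod k)) P'.obj) {p q : Pairing P.obj P'.obj D}
    (h : ∀ {R S : GrAlg k} {Z : GrMod k} (f : BilinMap R.toMod S.toMod Z) {i j n : ℤ}
      (hn : i + j = n) (x : (G.obj R).carrier i) (y : (G'.obj S).carrier j),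
      (p.bil f).app hn ((P.unit.app R).app i x) ((P'.unit.app S).app j y) =
        (q.bil f).app hn ((P.unit.app R).app i x) ((P'.unit.app S).app j y)) : p = q := by
  refine Pairing.ext_app fun f i j n hn x y => ?_
  refine MPair.ext_of_restr P hD hP' p.toMPair q.toMPair (fun {R S Z} f i j n hn x y => ?_) f hn x y
  -- The first argument has been reduced to `G`. After a flip the second one is treated in the same
  -- way, now with flat covers of elements of `G`.
  have e := MPair.ext_of_restr P' hD hG (p.toMPair.restr P).flip (q.toMPair.restr P).flip
    (fun {S R Z} f i j n hn y x => ?_) (S := R) f.flip ((add_comm j i).trans hn) y x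
  · have e' : (j * i).negOnePow • ((p.toMPair.restr P).bil f.flip.flip).app hn x y =
      (j * i).negOnePow • ((q.toMPair.restr P).bil f.flip.flip).app hn x y := e
    rw [BilinMap.flip_flip] at e'
    exact (negOnePow_mul_self_smul (j * i) _).symm.trans ((congrArg
      (fun t => (j * i).negOnePow • t) e').trans (negOnePow_mul_self_smul (j * i) _))
  · exact congrArg (fun t => (i * j).negOnePow • t) (h f.flip ((add_comm j i).trans hn) x y)

variable {F : FormalAlgSch k l}

/-- The multiplication of a formal algebra scheme. -/
def FormalAlgSch.mulSch (F : FormalAlgSch k l) : SchBilin F.mod F.mod F.mod where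
  bil R := (F.functor.obj R).mulBil
  natural g _ _ _ h x y := (F.functor.map g).map_mul h x y

lemma FormalAlgSch.mulSch_flip (F : FormalAlgSch k l) : F.mulSch.flip = F.mulSch := by
  ext R i j n h x y
  exact ((F.functor.obj R).mul_comm h ((add_comm j i).trans h) x y).symm

lemma FormalAlgSch.bilin_post_mulMap (F : FormalAlgSch k l) (T : SchTensor F.mod F.mod) :
    T.bilin.post (F.mulMap T) = F.mulSch :=
  (T.universal F.mod F.formal F.mulSch).choose_spec.1

variable (P : Primitives F.mod)

/-- The pairings `F(R) × F(S) → 𝒫(F)(Z)` given by the multiplication. -/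
def primPair : MPair (GrAlg.forget k) (GrAlg.forget k) F.mod F.mod P.obj where
  bil {R S _} f := ((((F.mulSch.bil (R.tensor S)).pre (F.mod.map (inL R S))
    (F.mod.map (inR R S))).post (P.unit.app (R.tensor S)))).post
      (P.obj.map (desc (R := R) (S := S) f))
  natural {R R' S S' Z Z'} f f' u v w e i j n h x y := by
    have e₁ : desc (R := R) (S := S) f ≫ w = lin (lift (u ≫ inL R' S') (v ≫ inR R' S')) ≫
        desc (R := R') (S := S') f' := by
      refine tensor_linHom_ext fun {i j n} h r s => ?_
      refine (congrArg (w.app n) (desc_tm (R := R) (S := S) f h r s)).trans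
        ((show w.app n (BilinMap.app f h r s) = f'.app h (u.app i r) (v.app j s) from
          congrArg (fun t : BilinMap R.toMod S.toMod Z' => t.app h r s) e).trans (Eq.symm ?_))
      refine (congrArg ((desc (R := R') (S := S') f').app n)
        (lift_tm (u ≫ inL R' S') (v ≫ inR R' S') h r s)).trans ?_
      refine (congrArg ((desc (R := R') (S := S') f').app n) (inL_mul_inR h _ _)).trans ?_
      exact desc_tm (R := R') (S := S') f' h _ _
    refine (map_comp_app P.obj _ w n _).trans ((congrArg (fun t => GrMod.Hom.app (P.obj.map t) n _)
      e₁).trans ((map_comp_app P.obj _ _ n _).symm.trans (congrArg _ ?_)))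
    refine (nat_app P.unit (lift (u ≫ inL R' S') (v ≫ inR R' S')) n _).symm.trans (congrArg _ ?_)
    refine (F.mulSch.natural _ h _ _).trans ?_
    rw [map_comp_app, map_comp_app, inL_lift, inR_lift, ← map_comp_app, ← map_comp_app]
    rfl

variable {P}

/-- A pairing of `𝒫(F)` with itself that is given by the multiplication of `F`. -/
def IsPrimMul (m : Pairing P.obj P.obj P.obj) : Prop :=
  ∀ (R : GrAlg k) {i j n : ℤ} (h : i + j = n) (x : (F.mod.obj R).carrier i)
    (y : (F.mod.obj R).carrier j),
    (m.bil R.mulBil).app h ((P.unit.app R).app i x) ((P.unit.app R).app j y) =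
      (P.unit.app R).app n ((F.mulSch.bil R).app h x y)

/-- The hypothesis concerns only the multiplication `C × C → C`, but a pairing is natural in its
bilinear map. This determines the product for every `f` that is the multiplication of some `C`,
restricted along `α`, `β` and followed by `w`. -/
lemma IsPrimMul.eq {m : Pairing P.obj P.obj P.obj} (hm : IsPrimMul m) {R S C : GrAlg k} {Z : GrMod k}
    (f : BilinMap R.toMod S.toMod Z) (α : R ⟶ C) (β : S ⟶ C) (w : C.toMod ⟶ Z)
    (hw : ∀ {i j n : ℤ} (h : i + j = n) (r : R.carrier i) (s : S.carrier j),
      w.app n (C.mul h (α.app i r) (β.app j s)) = f.app h r s) {i j n : ℤ} (h : i + j = n)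
    (x : (F.mod.obj R).carrier i) (y : (F.mod.obj S).carrier j) :
    (m.bil f).app h ((P.unit.app R).app i x) ((P.unit.app S).app j y) =
      (P.obj.map w).app n ((P.unit.app C).app n ((F.mulSch.bil C).app h ((F.mod.map α).app i x)
        ((F.mod.map β).app j y))) := by
  rw [← hm C h]
  refine Eq.symm ((m.toMPair.natural (X := C.toMod) (X' := C.toMod) C.mulBil (C.mulBil.post w)
    (𝟙 _) (𝟙 _) w rfl h _ _).trans ?_)
  have e : (C.mulBil.post w).pre (lin α) (lin β) = f := by
    ext i j n h r s
    exact hw h r s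
  refine Eq.trans ?_ ((m.toMPair.bil_pre (X := R.toMod) (Y := S.toMod) (X' := C.toMod)
    (Y' := C.toMod) (C.mulBil.post w) (lin α) (lin β) h ((P.unit.app R).app i x)
    ((P.unit.app S).app j y)).symm.trans ?_)
  · refine congrArg₂ ((m.bil (C.mulBil.post w)).app h) ?_ ?_
    · exact (map_id_app P.obj C.toMod i _).trans (nat_app P.unit α i x)
    · exact (map_id_app P.obj C.toMod j _).trans (nat_app P.unit β j y)
  · exact congrArg (fun t => (m.bil t).app h _ _) e

/-- Every bilinear map factors through the multiplication of `C = R ⊗ S`, so products of elements in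
the image of `η` are forced. This gives uniqueness. -/
lemma IsPrimMul.eq_desc {m : Pairing P.obj P.obj P.obj} (hm : IsPrimMul m) {R S : GrAlg k}
    {Z : GrMod k} (f : BilinMap R.toMod S.toMod Z) {i j n : ℤ} (h : i + j = n)
    (x : (F.mod.obj R).carrier i) (y : (F.mod.obj S).carrier j) :
    (m.bil f).app h ((P.unit.app R).app i x) ((P.unit.app S).app j y) =
      ((primPair P).bil f).app h x y :=
  hm.eq f (inL R S) (inR R S) (desc f) (fun h r s =>
    (congrArg ((desc f).app _) (inL_mul_inR h r s)).trans (desc_tm f h r s)) h x y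

variable (hF : FlatCovered (GrAlg.forget k) F.mod) (hP : FlatCovered (𝟭 (GrMod k)) P.obj)

variable (P) in
/-- The multiplication of `𝒫(F)`. -/
noncomputable def primMul : Pairing P.obj P.obj P.obj :=
  (((primPair P).extend P P.formal F.formal hF).flip.extend P P.formal P.formal hP).flip.toPairing

/-- On the image of `η` both extensions return the original pairing and the signs of the two flips
cancel. It remains to see that `R ⊗ R → R`, being an algebra map, carries `(x ⊗ 1)(1 ⊗ y)` to `x y`.
-/
lemma isPrimMul_primMul : IsPrimMul (primMul P hF hP) := by
  intro R i j n h x y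
  have e₁ : ((primMul P hF hP).bil R.mulBil).app h ((P.unit.app R).app i x)
      ((P.unit.app R).app j y) = ((primPair P).bil R.mulBil).app h x y := by
    refine (congrArg (fun t => (i * j).negOnePow • t) (MPair.extend_unit P P.formal
      ((primPair P).extend P P.formal F.formal hF).flip P.formal hP (R := R) (S := R.toMod)
      R.mulBil.flip ((add_comm j i).trans h) y ((P.unit.app R).app i x))).trans ?_
    refine (congrArg (fun t => (i * j).negOnePow • (j * i).negOnePow • t) ((congrArg
      (fun t => (((primPair P).extend P P.formal F.formal hF).bil (X := R.toMod) (Y := R) t).app h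
        ((P.unit.app R).app i x) y) R.mulBil.flip_flip).trans
      (MPair.extend_unit P P.formal (primPair P) F.formal hF R.mulBil h x y))).trans ?_
    rw [mul_comm j i, negOnePow_mul_self_smul]
  rw [e₁]
  change (P.obj.map (desc R.mulBil)).app n ((P.unit.app _).app n _) = _
  have e₂ : desc R.mulBil = lin (lift (𝟙 R) (𝟙 R)) :=
    tensor_linHom_ext fun h r s => (desc_tm _ h r s).trans (lift_tm (𝟙 R) (𝟙 R) h r s).symm
  rw [e₂]
  refine (nat_app P.unit (lift (𝟙 R) (𝟙 R)) n _).symm.trans (congrArg _ ?_)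
  refine (F.mulSch.natural _ h _ _).trans ?_
  rw [map_comp_app, map_comp_app, inL_lift, inR_lift, map_id_app, map_id_app]

include hF hP in
lemma IsPrimMul.unique {m m' : Pairing P.obj P.obj P.obj} (hm : IsPrimMul m) (hm' : IsPrimMul m') :
    m = m' :=
  Pairing.ext_of_unit P P P.formal hF hP fun f _ _ _ hn x y =>
    (hm.eq_desc f hn x y).trans (hm'.eq_desc f hn x y).symm

/-- Graded commutativity of `R` and of `F(R)`: the same signs appear on both sides. -/
lemma IsPrimMul.flip {m : Pairing P.obj P.obj P.obj} (hm : IsPrimMul m) : IsPrimMul m.flip := by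
  intro R i j n h x y
  have e : R.mulBil.flip = R.mulBil := by
    ext i j n h x y
    exact (R.mul_comm h ((add_comm j i).trans h) x y).symm
  change (i * j).negOnePow • (m.bil R.mulBil.flip).app _ _ _ = _
  rw [e]
  refine (congrArg (fun t => (i * j).negOnePow • t) (hm R ((add_comm j i).trans h) y x)).trans
    ((map_zsmul_unit _ _ _).symm.trans (congrArg _ ?_))
  exact ((F.functor.obj R).mul_comm h ((add_comm j i).trans h) x y).symm

end primAlgebra

/-! ### Left and right units under the flip. -/

section units

variable {k l : GrRing.{u}}

lemma GrMod.smulBilRight_flip (X : GrMod k) : X.smulBilRight.flip = X.smulBil := by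
  ext i j n h a x
  change (i * j).negOnePow • (i * j).negOnePow • X.smul _ a x = _
  rw [negOnePow_mul_self_smul]
  rfl

lemma IsLeftUnit.flip {A N : GrMod k ⥤ GrMod l} {e : (A.obj (GrAlg.base k).toMod).carrier 0}
    {p : Pairing A N N} (h : IsLeftUnit e p) : IsRightUnit e p.flip := by
  intro X n hn x
  change (n * 0).negOnePow • (p.bil X.smulBilRight.flip).app _ e x = x
  rw [GrMod.smulBilRight_flip, h, mul_zero, Int.negOnePow_zero, one_smul]

end units

/-! ### Inclusions into a triple tensor product of algebras. -/

section tripleTensor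

variable {k : GrRing.{u}}

namespace GrAlg

/-- The inclusion `S ⊗ T → (R ⊗ S) ⊗ T`. -/
def inRight (R S T : GrAlg k) : S.tensor T ⟶ (R.tensor S).tensor T :=
  lift (inR R S ≫ inL (R.tensor S) T) (inR (R.tensor S) T)

lemma inL_mul_inRight (R S T : GrAlg k) {i j m ij jm n : ℤ} (h₁ : i + j = ij) (h₂ : ij + m = n)
    (h₃ : j + m = jm) (h₄ : i + jm = n) (r : R.carrier i) (s : S.carrier j) (t : T.carrier m) :
    ((R.tensor S).tensor T).mul h₄ ((inL R S ≫ inL (R.tensor S) T).app i r)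
      ((inRight R S T).app jm (tm h₃ s t)) = tm h₂ (tm h₁ r s) t := by
  rw [inRight, lift_tm, ← ((R.tensor S).tensor T).mul_assoc h₁ h₂ h₃ h₄, comp_app, comp_app,
    ← (inL (R.tensor S) T).map_mul, inL_mul_inR, inL_mul_inR]

end GrAlg

end tripleTensor

/-! ### The algebra axioms for the primitives. -/

section primAlgebra

variable {k l : GrRing.{u}} {F : FormalAlgSch k l} {P : Primitives F.mod}

open GrAlg

/-- Multiplication by `η(1)` is an endomorphism of `𝒫(F)` that fixes `η`, since `1` is a unit in
each `F(R)`. The universal property makes it the identity. -/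
lemma IsPrimMul.isLeftUnit {m : Pairing P.obj P.obj P.obj} (hm : IsPrimMul m) :
    IsLeftUnit ((P.unit.app (base k)).app 0 (F.functor.obj (base k)).one) m := by
  let e := (P.unit.app (base k)).app 0 (F.functor.obj (base k)).one
  let σ : P.obj ⟶ P.obj :=
    { app := fun X =>
        { app := fun n => AddMonoidHom.mk' (fun x => (m.bil X.smulBil).app (zero_add n) e x)
            (fun x x' => (m.bil X.smulBil).add_right _ _ _ _)
          map_smul := fun {i j n} h a x => by
            refine ((m.bil X.smulBil).smul_right h (zero_add n) (zero_add j) h a e x).trans ?_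
            rw [mul_zero, Int.negOnePow_zero, one_smul]
            rfl }
      naturality := fun X Y f => GrMod.hom_ext fun n x => by
        refine Eq.trans ?_ (m.toMPair.natural X.smulBil Y.smulBil (𝟙 _) f f (by
          ext i j n h a x
          exact f.map_smul h a x) (zero_add n) e x).symm
        exact congrArg (fun t => (m.bil Y.smulBil).app (zero_add n) t _)
          (map_id_app P.obj (base k).toMod 0 e).symm }
  have hσ : σ = 𝟙 P.obj := by
    refine (P.universal _ P.formal P.unit).unique ?_ ?_
    · ext R : 2
      refine GrMod.hom_ext fun n x => ?_
      refine (hm.eq (R := base k) (S := R) (C := R) R.toMod.smulBil (unit R) (𝟙 R) (𝟙 R.toMod)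
        (fun h r s => rfl) (zero_add n) (F.functor.obj (base k)).one x).trans ?_
      refine (map_id_app P.obj R.toMod n _).trans (congrArg ((P.unit.app R).app n) ?_)
      refine (congrArg₂ ((F.functor.obj R).mul (zero_add n)) (F.functor.map (unit R)).map_one
        (map_id_app F.mod R n x)).trans ?_
      exact (F.functor.obj R).one_mul _ x
    · rfl
  intro X n h x
  exact congrArg (fun t : P.obj ⟶ P.obj => (t.app X).app n x) hσ

/-- Both bracketings are the image, under `η` and the linear map `w`, of a triple product in `F((R ⊗
S) ⊗ T)`. -/
lemma IsPrimMul.assoc_unit {m : Pairing P.obj P.obj P.obj} (hm : IsPrimMul m) {R S T : GrAlg k}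
    {XY YT Z : GrMod k} (f : BilinMap R.toMod S.toMod XY) (g : BilinMap XY T.toMod Z)
    (f' : BilinMap S.toMod T.toMod YT) (g' : BilinMap R.toMod YT Z) (hf : f.Assoc g f' g')
    {i j q ij jq n : ℤ} (h₁ : i + j = ij) (h₂ : ij + q = n) (h₃ : j + q = jq) (h₄ : i + jq = n)
    (x : (F.mod.obj R).carrier i) (y : (F.mod.obj S).carrier j) (z : (F.mod.obj T).carrier q) :
    (m.bil g).app h₂ ((m.bil f).app h₁ ((P.unit.app R).app i x) ((P.unit.app S).app j y))
        ((P.unit.app T).app q z) =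
      (m.bil g').app h₄ ((P.unit.app R).app i x)
        ((m.bil f').app h₃ ((P.unit.app S).app j y) ((P.unit.app T).app q z)) := by
  let w : ((R.tensor S).tensor T).toMod ⟶ Z := desc (R := R.tensor S) (g.pre (desc f) (𝟙 T.toMod))
  have hw : ∀ {ij q n : ℤ} (h : ij + q = n) (c : (R.tensor S).carrier ij) (t : T.carrier q),
      w.app n (tm h c t) = g.app h ((desc f).app ij c) t := fun h c t =>
    desc_tm (R := R.tensor S) (g.pre (desc f) (𝟙 T.toMod)) h c t
  refine (congrArg (fun t => (m.bil g).app h₂ t _) (hm.eq_desc f h₁ x y)).trans ?_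
  refine Eq.trans ?_ (congrArg ((m.bil g').app h₄ _) (hm.eq_desc f' h₃ y z)).symm
  have e₁ := m.toMPair.bil_pre (X := (R.tensor S).toMod) (Y := T.toMod) (X' := XY) (Y' := T.toMod)
    g (desc f) (𝟙 T.toMod) h₂ ((P.unit.app (R.tensor S)).app ij ((F.mulSch.bil _).app h₁
      ((F.mod.map (inL R S)).app i x) ((F.mod.map (inR R S)).app j y))) ((P.unit.app T).app q z)
  have e₂ := m.toMPair.bil_pre (X := R.toMod) (Y := (S.tensor T).toMod) (X' := R.toMod) (Y' := YT)
    g' (𝟙 R.toMod) (desc f') h₄ ((P.unit.app R).app i x) ((P.unit.app (S.tensor T)).app jq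
      ((F.mulSch.bil _).app h₃ ((F.mod.map (inL S T)).app j y) ((F.mod.map (inR S T)).app q z)))
  have e₁' := hm.eq (R := R.tensor S) (S := T) (g.pre (desc f) (𝟙 T.toMod)) (inL _ T) (inR _ T) w
    (fun h r s => (congrArg (w.app _) (inL_mul_inR h r s)).trans (hw h r s)) h₂
    ((F.mulSch.bil _).app h₁ ((F.mod.map (inL R S)).app i x) ((F.mod.map (inR R S)).app j y)) z
  have e₂' := hm.eq (R := R) (S := S.tensor T) (g'.pre (𝟙 R.toMod) (desc f'))
    (inL R S ≫ inL _ T) (inRight R S T) w (fun {a b n} h r s => by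
      induction s using tm_induction with
      | @tm c d hcd s t =>
        refine (congrArg (w.app n) (inL_mul_inRight R S T rfl (by omega) hcd h r s t)).trans ?_
        refine (hw _ _ t).trans ?_
        refine (congrArg (fun v => g.app _ v t) (desc_tm f rfl r s)).trans ?_
        refine (hf rfl _ hcd h r s t).trans ?_
        exact congrArg (g'.app h r) (desc_tm f' hcd s t).symm
      | add t t' ht ht' =>
        rw [map_add, GrRing.mul_add, map_add, ht, ht', BilinMap.add_right]) h₄ x
    ((F.mulSch.bil _).app h₃ ((F.mod.map (inL S T)).app j y) ((F.mod.map (inR S T)).app q z))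
  refine Eq.trans (congrArg ((m.bil g).app h₂ _) (map_id_app P.obj T.toMod q _)).symm ?_
  refine Eq.trans ?_ (congrArg (fun t => (m.bil g').app h₄ t _) (map_id_app P.obj R.toMod i _))
  refine e₁.symm.trans (e₁'.trans (Eq.trans ?_ (e₂'.symm.trans e₂)))
  -- What remains is associativity of the multiplication of `F` over the triple tensor product.
  refine congrArg (fun t => (P.obj.map w).app n ((P.unit.app _).app n t)) ?_
  rw [F.mulSch.natural, F.mulSch.natural, map_comp_app, map_comp_app, map_comp_app, map_comp_app,
    inRight, inL_lift, inR_lift]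
  exact (F.functor.obj _).mul_assoc h₁ h₂ h₃ h₄ _ _ _

variable (hF : FlatCovered (GrAlg.forget k) F.mod) (hP : FlatCovered (𝟭 (GrMod k)) P.obj)

-- The three arguments are replaced in turn by elements in the image of `η`; at each stage the other
-- two are covered by flat modules, through `hP` for an argument in `𝒫(F)` and through `hF` for one
-- already in `F`.
include hF hP in
lemma IsPrimMul.assoc {m : Pairing P.obj P.obj P.obj} (hm : IsPrimMul m) :
    PairingAssoc m m m m := by
  have : m.toMPair.Assoc m.toMPair m.toMPair m.toMPair := by
    refine MPair.Assoc.of_restr_fst P.formal hP hP ?_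
    refine MPair.Assoc.of_restr_snd P.formal hF hP ?_
    refine MPair.Assoc.of_restr_trd (P := P) P.formal hF hF ?_
    intro R S T XY YT Z f g f' g' e i j q ij jq n h₁ h₂ h₃ h₄ x y z
    exact hm.assoc_unit f g f' g' e h₁ h₂ h₃ h₄ x y z
  intro X Y W XY YW Z f g f' g' e
  exact this f g f' g' e

-- The flipped product is again induced by the multiplication of `F`, so uniqueness applies. This
-- commutativity turns statements about left actions into statements about right actions.
include hF hP in
lemma IsPrimMul.flip_eq {m : Pairing P.obj P.obj P.obj} (hm : IsPrimMul m) : m.flip = m :=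
  hm.flip.unique hF hP hm

variable (P) in
/-- The algebra structure on `𝒫(F)`. -/
noncomputable def primAlgebra : BimodAlgebra P.obj where
  one := (P.unit.app (base k)).app 0 (F.functor.obj (base k)).one
  mul := primMul P hF hP
  mul_assoc := (isPrimMul_primMul hF hP).assoc hF hP
  one_mul := (isPrimMul_primMul hF hP).isLeftUnit
  mul_one := by
    have := (isPrimMul_primMul hF hP).isLeftUnit.flip
    rwa [(isPrimMul_primMul hF hP).flip_eq hF hP] at this

include hF hP in
lemma existsUnique_isPrimAlgebra : ∃! A : BimodAlgebra P.obj, IsPrimAlgebra A := by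
  refine ⟨primAlgebra P hF hP, ⟨rfl, isPrimMul_primMul hF hP⟩, fun A hA => ?_⟩
  refine BimodAlgebra.ext hA.one ?_
  exact IsPrimMul.unique hF hP hA.mul (isPrimMul_primMul hF hP)

end primAlgebra

/-! ### Associativity for the universal bilinear maps. -/

section universalTriple

variable {k l : GrRing.{u}} {I J L : Type (u + 1)} [Category.{u} I] [Category.{u} J]
  [Category.{u} L] {V : I ⥤ GrMod k} {U : J ⥤ GrMod k} {W : L ⥤ GrMod k} {A : I ⥤ GrMod l}
  {B : J ⥤ GrMod l} {C : L ⥤ GrMod l} {AB BC D : GrMod k ⥤ GrMod l} {p : MPair V U A B AB}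
  {q : MPair (𝟭 (GrMod k)) W AB C D} {p' : MPair U W B C BC} {q' : MPair V (𝟭 (GrMod k)) A BC D}

/-- Associativity may be checked for the universal bilinear maps. -/
lemma MPair.Assoc.of_tri (h : ∀ {X : I} {Y : J} {T : L} {i j m ij jm n : ℤ} (h₁ : i + j = ij)
    (h₂ : ij + m = n) (h₃ : j + m = jm) (h₄ : i + jm = n) (a : (A.obj X).carrier i)
    (b : (B.obj Y).carrier j) (c : (C.obj T).carrier m),
    triLeft p q (𝟙 (V.obj X)) (𝟙 (U.obj Y)) (𝟙 (W.obj T)) h₁ h₂ a b c =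
      triRight p' q' (𝟙 (V.obj X)) (𝟙 (U.obj Y)) (𝟙 (W.obj T)) h₃ h₄ a b c) :
    p.Assoc q p' q' := by
  intro X Y T XY YT Z f g f' g' e i j m ij jm n h₁ h₂ h₃ h₄ a b c
  have e₁ := triLeft_lift p q f g (𝟙 X) (𝟙 Y) (𝟙 T) (x := 𝟙 (V.obj X)) (y := 𝟙 (U.obj Y))
    (z := 𝟙 (W.obj T)) (𝟙 _) (𝟙 _) (𝟙 _) (by simp) (by simp) (by simp) h₁ h₂ a b c
  have e₂ := triRight_lift p' q' f g f' g' e (𝟙 X) (𝟙 Y) (𝟙 T) (x := 𝟙 (V.obj X))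
    (y := 𝟙 (U.obj Y)) (z := 𝟙 (W.obj T)) (𝟙 _) (𝟙 _) (𝟙 _) (by simp) (by simp) (by simp)
    h₃ h₄ a b c
  rw [map_id_app, map_id_app, map_id_app] at e₁ e₂
  exact e₁.symm.trans ((congrArg _ (h h₁ h₂ h₃ h₄ a b c)).trans e₂)

end universalTriple

/-! ### Maps out of the square-zero extensions by `R ⊗ Y` and `Y ⊗ S`. -/

section sqZeroMaps

variable {k : GrRing.{u}}

namespace GrAlg

/-- The map `k ⊕ R ⊗ Y → C` given by `R → C` and `k ⊕ Y → C`. -/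
def sqZeroLeft {R C : GrAlg k} {Y : GrMod k} (α : R ⟶ C) (β : sqZero Y ⟶ C) :
    sqZero (R.toMod.tensor Y) ⟶ C :=
  sqZeroTensor R Y ≫ lift α β

lemma sqZeroLeft_in {R C : GrAlg k} {Y : GrMod k} (α : R ⟶ C) (β : sqZero Y ⟶ C) {i j n : ℤ}
    (h : i + j = n) (r : R.carrier i) (y : Y.carrier j) :
    (sqZeroLeft α β).app n ((sqZeroIn _).app n (GrMod.tmul (X := R.toMod) h r y)) =
      C.mul h (α.app i r) (β.app j ((sqZeroIn Y).app j y)) := by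
  rw [sqZeroLeft, comp_app, sqZeroTensor_in, tensorIn_tmul, lift_tm]

/-- The map `k ⊕ Y ⊗ S → C` given by `k ⊕ Y → C` and `S → C`. -/
def sqZeroRight {S C : GrAlg k} {Y : GrMod k} (β : sqZero Y ⟶ C) (α : S ⟶ C) :
    sqZero (Y.tensor S.toMod) ⟶ C :=
  sqZeroMap (GrMod.braiding Y S.toMod) ≫ sqZeroLeft α β

lemma sqZeroRight_in {S C : GrAlg k} {Y : GrMod k} (β : sqZero Y ⟶ C) (α : S ⟶ C) {i j n : ℤ}
    (h : i + j = n) (y : Y.carrier i) (s : S.carrier j) :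
    (sqZeroRight β α).app n ((sqZeroIn _).app n (GrMod.tmul (Y := S.toMod) h y s)) =
      C.mul h (β.app i ((sqZeroIn Y).app i y)) (α.app j s) := by
  rw [sqZeroRight, comp_app, sqZeroMap_in]
  refine (congrArg (fun t => (sqZeroLeft α β).app n ((sqZeroIn _).app n t))
    (GrMod.braiding_tmul (Y := S.toMod) h ((add_comm j i).trans h) y s)).trans ?_
  rw [map_zsmul_unit, map_zsmul_unit, sqZeroLeft_in, C.mul_comm h ((add_comm j i).trans h)]

end GrAlg

end sqZeroMaps

/-! ### The action of the primitives on the indecomposables. -/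

section modules

variable {k l : GrRing.{u}} {F : FormalAlgSch k l} {P : Primitives F.mod}

open GrAlg

lemma Pairing.flip_post {B C D D' : GrMod k ⥤ GrMod l} (p : Pairing B C D) (σ : D ⟶ D') :
    p.flip.post σ = (p.post σ).flip :=
  Pairing.ext_app fun {_ _ _} _ {_ _ _} _ _ _ => map_zsmul_unit _ _ _

lemma SchBilin.flip_post {F G H H' : GrAlg k ⥤ GrMod l} (b : SchBilin F G H) (σ : H ⟶ H') :
    b.flip.post σ = (b.post σ).flip := by
  ext R i j n h x y
  exact map_zsmul_unit _ _ _

/-- By flat covers it suffices to look at the image of `F`, where the claim is naturality of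
`indecPair` in the bilinear map. -/
lemma primIndec_post {F G H H' : GrAlg k ⥤ GrMod l} (P : Primitives F) (hH : IsFormal H)
    (hH' : IsFormal H') (hG : IsFormal G) (hQ : FlatCovered (𝟭 (GrMod k)) (indec G))
    (b : SchBilin F G H) (σ : H ⟶ H') :
    (primIndec P hH hG hQ b).post (indecMap σ) = primIndec P hH' hG hQ (b.post σ) :=
  Pairing.ext_app fun f _ _ _ h x y => by
    refine MPair.ext_of_restr P hH'.formal_indec hQ ((primIndec P hH hG hQ b).post
      (indecMap σ)).toMPair (primIndec P hH' hG hQ (b.post σ)).toMPair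
      (fun {R S Z} f i j n h x y => ?_) f h x y
    refine (congrArg (((indecMap σ).app Z).app n) (primIndec_unit P hH hG hQ b f h x y)).trans ?_
    exact (indecPair_post hH hH' b σ f h x y).trans
      (primIndec_unit P hH' hG hQ (b.post σ) f h x y).symm

variable (P) (hQ : FlatCovered (𝟭 (GrMod k)) (indec F.mod))

/-- The action of `𝒫(F)` on `𝒬(F)`. -/
noncomputable def primAct : Pairing P.obj (indec F.mod) (indec F.mod) :=
  primIndec P F.formal F.formal hQ F.mulSch

/-- This is how the action is computed: over any algebra `C` that receives `R`, `k ⊕ Y` and `k ⊕ Z`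
compatibly, acting by `η(x)` becomes multiplication in `F(C)`. -/
lemma primAct_map {R C : GrAlg k} {Y Z : GrMod k}
    (f : BilinMap R.toMod Y Z) (α : R ⟶ C) (β : sqZero Y ⟶ C) (γ : sqZero Z ⟶ C)
    (hγ : ∀ {i j n : ℤ} (h : i + j = n) (r : R.carrier i) (y : Y.carrier j),
      γ.app n ((sqZeroIn Z).app n (f.app h r y)) =
        C.mul h (α.app i r) (β.app j ((sqZeroIn Y).app j y)))
    {i j n : ℤ} (h : i + j = n) (x : (F.mod.obj R).carrier i)
    (y : ((indec F.mod).obj Y).carrier j) :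
    (F.mod.map γ).app n (((primAct P hQ).bil f).app h ((P.unit.app R).app i x) y).1 =
      (F.mulSch.bil C).app h ((F.mod.map α).app i x) ((F.mod.map β).app j y.1) :=
  (congrArg (fun t => (F.mod.map γ).app n t.1)
    (primIndec_unit P F.formal F.formal hQ F.mulSch f h x y)).trans
    (indecPair_map F.formal F.mulSch f α β γ hγ h x y)

lemma primAct_flip_map {S C : GrAlg k} {Y Z : GrMod k}
    (f : BilinMap Y S.toMod Z) (α : S ⟶ C) (β : sqZero Y ⟶ C) (γ : sqZero Z ⟶ C)
    (hγ : ∀ {i j n : ℤ} (h : i + j = n) (y : Y.carrier i) (s : S.carrier j),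
      γ.app n ((sqZeroIn Z).app n (f.app h y s)) =
        C.mul h (β.app i ((sqZeroIn Y).app i y)) (α.app j s))
    {i j n : ℤ} (h : i + j = n) (y : ((indec F.mod).obj Y).carrier i)
    (x : (F.mod.obj S).carrier j) :
    (F.mod.map γ).app n (((primAct P hQ).flip.bil f).app h y ((P.unit.app S).app j x)).1 =
      (F.mulSch.bil C).app h ((F.mod.map β).app i y.1) ((F.mod.map α).app j x) := by
  refine (map_zsmul_unit ((F.mod.map γ).app n) (i * j).negOnePow _).trans ?_
  refine (congrArg (fun t => (i * j).negOnePow • t) (primAct_map P hQ f.flip α β γ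
    (fun {i j n} h s y => ?_) ((add_comm j i).trans h) x y)).trans ?_
  · rw [BilinMap.flip_app f h ((add_comm j i).trans h), map_zsmul_unit, map_zsmul_unit, hγ,
      C.mul_comm h ((add_comm j i).trans h)]
  · exact ((F.functor.obj C).mul_comm h ((add_comm j i).trans h) _ _).symm

lemma primAct_isLeftUnit :
    IsLeftUnit ((P.unit.app (base k)).app 0 (F.functor.obj (base k)).one) (primAct P hQ) := by
  intro X n h x
  refine Subtype.ext ?_
  refine (map_id_app F.mod _ n _).symm.trans ((primAct_map P hQ (R := base k) X.smulBil
    (unit (sqZero X)) (𝟙 _) (𝟙 _) (fun {i j n} h r y => ?_) h _ x).trans ?_)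
  · exact ((sqZeroIn X).map_smul h r y)
  · refine (congrArg₂ ((F.functor.obj (sqZero X)).mul h)
      (F.functor.map (unit (sqZero X))).map_one (map_id_app F.mod _ n x.1)).trans ?_
    exact (F.functor.obj _).one_mul _ _

variable {P}

/-- Over `C` both sides become triple products in the associative algebra `F(C)`; the hypotheses say
that the various square-zero extensions map to `C` compatibly with the bilinear maps. -/
lemma IsPrimMul.assoc_act_map {m : Pairing P.obj P.obj P.obj} (hm : IsPrimMul m) {R S C : GrAlg k}
    {W XY YW Z : GrMod k} (f : BilinMap R.toMod S.toMod XY) (g : BilinMap XY W Z)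
    (f' : BilinMap S.toMod W YW) (g' : BilinMap R.toMod YW Z) (α : R ⟶ C) (α' : S ⟶ C)
    (β : sqZero W ⟶ C) (β' : sqZero YW ⟶ C) (γ : sqZero Z ⟶ C)
    (hβ : ∀ {i j n : ℤ} (h : i + j = n) (s : S.carrier i) (w : W.carrier j),
      β'.app n ((sqZeroIn YW).app n (f'.app h s w)) =
        C.mul h (α'.app i s) (β.app j ((sqZeroIn W).app j w)))
    (hγ : ∀ {i j n : ℤ} (h : i + j = n) (r : R.carrier i) (t : YW.carrier j),
      γ.app n ((sqZeroIn Z).app n (g'.app h r t)) =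
        C.mul h (α.app i r) (β'.app j ((sqZeroIn YW).app j t)))
    (hγ' : ∀ {i j q ij n : ℤ} (h₁ : i + j = ij) (h₂ : ij + q = n) (r : R.carrier i)
      (s : S.carrier j) (w : W.carrier q),
      γ.app n ((sqZeroIn Z).app n (g.app h₂ (f.app h₁ r s) w)) =
        C.mul h₂ (C.mul h₁ (α.app i r) (α'.app j s)) (β.app q ((sqZeroIn W).app q w)))
    {i j q ij jq n : ℤ} (h₁ : i + j = ij) (h₂ : ij + q = n) (h₃ : j + q = jq)
    (h₄ : i + jq = n) (x : (F.mod.obj R).carrier i) (y : (F.mod.obj S).carrier j)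
    (z : ((indec F.mod).obj W).carrier q) :
    (F.mod.map γ).app n (((primAct P hQ).bil g).app h₂ ((m.bil f).app h₁ ((P.unit.app R).app i x)
        ((P.unit.app S).app j y)) z).1 =
      (F.mod.map γ).app n (((primAct P hQ).bil g').app h₄ ((P.unit.app R).app i x)
        (((primAct P hQ).bil f').app h₃ ((P.unit.app S).app j y) z)).1 := by
  rw [hm.eq_desc f h₁ x y, primAct_map P hQ g' α β' γ hγ, primAct_map P hQ f' α' β β' hβ]
  have e := (primAct P hQ).toMPair.bil_pre (X := (R.tensor S).toMod) (X' := XY) (Y := W) (Y' := W)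
    g (desc f) (𝟙 W) h₂ ((P.unit.app (R.tensor S)).app ij ((F.mulSch.bil _).app h₁
      ((F.mod.map (inL R S)).app i x) ((F.mod.map (inR R S)).app j y))) z
  have e' := primAct_map P hQ (R := R.tensor S) (g.pre (desc f) (𝟙 W)) (lift α α') β γ
    (fun {i j n} h t w => by
      induction t using tm_induction with
      | @tm c d hcd r s =>
        rw [lift_tm, ← hγ']
        exact congrArg (fun v => γ.app n ((sqZeroIn Z).app n (g.app h v w))) (desc_tm f hcd r s)
      | add t t' ht ht' =>
        rw [BilinMap.add_left, map_add, map_add, map_add, GrRing.add_mul, ht, ht']) h₂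
    ((F.mulSch.bil _).app h₁ ((F.mod.map (inL R S)).app i x) ((F.mod.map (inR R S)).app j y)) z
  have e'' := (congrArg (((primAct P hQ).bil g).app h₂ (((primPair P).bil f).app h₁ x y))
    (map_id_app (indec F.mod) W q z)).symm.trans e.symm
  refine (congrArg (fun t => (F.mod.map γ).app n (Subtype.val t)) e'').trans (e'.trans ?_)
  rw [F.mulSch.natural, map_comp_app, map_comp_app, inL_lift, inR_lift]
  exact (F.functor.obj C).mul_assoc h₁ h₂ h₃ h₄ _ _ _

lemma assoc_act_flip_map {R S C : GrAlg k}
    {Y XY YS Z : GrMod k} (f : BilinMap R.toMod Y XY) (g : BilinMap XY S.toMod Z)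
    (f' : BilinMap Y S.toMod YS) (g' : BilinMap R.toMod YS Z) (α : R ⟶ C) (α' : S ⟶ C)
    (β : sqZero Y ⟶ C) (β₁ : sqZero XY ⟶ C) (β₂ : sqZero YS ⟶ C) (γ : sqZero Z ⟶ C)
    (hβ₁ : ∀ {i j n : ℤ} (h : i + j = n) (r : R.carrier i) (y : Y.carrier j),
      β₁.app n ((sqZeroIn XY).app n (f.app h r y)) =
        C.mul h (α.app i r) (β.app j ((sqZeroIn Y).app j y)))
    (hβ₂ : ∀ {i j n : ℤ} (h : i + j = n) (y : Y.carrier i) (s : S.carrier j),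
      β₂.app n ((sqZeroIn YS).app n (f'.app h y s)) =
        C.mul h (β.app i ((sqZeroIn Y).app i y)) (α'.app j s))
    (hγ : ∀ {i j n : ℤ} (h : i + j = n) (r : R.carrier i) (t : YS.carrier j),
      γ.app n ((sqZeroIn Z).app n (g'.app h r t)) =
        C.mul h (α.app i r) (β₂.app j ((sqZeroIn YS).app j t)))
    (hγ' : ∀ {i j n : ℤ} (h : i + j = n) (t : XY.carrier i) (s : S.carrier j),
      γ.app n ((sqZeroIn Z).app n (g.app h t s)) =
        C.mul h (β₁.app i ((sqZeroIn XY).app i t)) (α'.app j s))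
    {i j q ij jq n : ℤ} (h₁ : i + j = ij) (h₂ : ij + q = n) (h₃ : j + q = jq)
    (h₄ : i + jq = n) (x : (F.mod.obj R).carrier i) (y : ((indec F.mod).obj Y).carrier j)
    (z : (F.mod.obj S).carrier q) :
    (F.mod.map γ).app n (((primAct P hQ).flip.bil g).app h₂ (((primAct P hQ).bil f).app h₁
        ((P.unit.app R).app i x) y) ((P.unit.app S).app q z)).1 =
      (F.mod.map γ).app n (((primAct P hQ).bil g').app h₄ ((P.unit.app R).app i x)
        (((primAct P hQ).flip.bil f').app h₃ y ((P.unit.app S).app q z))).1 := by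
  rw [primAct_flip_map P hQ g α' β₁ γ hγ', primAct_map P hQ f α β β₁ hβ₁,
    primAct_map P hQ g' α β₂ γ hγ, primAct_flip_map P hQ f' α' β β₂ hβ₂]
  exact (F.functor.obj C).mul_assoc h₁ h₂ h₃ h₄ _ _ _

end modules

/-! ### Square-zero extensions inside triple tensor products. -/

section tripleSqZero

variable {k : GrRing.{u}}

namespace GrAlg

/-- The map `k ⊕ (R ⊗ S) ⊗ W → (R ⊗ S) ⊗ (k ⊕ W)`. -/
def sqZeroTriLeft (R S : GrAlg k) (W : GrMod k) :
    sqZero ((R.toMod.tensor S.toMod).tensor W) ⟶ (R.tensor S).tensor (sqZero W) :=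
  sqZeroMap (GrMod.tensorHom (GrMod.tensorLift (tmBil R S)) (𝟙 W)) ≫ sqZeroTensor (R.tensor S) W

lemma sqZeroTriLeft_in (R S : GrAlg k) (W : GrMod k) {i j n : ℤ} (h : i + j = n)
    (t : (R.toMod.tensor S.toMod).carrier i) (w : W.carrier j) :
    (sqZeroTriLeft R S W).app n ((sqZeroIn _).app n (GrMod.tmul h t w)) =
      tm h ((GrMod.tensorLift (tmBil R S)).app i t) ((sqZeroIn W).app j w) := by
  rw [sqZeroTriLeft, comp_app, sqZeroMap_in, sqZeroTensor_in, GrMod.tensorHom_tmul]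
  exact tensorIn_tmul (R.tensor S) W h _ w

lemma tensorLift_tmBil (R S : GrAlg k) {i j n : ℤ} (h : i + j = n) (r : R.carrier i)
    (s : S.carrier j) : (GrMod.tensorLift (tmBil R S)).app n
      (GrMod.tmul (X := R.toMod) (Y := S.toMod) h r s) = tm h r s := by
  rw [GrMod.tensorLift_tmul (X := R.toMod) (Y := S.toMod) (tmBil R S) h r s, tmBil_app]

lemma toTensor_tensorLift (R S : GrAlg k) (n : ℤ) (t : (R.toMod.tensor S.toMod).carrier n) :
    (toTensor R S).app n ((GrMod.tensorLift (tmBil R S)).app n t) = t := by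
  induction t using GrMod.tensor_induction with
  | tmul h r s => exact tensorLift_tmBil R S h r s
  | add t t' ht ht' => rw [map_add, map_add, ht, ht']

/-- The projection `(R ⊗ S) ⊗ (k ⊕ W) → (R ⊗ S) ⊗ W` provides a left inverse on the square-zero
part. -/
lemma sqZeroTriLeft_injective (R S : GrAlg k) (W : GrMod k) (n : ℤ)
    (s t : ((R.toMod.tensor S.toMod).tensor W).carrier n)
    (e : (sqZeroTriLeft R S W).app n ((sqZeroIn _).app n s) =
      (sqZeroTriLeft R S W).app n ((sqZeroIn _).app n t)) : s = t := by
  have key : ∀ s : ((R.toMod.tensor S.toMod).tensor W).carrier n,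
      (GrMod.tensorHom (toTensor R S) (𝟙 W)).app n ((tensorSnd (R.tensor S) W).app n
        ((sqZeroTriLeft R S W).app n ((sqZeroIn _).app n s))) = s := by
    intro s
    induction s using GrMod.tensor_induction with
    | @tmul a b h t w =>
      rw [sqZeroTriLeft_in]
      refine (congrArg ((GrMod.tensorHom (toTensor R S) (𝟙 W)).app n)
        (desc_tm (R := R.tensor S) _ h _ _)).trans ?_
      refine (GrMod.tensorHom_tmul (X := (R.tensor S).toMod) _ _ h _ _).trans ?_
      exact congrArg (fun v => GrMod.tmul h v w) (toTensor_tensorLift R S a t)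
    | add t t' ht ht' => rw [map_add, map_add, map_add, map_add, ht, ht']
  rw [← key s, e, key]

/-- The map `k ⊕ (R ⊗ Y) ⊗ S → (R ⊗ (k ⊕ Y)) ⊗ S`. -/
def sqZeroTriMid (R : GrAlg k) (Y : GrMod k) (S : GrAlg k) :
    sqZero ((R.toMod.tensor Y).tensor S.toMod) ⟶ (R.tensor (sqZero Y)).tensor S :=
  sqZeroRight (sqZeroTensor R Y ≫ inL _ S) (inR _ S)

lemma sqZeroTriMid_injective (R : GrAlg k) (Y : GrMod k) (S : GrAlg k) (n : ℤ)
    (s t : ((R.toMod.tensor Y).tensor S.toMod).carrier n)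
    (e : (sqZeroTriMid R Y S).app n ((sqZeroIn _).app n s) =
      (sqZeroTriMid R Y S).app n ((sqZeroIn _).app n t)) : s = t := by
  have key : ∀ s : ((R.toMod.tensor Y).tensor S.toMod).carrier n,
      (GrMod.tensorHom (tensorSnd R Y) (𝟙 S.toMod)).app n ((toTensor (R.tensor (sqZero Y)) S).app n
        ((sqZeroTriMid R Y S).app n ((sqZeroIn _).app n s))) = s := by
    intro s
    induction s using GrMod.tensor_induction with
    | @tmul a b h t w =>
      rw [sqZeroTriMid, sqZeroRight_in, comp_app, inL_mul_inR, sqZeroTensor_in]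
      refine (GrMod.tensorHom_tmul (X := (R.tensor (sqZero Y)).toMod) (Y := S.toMod) _ _ h _ _).trans
        ?_
      exact congrArg (fun v => GrMod.tmul (Y := S.toMod) h v w) (tensorIn_tensorSnd R Y a t)
    | add t t' ht ht' => rw [map_add, map_add, map_add, map_add, ht, ht']
  rw [← key s, e, key]

end GrAlg

end tripleSqZero

/-! ### The module axioms. -/

section twoSidedModule

variable {k l : GrRing.{u}} {F : FormalAlgSch k l} {P : Primitives F.mod}

open GrAlg

variable (hF : FlatCovered (GrAlg.forget k) F.mod) (hP : FlatCovered (𝟭 (GrMod k)) P.obj)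
  (hQ : FlatCovered (𝟭 (GrMod k)) (indec F.mod))

-- The two arguments in `𝒫(F)` are reduced to the image of `η`; the third stays in `𝒬(F)(W)`. Both
-- sides are then compared in `(R ⊗ S) ⊗ (k ⊕ W)`, into which `(R ⊗ S) ⊗ W` embeds.
include hF hP in
lemma IsPrimMul.act_assoc {m : Pairing P.obj P.obj P.obj} (hm : IsPrimMul m) :
    m.toMPair.Assoc (primAct P hQ).toMPair (primAct P hQ).toMPair (primAct P hQ).toMPair := by
  have hD := F.formal.formal_indec
  refine MPair.Assoc.of_restr_fst hD hP hQ ?_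
  refine MPair.Assoc.of_restr_snd hD hF hQ ?_
  refine MPair.Assoc.of_tri ?_
  intro R S W i j q ij jq n h₁ h₂ h₃ h₄ x y z
  refine F.formal.indec_injective (sqZeroTriLeft R S W) (sqZeroTriLeft_injective R S W) ?_
  refine hm.assoc_act_map hQ ((GrMod.tmulBil R.toMod S.toMod).pre (𝟙 _) (𝟙 _))
    ((GrMod.tmulBil (R.toMod.tensor S.toMod) W).pre (𝟙 _) (𝟙 W))
    ((GrMod.tmulBil S.toMod W).pre (𝟙 _) (𝟙 W))
    ((GrMod.assocBil R.toMod S.toMod W).pre (𝟙 _) (𝟙 _))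
    (inL R S ≫ inL _ _) (inR R S ≫ inL _ _) (inR _ _) (sqZeroTensor S W ≫ inRight R S (sqZero W))
    (sqZeroTriLeft R S W) (fun {i j n} h s w => ?_) (fun {i j n} h r t => ?_)
    (fun {i j q ij n} h₁ h₂ r s w => ?_) h₁ h₂ h₃ h₄ x y z
  · refine (congrArg ((inRight R S (sqZero W)).app n) ((sqZeroTensor_in S W n _).trans
      (tensorIn_tmul S W h s w))).trans ?_
    exact lift_tm _ _ h s _
  · change (sqZeroTriLeft R S W).app n ((sqZeroIn _).app n
      ((GrMod.assocBil R.toMod S.toMod W).app h r t)) = _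
    induction t using GrMod.tensor_induction with
    | @tmul a b hab s w =>
      have hc : (sqZeroTensor S W ≫ inRight R S (sqZero W)).app j ((sqZeroIn _).app j
          (GrMod.tmul (X := S.toMod) hab s w)) =
            (inRight R S (sqZero W)).app j (tm hab s ((sqZeroIn W).app b w)) := by
        rw [comp_app, sqZeroTensor_in, tensorIn_tmul]
      rw [hc]
      refine Eq.trans ?_ (inL_mul_inRight R S _ rfl (by omega) hab h r s _).symm
      rw [GrMod.assocBil_tmul rfl (show i + a + b = n by omega), sqZeroTriLeft_in, tensorLift_tmBil]
    | add t t' ht ht' =>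
      rw [BilinMap.add_right, map_add, map_add, map_add, map_add, GrRing.mul_add, ht, ht']
  · refine (sqZeroTriLeft_in R S W h₂ _ w).trans ?_
    refine (congrArg (fun v => tm h₂ v _) (tensorLift_tmBil R S h₁ r s)).trans ?_
    rw [comp_app, comp_app, ← (inL (R.tensor S) (sqZero W)).map_mul, inL_mul_inR, inL_mul_inR]

-- Now the outer arguments are reduced to the image of `η`, and the comparison takes place in `(R ⊗
-- (k ⊕ Y)) ⊗ S`.
include hF hP in
lemma primAct_assoc_flip :
    (primAct P hQ).toMPair.Assoc (primAct P hQ).flip.toMPair (primAct P hQ).flip.toMPair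
      (primAct P hQ).toMPair := by
  have hD := F.formal.formal_indec
  refine MPair.Assoc.of_restr_fst hD hQ hP ?_
  refine MPair.Assoc.of_restr_trd (P := P) hD hF hQ ?_
  refine MPair.Assoc.of_tri ?_
  intro R Y S i j q ij jq n h₁ h₂ h₃ h₄ x y z
  refine F.formal.indec_injective (sqZeroTriMid R Y S) (sqZeroTriMid_injective R Y S) ?_
  refine assoc_act_flip_map hQ ((GrMod.tmulBil R.toMod Y).pre (𝟙 _) (𝟙 Y))
    ((GrMod.tmulBil (R.toMod.tensor Y) S.toMod).pre (𝟙 _) (𝟙 _))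
    ((GrMod.tmulBil Y S.toMod).pre (𝟙 Y) (𝟙 _))
    ((GrMod.assocBil R.toMod Y S.toMod).pre (𝟙 _) (𝟙 _))
    (inL R (sqZero Y) ≫ inL _ S) (inR _ S) (inR R (sqZero Y) ≫ inL _ S)
    (sqZeroTensor R Y ≫ inL _ S) (sqZeroRight (inR R (sqZero Y) ≫ inL _ S) (inR _ S))
    (sqZeroTriMid R Y S) (fun {i j n} h r y => ?_) (fun {i j n} h y s => ?_)
    (fun {i j n} h r t => ?_) (fun {i j n} h t s => ?_) h₁ h₂ h₃ h₄ x y z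
  · refine (congrArg ((inL _ S).app n) ((sqZeroTensor_in R Y n _).trans
      (tensorIn_tmul R Y h r y))).trans ?_
    rw [comp_app, comp_app, ← (inL (R.tensor (sqZero Y)) S).map_mul, inL_mul_inR]
  · exact sqZeroRight_in _ _ h y s
  · change (sqZeroTriMid R Y S).app n ((sqZeroIn _).app n
      ((GrMod.assocBil R.toMod Y S.toMod).app h r t)) = _
    induction t using GrMod.tensor_induction with
    | @tmul a b hab y s =>
      rw [GrMod.assocBil_tmul rfl (show i + a + b = n by omega), sqZeroTriMid]
      refine (sqZeroRight_in _ _ _ _ _).trans (Eq.trans ?_ (congrArg _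
        (sqZeroRight_in _ _ hab y s)).symm)
      rw [← ((R.tensor (sqZero Y)).tensor S).mul_assoc rfl (show i + a + b = n by omega) hab h,
        comp_app, comp_app, comp_app, ← (inL (R.tensor (sqZero Y)) S).map_mul, sqZeroTensor_in,
        tensorIn_tmul, inL_mul_inR, inL_mul_inR, inL_mul_inR]
    | add t t' ht ht' =>
      rw [BilinMap.add_right, map_add, map_add, map_add, map_add, GrRing.mul_add, ht, ht']
  · exact sqZeroRight_in _ _ h t s

include hF hP in
/-- The indecomposables are a two-sided module over the primitives. -/
lemma isTwoSidedModule_primAct {A : BimodAlgebra P.obj} (hA : IsPrimAlgebra A) :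
    IsTwoSidedModule A (primAct P hQ) (primAct P hQ).flip := by
  have hm : IsPrimMul A.mul := hA.mul
  have h₁ := hm.act_assoc hF hP hQ
  -- Associativity of the right action is the reversed form of that of the left action, once the
  -- flipped product of `A` is identified with the product itself.
  have h₂ := h₁.flip
  have e : A.mul.toMPair.flip = A.mul.toMPair :=
    congrArg Pairing.toMPair (hm.flip_eq hF hP)
  rw [e] at h₂
  have h₃ := primAct_assoc_flip (P := P) hF hP hQ
  refine ⟨?_, ?_, ?_, ?_, ?_⟩
  · rw [hA.one]
    exact primAct_isLeftUnit P hQ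
  · rw [hA.one]
    exact (primAct_isLeftUnit P hQ).flip
  · intro X Y W XY YW Z f g f' g' e
    exact h₁ f g f' g' e
  · intro X Y W XY YW Z f g f' g' e
    exact h₂ f g f' g' e
  · intro X Y W XY YW Z f g f' g' e
    exact h₃ f g f' g' e

end twoSidedModule

/-! ### The factorization and the conclusion. -/

section mainResult

variable {k l : GrRing.{u}}

/-- The two extensions of the lax structure agree on `𝒬(F) × 𝒬(G)`, so they glue. The restrictions
of `σ` to both corners are recorded because they become the two actions. -/
lemma exists_factorization {F G H : GrAlg k ⥤ GrMod l} (PF : Primitives F) (PG : Primitives G)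
    (hF : IsFormal F) (hG : IsFormal G) (hH : IsFormal H) (hQF : FlatCovered (𝟭 (GrMod k)) (indec F))
    (hQG : FlatCovered (𝟭 (GrMod k)) (indec G)) (b : SchBilin F G H)
    (QQ : BimodTensor (indec F) (indec G)) (QP : BimodTensor (indec F) PG.obj)
    (PQ : BimodTensor PF.obj (indec G))
    (E : FormalPushout (QQ.map QP (𝟙 (indec F)) PG.fromIndec)
      (QQ.map PQ PF.fromIndec (𝟙 (indec G)))) :
    ∃ σ : E.obj ⟶ indec H,
      QP.pairing.post (E.inl ≫ σ) = (primIndec PG hH hF hQF b.flip).flip ∧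
      PQ.pairing.post (E.inr ≫ σ) = primIndec PF hH hG hQG b ∧
      QQ.pairing.post (QQ.map QP (𝟙 (indec F)) PG.fromIndec ≫ E.inl ≫ σ) = laxPairing hH b :=
  E.exists_of_pairings PF.fromIndec PG.fromIndec QQ QP PQ hH.formal_indec _ _ _
    (primIndec_flip_pre PG hH hF hQF b) (primIndec_pre PF hH hG hQG b)

end mainResult

end FormalPlethory

theorem mainTheorem11 (k l : GrRing.{u}) :
    (∀ (F G : FormalAlgSch k l) (PF : Primitives F.mod) (PG : Primitives G.mod),
      IsProFlatSch F.mod → IsProFlatSch G.mod →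
      IsProFlatBimod PF.obj → IsProFlatBimod PG.obj →
      IsProFlatBimod (indec F.mod) → IsProFlatBimod (indec G.mod) →
      ∀ (T : SchTensor F.mod G.mod)
        (QQ : BimodTensor (indec F.mod) (indec G.mod))
        (QP : BimodTensor (indec F.mod) PG.obj)
        (PQ : BimodTensor PF.obj (indec G.mod))
        (E : FormalPushout (QQ.map QP (𝟙 (indec F.mod)) PG.fromIndec)
          (QQ.map PQ PF.fromIndec (𝟙 (indec G.mod)))),
        (∃! φ : Pairing (indec F.mod) (indec G.mod) (indec T.obj), IsLax T φ) ∧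
        ∀ φ : Pairing (indec F.mod) (indec G.mod) (indec T.obj), IsLax T φ →
          ∃ σ : E.obj ⟶ indec T.obj,
            QQ.pairing.post (QQ.map QP (𝟙 (indec F.mod)) PG.fromIndec ≫ E.inl ≫ σ) = φ) ∧
    (∀ (F : FormalAlgSch k l) (PF : Primitives F.mod),
      IsProFlatSch F.mod → IsProFlatBimod PF.obj → IsProFlatBimod (indec F.mod) →
      (∃! A : BimodAlgebra PF.obj, IsPrimAlgebra A) ∧
      ∀ A : BimodAlgebra PF.obj, IsPrimAlgebra A →
        ∀ (T : SchTensor F.mod F.mod)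
          (QQ : BimodTensor (indec F.mod) (indec F.mod))
          (QP : BimodTensor (indec F.mod) PF.obj)
          (PQ : BimodTensor PF.obj (indec F.mod))
          (E : FormalPushout (QQ.map QP (𝟙 (indec F.mod)) PF.fromIndec)
            (QQ.map PQ PF.fromIndec (𝟙 (indec F.mod))))
          (φ : Pairing (indec F.mod) (indec F.mod) (indec T.obj)), IsLax T φ →
          ∃ σ : E.obj ⟶ indec T.obj,
            QQ.pairing.post (QQ.map QP (𝟙 (indec F.mod)) PF.fromIndec ≫ E.inl ≫ σ) = φ ∧
            IsTwoSidedModule A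
              (PQ.pairing.post (E.inr ≫ σ ≫ indecMap (F.mulMap T)))
              (QP.pairing.post (E.inl ≫ σ ≫ indecMap (F.mulMap T)))) := by
  refine ⟨fun F G PF PG _ _ _ _ hQF hQG T QQ QP PQ E => ⟨⟨laxPairing T.formal T.bilin,
    isLax_laxPairing T, fun φ hφ => IsLax.eq_laxPairing hφ⟩, fun φ hφ => ?_⟩,
    fun F PF hF hP hQ => ⟨existsUnique_isPrimAlgebra hF.flatCovered hP.flatCovered,
      fun A hA T QQ QP PQ E φ hφ => ?_⟩⟩
  · obtain ⟨σ, -, -, h⟩ := exists_factorization PF PG F.formal G.formal T.formal hQF.flatCovered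
      hQG.flatCovered T.bilin QQ QP PQ E
    exact ⟨σ, h.trans (IsLax.eq_laxPairing hφ).symm⟩
  · obtain ⟨σ, h₁, h₂, h⟩ := exists_factorization PF PF F.formal F.formal T.formal hQ.flatCovered
      hQ.flatCovered T.bilin QQ QP PQ E
    refine ⟨σ, h.trans (IsLax.eq_laxPairing hφ).symm, ?_⟩
    -- Composing with the multiplication `F ⊗ F → F` replaces the universal bilinear map by the
    -- product of `F`. Since that product is commutative, the corner `𝒬 × 𝒫` gives the flip of the
    -- left action.
    have e₁ : QP.pairing.post (E.inl ≫ σ ≫ indecMap (F.mulMap T)) =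
        (primAct PF hQ.flatCovered).flip := by
      rw [← Category.assoc, ← Pairing.post_post, h₁, Pairing.flip_post,
        primIndec_post PF T.formal F.formal, SchBilin.flip_post, F.bilin_post_mulMap, F.mulSch_flip]
      rfl
    have e₂ : PQ.pairing.post (E.inr ≫ σ ≫ indecMap (F.mulMap T)) =
        primAct PF hQ.flatCovered := by
      rw [← Category.assoc, ← Pairing.post_post, h₂, primIndec_post PF T.formal F.formal,
        F.bilin_post_mulMap]
      rfl
    rw [e₁, e₂]
    exact isTwoSidedModule_primAct hF.flatCovered hP.flatCovered hQ.flatCovered hA
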